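/- Let $R$ be an associative ring with unit, let $\mathbf{t}=(\mathcal{T},\mathcal{F})$ be a torsion pair in the category $R\text{-Mod}$ of left $R$-modules, and write $t(M)$ for the torsion submodule of a module $M$. Let $\mathcal{H}_{\mathbf{t}}$ be the heart of the associated Happel–Reiten–Smalø t-structure, i.e. the full subcategory of the derived category $\mathcal{D}(R)$ consisting of the complexes $M$ with $H^{k}(M)=0$ for $k\neq -1,0$, $H^{-1}(M)\in\mathcal{F}$ and $H^{0}(M)\in\mathcal{T}$. Then $\mathcal{H}_{\mathbf{t}}$ is a module category (i.e. it is equivalent to $S\text{-Mod}$ for some ring $S$ with unit) if, and only if, there is a complex of $R$-modules $$G:\quad \cdots\to 0\to X\xrightarrow{\;j\;}Q\xrightarrow{\;d\;}P\to 0\to\cdots$$ with $P$ in degree $0$ satisfying the following properties, where $V:=H^{0}(G)=\operatorname{Coker}(d)$: 1. $\mathcal{T}=\operatorname{Pres}(V)\subseteq\operatorname{Ker}(\operatorname{Ext}^{1}_{R}(V,-))$; 2. $Q$ and $P$ are finitely generated projective $R$-modules, and $j$ is a monomorphism such that $H^{-1}(G)\in\mathcal{F}$; 3. $H^{-1}(G)\subseteq\operatorname{Rej}_{\mathcal{T}}(Q/X)$,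 where $X$ is viewed as a submodule of $Q$ via $j$ and $H^{-1}(G)=\operatorname{Ker}(d)/X\subseteq Q/X$; 4. $\operatorname{Ext}^{1}_{R}(\operatorname{Coker}(j),-)$ vanishes on $\mathcal{F}$; 5. there are a set $I$ and a homomorphism $h:(Q/X)^{(I)}\to R/t(R)$ such that the cokernel of the restriction of $h$ to $H^{-1}(G)^{(I)}$ belongs to $\overline{\operatorname{Gen}}(V)$. Here $\operatorname{Pres}(V)$ is the class of modules $M$ that admit an exact sequence $V^{(J)}\to V^{(I)}\to M\to 0$ for some sets $I,J$; $\overline{\operatorname{Gen}}(V)$ is the class of $V$-subgenerated modules, i.e. those isomorphic to a submodule of an epimorphic image of some coproduct $V^{(I)}$; and $\operatorname{Rej}_{\mathcal{T}}(M)$ is the intersection of the kernels of all homomorphisms $M\to T$ with $T\in\mathcal{T}$. -/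

import Mathlib

open CategoryTheory

universe w u

/-- A torsion pair in an abelian category. The two classes are full subcategories, given as
isomorphism-closed properties of objects. -/
structure TorsionPair (C : Type*) [Category* C] [Abelian C] where
  /-- the torsion class -/
  T : ObjectProperty C
  /-- the torsion-free class -/
  F : ObjectProperty C
  T_iso : T.IsClosedUnderIsomorphisms
  F_iso : F.IsClosedUnderIsomorphisms
  hom_eq_zero : ∀ (A B : C) (f : A ⟶ B), T A → F B → f = 0
  exists_shortExact : ∀ M : C, ∃ (A B : C) (i : A ⟶ M) (p : M ⟶ B) (hip : i ≫ p = 0),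
    T A ∧ F B ∧ (ShortComplex.mk i p hip).ShortExact

namespace TorsionPair

section Heart

variable {C : Type*} [Category* C] [Abelian C] [HasDerivedCategory.{w} C] (t : TorsionPair C)

/-- The aisle of the Happel–Reiten–Smalø t-structure: the objects of `D^{≤ 0}` whose
zeroth homology is torsion. -/
def aisle : ObjectProperty (DerivedCategory C) := fun K =>
  K.IsLE 0 ∧ t.T ((DerivedCategory.homologyFunctor C 0).obj K)

/-- The co-aisle of the Happel–Reiten–Smalø t-structure: the objects of `D^{≥ -1}` whose
homology in degree `-1` is torsion-free. -/
def coaisle : ObjectProperty (DerivedCategory C) := fun K =>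
  K.IsGE (-1) ∧ t.F ((DerivedCategory.homologyFunctor C (-1)).obj K)

/-- The objects of the heart of the Happel–Reiten–Smalø t-structure. -/
def heart : ObjectProperty (DerivedCategory C) := t.aisle ⊓ t.coaisle

/-- The heart, as a full subcategory of the derived category. -/
abbrev Heart := t.heart.FullSubcategory

end Heart

section Modules

variable {R : Type u} [Ring R] (t : TorsionPair (ModuleCat.{u} R))

/-- The torsion submodule `t(M)`: the largest submodule of `M` that lies in the torsion class
(see `torsion_mem` and `quotient_torsion_mem`). -/
def torsion (M : Type u) [AddCommGroup M] [Module R M] : Submodule R M :=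
  sSup {N | t.T (ModuleCat.of R N)}

theorem torsion_eq_range {M A B : ModuleCat.{u} R} (i : A ⟶ M) (p : M ⟶ B) (hip : i ≫ p = 0)
    (hA : t.T A) (hB : t.F B) (h : (ShortComplex.mk i p hip).ShortExact) :
    t.torsion M = LinearMap.range i.hom := by
  have := t.T_iso
  have hmono : Function.Injective i.hom := (ModuleCat.mono_iff_injective i).1 h.mono_f
  apply le_antisymm
  · refine sSup_le fun N hN x hx => ?_
    have h0 := t.hom_eq_zero _ _ (ModuleCat.ofHom N.subtype ≫ p) hN hB
    have hx0 : p.hom x = 0 := congrArg (fun f => f.hom ⟨x, hx⟩) h0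
    exact (ShortComplex.moduleCat_exact_iff _).1 h.exact x hx0
  · refine le_sSup ?_
    exact t.T.prop_of_iso (LinearEquiv.toModuleIso (LinearEquiv.ofInjective i.hom hmono)) hA

theorem torsion_mem (M : ModuleCat.{u} R) : t.T (ModuleCat.of R (t.torsion M)) := by
  have := t.T_iso
  obtain ⟨A, B, i, p, hip, hA, hB, h⟩ := t.exists_shortExact M
  have hmono : Function.Injective i.hom := (ModuleCat.mono_iff_injective i).1 h.mono_f
  rw [t.torsion_eq_range i p hip hA hB h]
  exact t.T.prop_of_iso (LinearEquiv.toModuleIso (LinearEquiv.ofInjective i.hom hmono)) hA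

theorem quotient_torsion_mem (M : ModuleCat.{u} R) :
    t.F (ModuleCat.of R (M ⧸ t.torsion M)) := by
  have := t.F_iso
  obtain ⟨A, B, i, p, hip, hA, hB, h⟩ := t.exists_shortExact M
  have hepi : Function.Surjective p.hom := (ModuleCat.epi_iff_surjective p).1 h.epi_g
  have hex : LinearMap.range i.hom = LinearMap.ker p.hom :=
    (ShortComplex.moduleCat_exact_iff_range_eq_ker _).1 h.exact
  rw [t.torsion_eq_range i p hip hA hB h, hex]
  exact t.F.prop_of_iso
    (LinearEquiv.toModuleIso (p.hom.quotKerEquivOfSurjective hepi)).symm hB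

end Modules

end TorsionPair

/-- A category is a module category if it is equivalent to the category of left modules over
some (unital, associative) ring. -/
def IsModuleCategory (H : Type*) [Category* H] : Prop :=
  ∃ (S : Type u) (_ : Ring S), Nonempty (H ≌ ModuleCat.{u} S)

section ModuleClasses

variable {R : Type u} [Ring R]

/-- `V`-generated modules: there is an epimorphism `V^(I) → M`. -/
def Gen (V : ModuleCat.{u} R) : ObjectProperty (ModuleCat.{u} R) := fun M =>
  ∃ (I : Type u) (p : (I →₀ V) →ₗ[R] M), Function.Surjective p

/-- `V`-presented modules: there is an exact sequence `V^(J) → V^(I) → M → 0`. -/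
def Pres (V : ModuleCat.{u} R) : ObjectProperty (ModuleCat.{u} R) := fun M =>
  ∃ (I J : Type u) (f : (J →₀ V) →ₗ[R] (I →₀ V)) (p : (I →₀ V) →ₗ[R] M),
    Function.Exact f p ∧ Function.Surjective p

/-- `V`-subgenerated modules: those isomorphic to a submodule of a `V`-generated module. -/
def SubGen (V : ModuleCat.{u} R) : ObjectProperty (ModuleCat.{u} R) := fun M =>
  ∃ (N : ModuleCat.{u} R) (i : M →ₗ[R] N), Gen V N ∧ Function.Injective i

/-- The kernel of `Ext¹(V, ?)`. -/
def KerExtOne (V : ModuleCat.{u} R) : ObjectProperty (ModuleCat.{u} R) := fun M =>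
  Subsingleton (Abelian.Ext V M 1)

/-- The reject of a class of modules in `M`: the intersection of the kernels of all
homomorphisms from `M` to a module of the class. -/
def reject (S : ObjectProperty (ModuleCat.{u} R)) (M : Type u) [AddCommGroup M] [Module R M] :
    Submodule R M :=
  ⨅ (N : ModuleCat.{u} R) (_ : S N) (f : M →ₗ[R] N), LinearMap.ker f

end ModuleClasses

/-- A complex `⋯ → 0 → X → Q → P → 0 → ⋯` of modules, with `P` in degree `0`, so that `Q` is in
degree `-1` and `X` in degree `-2`. -/
structure ThreeTermComplex (R : Type u) [Ring R] where
  X : ModuleCat.{u} R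
  Q : ModuleCat.{u} R
  P : ModuleCat.{u} R
  j : X →ₗ[R] Q
  d : Q →ₗ[R] P
  d_comp_j : d ∘ₗ j = 0

namespace ThreeTermComplex

variable {R : Type u} [Ring R] (G : ThreeTermComplex R)

/-- `H⁰(G) = P / Im d`. -/
abbrev H0 : ModuleCat.{u} R := ModuleCat.of R (G.P ⧸ LinearMap.range G.d)

/-- `Coker j`, which is `Q / X` when `X` is viewed as a submodule of `Q`. -/
abbrev cokerJ : ModuleCat.{u} R := ModuleCat.of R (G.Q ⧸ LinearMap.range G.j)

/-- `H⁻¹(G) = Ker d / Im j`, as a submodule of `Q / X`. -/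
def HNegOne : Submodule R (G.Q ⧸ LinearMap.range G.j) :=
  (LinearMap.ker G.d).map (LinearMap.range G.j).mkQ

/-- The inclusion of `H⁻¹(G)^(I)` in `(Q / X)^(I)`. -/
noncomputable def HNegOneIncl (I : Type u) :
    (I →₀ G.HNegOne) →ₗ[R] (I →₀ G.Q ⧸ LinearMap.range G.j) :=
  Finsupp.mapRange.linearMap G.HNegOne.subtype

end ThreeTermComplex

/-! The heart is replaced by a concrete model, `TwoTerm`: complexes `A → P` with `P` projective in
degree 0, torsion-free kernel and torsion cokernel, with chain maps modulo homotopy. Projectivity of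
`P` alone makes these homotopy classes agree with morphisms in the derived category (`toHeart`). The
cokernel of a map in the model is its cone with the torsion of `H⁻¹` divided out, so epimorphisms
are the maps whose cone has `H⁰ = 0` and torsion `H⁻¹` (`IsConeEpi`).

It remains to decide when the model has a small projective generator. Put `A = Q/X` and `V = H⁰(G)`.
Each object of the heart is an extension of some `T[0]` by some `F[1]`, with `T` torsion and `F`
torsion-free, so projectivity of `G` is tested on these. Ext¹ from `G` to `T[0]` vanishes iff every
map `A → T` extends along `d` to `P`; for all `T` this amounts to condition 3 together with `Ext¹(V,
T) = 0`. Ext¹ from `G` to `F[1]` is `Ext¹(A, F)`, which is condition 4. If `Hom(G, C) = 0`, then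
`H⁰(C) = 0` because torsion modules are generated by `V`, and `H⁻¹(C) = 0` by condition 5
(`subsingleton_of_extend`). Finite generation lets `Hom(G, -)` commute with powers of `G`. Then
`Hom(G, -)` is an equivalence onto modules over the endomorphism ring
(`IsProgenerator.isEquivalence`).

Conversely, given a small projective generator, the vanishing conditions come from splitting
suitable epimorphisms onto it, and condition 5 from covering `(R/t(R))[1]` by a power of it. The
delicate point is finite generation of `V` and of `A`. The quotients of a module by its finitely
generated submodules have direct limit zero; lifting through the standard presentation of this
limit, and using smallness to make the lift finitely supported, shows that some quotient in the
system is already zero (`DirectedQuotients.exists_eq_top`). -/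

/-! ### Vanishing of Ext¹ as extension and lifting properties. -/

section ExtOne

variable {R : Type u} [Ring R] {V M K E : Type u} [AddCommGroup V] [Module R V]
  [AddCommGroup M] [Module R M] [AddCommGroup K] [Module R K] [AddCommGroup E] [Module R E]

theorem ModuleCat.shortExact_ofHom {i : K →ₗ[R] E} {p : E →ₗ[R] V} (hi : Function.Injective i)
    (hip : Function.Exact i p) (hp : Function.Surjective p) :
    (ShortComplex.mk (ModuleCat.ofHom i) (ModuleCat.ofHom p)
      (by rw [← ModuleCat.ofHom_comp, hip.linearMap_comp_eq_zero]; rfl)).ShortExact where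
  exact := (ShortComplex.ShortExact.moduleCat_exact_iff_function_exact _).2 hip
  mono_f := (ModuleCat.mono_iff_injective _).2 hi
  epi_g := (ModuleCat.epi_iff_surjective _).2 hp

theorem KerExtOne.exists_extension (h : KerExtOne (ModuleCat.of R V) (ModuleCat.of R M))
    {i : K →ₗ[R] E} {p : E →ₗ[R] V} (hi : Function.Injective i)
    (hip : Function.Exact i p) (hp : Function.Surjective p) (f : K →ₗ[R] M) :
    ∃ g : E →ₗ[R] M, g ∘ₗ i = f := by
  have hS := ModuleCat.shortExact_ofHom hi hip hp
  have : Subsingleton (Abelian.Ext (ModuleCat.of R V) (ModuleCat.of R M) 1) := h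
  obtain ⟨x, hx⟩ := Abelian.Ext.contravariant_sequence_exact₁ hS _
    (Abelian.Ext.mk₀ (ModuleCat.ofHom f)) (add_zero 1) (Subsingleton.elim _ _)
  obtain ⟨g, rfl⟩ := Abelian.Ext.mk₀_bijective _ _ |>.2 x
  rw [Abelian.Ext.mk₀_comp_mk₀] at hx
  have := (Abelian.Ext.mk₀_bijective _ _).1 hx
  exact ⟨g.hom, congrArg ModuleCat.Hom.hom this⟩

theorem KerExtOne.exists_lift (h : KerExtOne (ModuleCat.of R V) (ModuleCat.of R M))
    {i : M →ₗ[R] E} {p : E →ₗ[R] K} (hi : Function.Injective i)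
    (hip : Function.Exact i p) (hp : Function.Surjective p) (f : V →ₗ[R] K) :
    ∃ g : V →ₗ[R] E, p ∘ₗ g = f := by
  have hS := ModuleCat.shortExact_ofHom hi hip hp
  have : Subsingleton (Abelian.Ext (ModuleCat.of R V) (ModuleCat.of R M) 1) := h
  obtain ⟨x, hx⟩ := Abelian.Ext.covariant_sequence_exact₃ (ModuleCat.of R V) hS
    (Abelian.Ext.mk₀ (ModuleCat.ofHom f)) (zero_add 1) (Subsingleton.elim _ _)
  obtain ⟨g, rfl⟩ := Abelian.Ext.mk₀_bijective _ _ |>.2 x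
  rw [Abelian.Ext.mk₀_comp_mk₀] at hx
  have := (Abelian.Ext.mk₀_bijective _ _).1 hx
  exact ⟨g.hom, congrArg ModuleCat.Hom.hom this⟩

/-- Since `E` is projective, every class in `Ext¹(V, M)` is the pushforward of the class of the
extension along some `K → M`, and it dies as soon as that map extends to `E`. -/
theorem kerExtOne_of_projective [Module.Projective R E]
    {i : K →ₗ[R] E} {p : E →ₗ[R] V} (hi : Function.Injective i)
    (hip : Function.Exact i p) (hp : Function.Surjective p)
    (H : ∀ f : K →ₗ[R] M, ∃ g : E →ₗ[R] M, g ∘ₗ i = f) :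
    KerExtOne (ModuleCat.of R V) (ModuleCat.of R M) := by
  have hS := ModuleCat.shortExact_ofHom hi hip hp
  have : Projective (ModuleCat.of R E) := (IsProjective.iff_projective E).1 inferInstance
  refine subsingleton_of_forall_eq 0 fun x => ?_
  obtain ⟨y, rfl⟩ := Abelian.Ext.contravariant_sequence_exact₃ hS _ x
    (Abelian.Ext.eq_zero_of_projective _) (add_zero 1)
  obtain ⟨f, rfl⟩ := Abelian.Ext.mk₀_bijective _ _ |>.2 y
  obtain ⟨g, hg⟩ := H f.hom
  have : f = ModuleCat.ofHom i ≫ ModuleCat.ofHom g := by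
    ext x
    exact (LinearMap.congr_fun hg x).symm
  rw [this, ← Abelian.Ext.mk₀_comp_mk₀]
  exact hS.extClass_comp_assoc _

end ExtOne

/-! ### Closure properties of the two classes of a torsion pair. -/

namespace TorsionPair

variable {R : Type u} [Ring R] (t : TorsionPair (ModuleCat.{u} R))

/-- A module, given as a type, is torsion. -/
def IsT (M : Type u) [AddCommGroup M] [Module R M] : Prop := t.T (ModuleCat.of R M)

/-- A module, given as a type, is torsion-free. -/
def IsF (M : Type u) [AddCommGroup M] [Module R M] : Prop := t.F (ModuleCat.of R M)

variable {t} {M N L : Type u} [AddCommGroup M] [Module R M] [AddCommGroup N] [Module R N]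
  [AddCommGroup L] [Module R L]

theorem IsT.of_equiv (h : t.IsT M) (e : M ≃ₗ[R] N) : t.IsT N :=
  have := t.T_iso
  t.T.prop_of_iso e.toModuleIso h

theorem IsF.of_equiv (h : t.IsF M) (e : M ≃ₗ[R] N) : t.IsF N :=
  have := t.F_iso
  t.F.prop_of_iso e.toModuleIso h

theorem IsT.hom_eq_zero (h : t.IsT M) (h' : t.IsF N) (f : M →ₗ[R] N) : f = 0 :=
  congrArg ModuleCat.Hom.hom (t.hom_eq_zero _ _ (ModuleCat.ofHom f) h h')

theorem IsT.apply_eq_zero (h : t.IsT M) (h' : t.IsF N) (f : M →ₗ[R] N) (x : M) : f x = 0 := by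
  rw [h.hom_eq_zero h' f, LinearMap.zero_apply]

theorem isT_torsion : t.IsT (t.torsion M) := t.torsion_mem (ModuleCat.of R M)

theorem isF_quotient_torsion : t.IsF (M ⧸ t.torsion M) :=
  t.quotient_torsion_mem (ModuleCat.of R M)

theorem isT_of_torsion_eq_top (h : t.torsion M = ⊤) : t.IsT M :=
  isT_torsion.of_equiv (LinearEquiv.ofTop _ h)

/-- The projection onto `M ⧸ t(M)` has torsion-free target, and `M` is torsion once it vanishes.
With the dual `isF_iff`, this reduces the closure properties to statements about zero maps. -/
theorem isT_iff : t.IsT M ↔ ∀ (N : Type u) [AddCommGroup N] [Module R N], t.IsF N →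
    ∀ f : M →ₗ[R] N, f = 0 := by
  refine ⟨fun h N _ _ hN f => h.hom_eq_zero hN f, fun h => isT_of_torsion_eq_top ?_⟩
  rw [← Submodule.ker_mkQ (t.torsion M), h _ isF_quotient_torsion (t.torsion M).mkQ,
    LinearMap.ker_zero]

theorem isF_iff : t.IsF M ↔ ∀ (N : Type u) [AddCommGroup N] [Module R N], t.IsT N →
    ∀ f : N →ₗ[R] M, f = 0 := by
  refine ⟨fun h N _ _ hN f => hN.hom_eq_zero h f, fun h => ?_⟩
  have : t.torsion M = ⊥ := by
    rw [← Submodule.range_subtype (t.torsion M), h _ isT_torsion (t.torsion M).subtype,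
      LinearMap.range_zero]
  exact isF_quotient_torsion.of_equiv (Submodule.quotEquivOfEqBot _ this)

theorem IsT.of_surjective (h : t.IsT M) (f : M →ₗ[R] N) (hf : Function.Surjective f) :
    t.IsT N := by
  rw [isT_iff]
  intro K _ _ hK g
  ext y
  obtain ⟨x, rfl⟩ := hf y
  exact h.apply_eq_zero hK (g ∘ₗ f) x

theorem IsF.of_injective (h : t.IsF N) (f : M →ₗ[R] N) (hf : Function.Injective f) :
    t.IsF M := by
  rw [isF_iff]
  intro K _ _ hK g
  ext y
  exact hf ((hK.apply_eq_zero h (f ∘ₗ g) y).trans (map_zero f).symm)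

theorem IsT.of_exact (hM : t.IsT M) (hL : t.IsT L) (f : M →ₗ[R] N) (g : N →ₗ[R] L)
    (hfg : Function.Exact f g) (hg : Function.Surjective g) : t.IsT N := by
  rw [isT_iff]
  intro K _ _ hK h
  obtain ⟨k, hk⟩ : ∃ k : L →ₗ[R] K, k ∘ₗ g = h := by
    have hker : LinearMap.ker g ≤ LinearMap.ker h := fun x hx => by
      obtain ⟨y, rfl⟩ := (hfg x).1 hx
      exact hM.apply_eq_zero hK (h ∘ₗ f) y
    refine ⟨(LinearMap.ker g).liftQ h hker ∘ₗ (g.quotKerEquivOfSurjective hg).symm, ?_⟩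
    ext x
    have : (g.quotKerEquivOfSurjective hg).symm (g x) = (LinearMap.ker g).mkQ x := by
      rw [LinearEquiv.symm_apply_eq]; rfl
    simp [this]
  rw [← hk, hL.hom_eq_zero hK k, LinearMap.zero_comp]

theorem IsF.of_exact (hM : t.IsF M) (hL : t.IsF L) (f : M →ₗ[R] N) (g : N →ₗ[R] L)
    (hf : Function.Injective f) (hfg : Function.Exact f g) : t.IsF N := by
  rw [isF_iff]
  intro K _ _ hK h
  have hr : ∀ x, h x ∈ LinearMap.range f := fun x =>
    (hfg _).1 (hK.apply_eq_zero hL (g ∘ₗ h) x)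
  ext x
  have := hK.apply_eq_zero (hM.of_equiv (LinearEquiv.ofInjective f hf)) (h.codRestrict _ hr) x
  exact congrArg Subtype.val this

theorem isT_of_subsingleton [Subsingleton M] : t.IsT M :=
  isT_iff.2 fun N _ _ _ f => by ext x; rw [Subsingleton.elim x 0, map_zero, map_zero]

theorem isF_of_subsingleton [Subsingleton M] : t.IsF M :=
  isF_iff.2 fun N _ _ _ f => by ext x; exact Subsingleton.elim _ _

theorem IsT.finsupp (h : t.IsT M) (I : Type u) : t.IsT (I →₀ M) := by
  rw [isT_iff]
  intro K _ _ hK f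
  refine Finsupp.lhom_ext fun i x => ?_
  exact h.apply_eq_zero hK (f ∘ₗ Finsupp.lsingle i) x

theorem IsT.directSum {I : Type u} {M : I → Type u} [∀ i, AddCommGroup (M i)]
    [∀ i, Module R (M i)] (h : ∀ i, t.IsT (M i)) : t.IsT (DirectSum I M) := by
  classical
  rw [isT_iff]
  intro K _ _ hK f
  refine DirectSum.linearMap_ext R fun i => ?_
  exact (h i).hom_eq_zero hK _

theorem IsF.directSum {I : Type u} {M : I → Type u} [∀ i, AddCommGroup (M i)]
    [∀ i, Module R (M i)] (h : ∀ i, t.IsF (M i)) : t.IsF (DirectSum I M) := by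
  classical
  rw [isF_iff]
  intro K _ _ hK f
  ext x i
  exact hK.apply_eq_zero (h i) (DirectSum.component R I M i ∘ₗ f) x

theorem map_mem_torsion (f : M →ₗ[R] N) {x : M} (hx : x ∈ t.torsion M) : f x ∈ t.torsion N := by
  rw [← Submodule.Quotient.mk_eq_zero]
  exact isT_torsion.apply_eq_zero isF_quotient_torsion
    ((t.torsion N).mkQ ∘ₗ f ∘ₗ (t.torsion M).subtype) ⟨x, hx⟩

end TorsionPair

/-! ### The model of the heart: two-term complexes up to homotopy. -/

namespace TorsionPair

variable {R : Type u} [Ring R] (t : TorsionPair (ModuleCat.{u} R))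

/-- A complex `A → P` with `P` projective in degree `0`, with torsion-free kernel and torsion
cokernel. These complexes, with chain maps up to homotopy, form a model of the heart. -/
structure TwoTerm where
  /-- the term in degree `-1` -/
  A : Type u
  /-- the term in degree `0` -/
  P : Type u
  [addCommGroupA : AddCommGroup A]
  [addCommGroupP : AddCommGroup P]
  [moduleA : Module R A]
  [moduleP : Module R P]
  /-- the differential -/
  d : A →ₗ[R] P
  [projective : Module.Projective R P]
  isF : t.IsF (LinearMap.ker d)
  isT : t.IsT (P ⧸ LinearMap.range d)

namespace TwoTerm

attribute [instance] addCommGroupA addCommGroupP moduleA moduleP projective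

variable {t}

/-- The group of chain maps. -/
def chain (M N : t.TwoTerm) : AddSubgroup ((M.A →ₗ[R] N.A) × (M.P →ₗ[R] N.P)) where
  carrier := {f | N.d ∘ₗ f.1 = f.2 ∘ₗ M.d}
  add_mem' {f g} hf hg := by
    simp only [Set.mem_ofPred_eq] at hf hg ⊢
    simp [LinearMap.comp_add, LinearMap.add_comp, hf, hg]
  zero_mem' := by simp
  neg_mem' {f} hf := by
    simp only [Set.mem_ofPred_eq] at hf ⊢
    simp [LinearMap.comp_neg, LinearMap.neg_comp, hf]

/-- The null-homotopic chain map attached to a homotopy. -/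
def null (M N : t.TwoTerm) : (M.P →ₗ[R] N.A) →+ chain M N where
  toFun k := ⟨(k ∘ₗ M.d, N.d ∘ₗ k), by
    show N.d ∘ₗ (k ∘ₗ M.d) = (N.d ∘ₗ k) ∘ₗ M.d
    rw [LinearMap.comp_assoc]⟩
  map_zero' := by ext <;> simp
  map_add' k l := by ext <;> simp

theorem chain_comm {M N : t.TwoTerm} (f : chain M N) (a : M.A) :
    N.d (f.1.1 a) = f.1.2 (M.d a) := LinearMap.congr_fun f.2 a

theorem mem_null_range {M N : t.TwoTerm} {f : chain M N} :
    f ∈ (null M N).range ↔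
      ∃ k : M.P →ₗ[R] N.A, (∀ a, f.1.1 a = k (M.d a)) ∧ ∀ p, f.1.2 p = N.d (k p) := by
  constructor
  · rintro ⟨k, rfl⟩
    exact ⟨k, fun _ => rfl, fun _ => rfl⟩
  · rintro ⟨k, h₁, h₀⟩
    refine ⟨k, ?_⟩
    ext x
    · exact (h₁ x).symm
    · exact (h₀ x).symm

/-- Composition of chain maps. -/
def chainComp {M N L : t.TwoTerm} (f : chain M N) (g : chain N L) : chain M L :=
  ⟨(g.1.1 ∘ₗ f.1.1, g.1.2 ∘ₗ f.1.2), by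
    show L.d ∘ₗ (g.1.1 ∘ₗ f.1.1) = (g.1.2 ∘ₗ f.1.2) ∘ₗ M.d
    ext a
    simp [chain_comm]⟩

/-- Homotopy classes of chain maps. -/
def HomClass (M N : t.TwoTerm) : Type u := chain M N ⧸ (null M N).range

instance (M N : t.TwoTerm) : AddCommGroup (HomClass M N) :=
  inferInstanceAs (AddCommGroup (chain M N ⧸ (null M N).range))

instance : Category.{u} t.TwoTerm where
  Hom := HomClass
  id M := QuotientAddGroup.mk (s := (null M M).range) ⟨(LinearMap.id, LinearMap.id), rfl⟩
  comp {M N L} f g := Quotient.map₂ (sc := QuotientAddGroup.leftRel (null M L).range)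
    chainComp (by
    intro f f' hf g g' hg
    have hf : -f + f' ∈ (null M N).range := QuotientAddGroup.leftRel_apply.1 hf
    have hg : -g + g' ∈ (null N L).range := QuotientAddGroup.leftRel_apply.1 hg
    refine QuotientAddGroup.leftRel_apply.2 ?_
    rw [mem_null_range] at hf hg ⊢
    obtain ⟨k, hk₁, hk₀⟩ := hf
    obtain ⟨l, hl₁, hl₀⟩ := hg
    have hk₁ : ∀ a, f'.1.1 a = f.1.1 a + k (M.d a) := fun a => by rw [← hk₁ a]; simp
    have hk₀ : ∀ a, f'.1.2 a = f.1.2 a + N.d (k a) := fun a => by rw [← hk₀ a]; simp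
    have hl₁ : ∀ a, g'.1.1 a = g.1.1 a + l (N.d a) := fun a => by rw [← hl₁ a]; simp
    have hl₀ : ∀ a, g'.1.2 a = g.1.2 a + L.d (l a) := fun a => by rw [← hl₀ a]; simp
    -- The homotopy comes from writing `g'f' - gf = g(f' - f) + (g' - g)f'`.
    refine ⟨g.1.1 ∘ₗ k + l ∘ₗ f'.1.2, fun a => ?_, fun p => ?_⟩
    · have : (-chainComp f g + chainComp f' g').1.1 a = - g.1.1 (f.1.1 a) + g'.1.1 (f'.1.1 a) :=
        rfl
      rw [this, hl₁, chain_comm, hk₁]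
      simp only [map_add, LinearMap.add_apply, LinearMap.comp_apply]
      abel
    · have : (-chainComp f g + chainComp f' g').1.2 p = - g.1.2 (f.1.2 p) + g'.1.2 (f'.1.2 p) :=
        rfl
      rw [this, hl₀]
      simp only [hk₀, map_add, LinearMap.add_apply, LinearMap.comp_apply, chain_comm]
      abel) f g
  id_comp := by rintro M N ⟨f⟩; rfl
  comp_id := by rintro M N ⟨f⟩; rfl
  assoc := by rintro M N L K ⟨f⟩ ⟨g⟩ ⟨h⟩; rfl

/-- The class of a chain map. -/
def homMk {M N : t.TwoTerm} (f₁ : M.A →ₗ[R] N.A) (f₀ : M.P →ₗ[R] N.P)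
    (h : ∀ a, N.d (f₁ a) = f₀ (M.d a)) : M ⟶ N :=
  QuotientAddGroup.mk (s := (null M N).range) ⟨(f₁, f₀), LinearMap.ext h⟩

theorem exists_homMk {M N : t.TwoTerm} (f : M ⟶ N) : ∃ (f₁ : M.A →ₗ[R] N.A)
    (f₀ : M.P →ₗ[R] N.P) (h : ∀ a, N.d (f₁ a) = f₀ (M.d a)), f = homMk f₁ f₀ h := by
  obtain ⟨f, rfl⟩ := QuotientAddGroup.mk_surjective f
  exact ⟨f.1.1, f.1.2, chain_comm f, rfl⟩

theorem id_eq_homMk (M : t.TwoTerm) : 𝟙 M = homMk LinearMap.id LinearMap.id (fun _ => rfl) := rfl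

theorem homMk_comp_homMk {M N L : t.TwoTerm} {f₁ : M.A →ₗ[R] N.A} {f₀ : M.P →ₗ[R] N.P}
    {g₁ : N.A →ₗ[R] L.A} {g₀ : N.P →ₗ[R] L.P} (hf : ∀ a, N.d (f₁ a) = f₀ (M.d a))
    (hg : ∀ a, L.d (g₁ a) = g₀ (N.d a)) :
    homMk f₁ f₀ hf ≫ homMk g₁ g₀ hg = homMk (g₁ ∘ₗ f₁) (g₀ ∘ₗ f₀) (fun a => by simp [hf, hg]) := rfl

instance (M N : t.TwoTerm) : AddCommGroup (M ⟶ N) := inferInstanceAs (AddCommGroup (HomClass M N))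

theorem homMk_add_homMk {M N : t.TwoTerm} {f₁ g₁ : M.A →ₗ[R] N.A} {f₀ g₀ : M.P →ₗ[R] N.P}
    (hf : ∀ a, N.d (f₁ a) = f₀ (M.d a)) (hg : ∀ a, N.d (g₁ a) = g₀ (M.d a)) :
    homMk f₁ f₀ hf + homMk g₁ g₀ hg = homMk (f₁ + g₁) (f₀ + g₀) (fun a => by simp [hf, hg]) := rfl

theorem homMk_sub_homMk {M N : t.TwoTerm} {f₁ g₁ : M.A →ₗ[R] N.A} {f₀ g₀ : M.P →ₗ[R] N.P}
    (hf : ∀ a, N.d (f₁ a) = f₀ (M.d a)) (hg : ∀ a, N.d (g₁ a) = g₀ (M.d a)) :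
    homMk f₁ f₀ hf - homMk g₁ g₀ hg = homMk (f₁ - g₁) (f₀ - g₀) (fun a => by simp [hf, hg]) := rfl

instance : Preadditive t.TwoTerm where
  add_comp := by
    intro M N L f f' g
    obtain ⟨f₁, f₀, hf, rfl⟩ := exists_homMk f
    obtain ⟨f₁', f₀', hf', rfl⟩ := exists_homMk f'
    obtain ⟨g₁, g₀, hg, rfl⟩ := exists_homMk g
    simp only [homMk_add_homMk, homMk_comp_homMk, LinearMap.comp_add]
  comp_add := by
    intro M N L f g g'
    obtain ⟨f₁, f₀, hf, rfl⟩ := exists_homMk f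
    obtain ⟨g₁', g₀', hg', rfl⟩ := exists_homMk g'
    obtain ⟨g₁, g₀, hg, rfl⟩ := exists_homMk g
    simp only [homMk_add_homMk, homMk_comp_homMk, LinearMap.add_comp]

theorem homMk_eq_zero_iff {M N : t.TwoTerm} {f₁ : M.A →ₗ[R] N.A} {f₀ : M.P →ₗ[R] N.P}
    (hf : ∀ a, N.d (f₁ a) = f₀ (M.d a)) :
    homMk f₁ f₀ hf = 0 ↔ ∃ k : M.P →ₗ[R] N.A, (∀ a, f₁ a = k (M.d a)) ∧ ∀ p, f₀ p = N.d (k p) :=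
  (QuotientAddGroup.eq_zero_iff _).trans mem_null_range

theorem homMk_eq_homMk_iff {M N : t.TwoTerm} {f₁ g₁ : M.A →ₗ[R] N.A} {f₀ g₀ : M.P →ₗ[R] N.P}
    (hf : ∀ a, N.d (f₁ a) = f₀ (M.d a)) (hg : ∀ a, N.d (g₁ a) = g₀ (M.d a)) :
    homMk f₁ f₀ hf = homMk g₁ g₀ hg ↔
      ∃ k : M.P →ₗ[R] N.A, (∀ a, f₁ a = g₁ a + k (M.d a)) ∧ ∀ p, f₀ p = g₀ p + N.d (k p) := by
  rw [← sub_eq_zero, homMk_sub_homMk, homMk_eq_zero_iff]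
  simp [sub_eq_iff_eq_add']

theorem homMk_comp_eq_zero_iff {M N L : t.TwoTerm} {f₁ : M.A →ₗ[R] N.A} {f₀ : M.P →ₗ[R] N.P}
    {g₁ : N.A →ₗ[R] L.A} {g₀ : N.P →ₗ[R] L.P} {hf : ∀ a, N.d (f₁ a) = f₀ (M.d a)}
    {hg : ∀ a, L.d (g₁ a) = g₀ (N.d a)} :
    homMk f₁ f₀ hf ≫ homMk g₁ g₀ hg = 0 ↔ ∃ k : M.P →ₗ[R] L.A,
      (∀ a, g₁ (f₁ a) = k (M.d a)) ∧ ∀ p, g₀ (f₀ p) = L.d (k p) := by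
  rw [homMk_comp_homMk, homMk_eq_zero_iff]
  rfl

theorem homMk_comp_eq_homMk_iff {M N L : t.TwoTerm} {f₁ : M.A →ₗ[R] N.A}
    {f₀ : M.P →ₗ[R] N.P} {g₁ : N.A →ₗ[R] L.A} {g₀ : N.P →ₗ[R] L.P}
    {h₁ : M.A →ₗ[R] L.A} {h₀ : M.P →ₗ[R] L.P} {hf : ∀ a, N.d (f₁ a) = f₀ (M.d a)}
    {hg : ∀ a, L.d (g₁ a) = g₀ (N.d a)} {hh : ∀ a, L.d (h₁ a) = h₀ (M.d a)} :
    homMk f₁ f₀ hf ≫ homMk g₁ g₀ hg = homMk h₁ h₀ hh ↔ ∃ k : M.P →ₗ[R] L.A,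
      (∀ a, g₁ (f₁ a) = h₁ a + k (M.d a)) ∧ ∀ p, g₀ (f₀ p) = h₀ p + L.d (k p) := by
  rw [homMk_comp_homMk, homMk_eq_homMk_iff]
  rfl

/-! ### Powers -/

/-- The power `M^(I)`. -/
noncomputable abbrev pow (M : t.TwoTerm) (I : Type u) : t.TwoTerm where
  A := I →₀ M.A
  P := I →₀ M.P
  d := Finsupp.mapRange.linearMap M.d
  projective := by
    classical
    exact Module.Projective.of_equiv (finsuppLequivDFinsupp R (M := M.P) (ι := I)).symm
  isF := by
    rw [isF_iff]
    intro K _ _ hK f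
    have h : ∀ i x, (f x).1 i ∈ LinearMap.ker M.d := fun i x =>
      DFunLike.congr_fun (LinearMap.mem_ker.1 (f x).2) i
    ext x i
    exact congrArg Subtype.val (hK.apply_eq_zero M.isF
      ((Finsupp.lapply i ∘ₗ Submodule.subtype _ ∘ₗ f).codRestrict _ (h i)) x)
  isT := by
    rw [isT_iff]
    intro K _ _ hK f
    refine Submodule.linearMap_qext _ (Finsupp.lhom_ext fun i x => ?_)
    have h : LinearMap.range M.d ≤ LinearMap.ker (f ∘ₗ Submodule.mkQ _ ∘ₗ Finsupp.lsingle i) := by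
      rintro _ ⟨a, rfl⟩
      have : (Submodule.Quotient.mk (Finsupp.single i (M.d a)) :
          (I →₀ M.P) ⧸ LinearMap.range (Finsupp.mapRange.linearMap M.d)) = 0 := by
        rw [Submodule.Quotient.mk_eq_zero]
        exact ⟨Finsupp.single i a, by simp⟩
      simp [this]
    exact M.isT.apply_eq_zero hK ((LinearMap.range M.d).liftQ _ h) (Submodule.Quotient.mk x)

/-- The coprojections of a power. -/
noncomputable def ι (M : t.TwoTerm) {I : Type u} (i : I) : M ⟶ M.pow I :=
  homMk (N := M.pow I) (Finsupp.lsingle i) (Finsupp.lsingle i)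
    fun _ => Finsupp.mapRange_single (hf := map_zero M.d)

/-- Null-homotopies on the summands assemble into one on `I →₀ M.P`. Together with `exists_pow_desc`
this makes `M.pow I` a coproduct up to homotopy, not only at the level of chain maps. -/
theorem pow_hom_ext {M N : t.TwoTerm} {I : Type u} {f g : M.pow I ⟶ N}
    (h : ∀ i, M.ι i ≫ f = M.ι i ≫ g) : f = g := by
  rw [← sub_eq_zero]
  replace h : ∀ i, M.ι i ≫ (f - g) = 0 := fun i => by
    rw [Preadditive.comp_sub, h, sub_self]
  obtain ⟨f₁, f₀, hf, hfg⟩ := exists_homMk (f - g)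
  rw [hfg] at h ⊢
  have h' := fun i => homMk_comp_eq_zero_iff.1 (h i)
  choose k hk₁ hk₀ using h'
  rw [homMk_eq_zero_iff]
  refine ⟨Finsupp.lsum ℕ k, ?_, ?_⟩
  · refine LinearMap.congr_fun (f := f₁) (g := Finsupp.lsum ℕ k ∘ₗ (M.pow I).d)
      (Finsupp.lhom_ext fun i a => ?_)
    simpa [pow] using hk₁ i a
  · refine LinearMap.congr_fun (f := f₀) (g := N.d ∘ₗ Finsupp.lsum ℕ k)
      (Finsupp.lhom_ext fun i a => ?_)
    simpa using hk₀ i a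

theorem exists_pow_desc {M N : t.TwoTerm} {I : Type u} (f : I → (M ⟶ N)) :
    ∃ g : M.pow I ⟶ N, ∀ i, M.ι i ≫ g = f i := by
  choose f₁ f₀ hf hff using fun i => exists_homMk (f i)
  refine ⟨homMk (M := M.pow I) (Finsupp.lsum ℕ f₁) (Finsupp.lsum ℕ f₀)
    (LinearMap.congr_fun (f := N.d ∘ₗ Finsupp.lsum ℕ f₁)
      (g := Finsupp.lsum ℕ f₀ ∘ₗ (M.pow I).d) (Finsupp.lhom_ext fun i a => ?_)), fun i => ?_⟩
  · simp [hf]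
  · rw [hff]
    exact homMk_comp_eq_homMk_iff.2 ⟨0, by simp, by simp⟩

/-! ### The cone of a chain map -/

section Cone

variable {M N : t.TwoTerm} (f₁ : M.A →ₗ[R] N.A) (f₀ : M.P →ₗ[R] N.P)

/-- The differential of the cone ending in degree `0`. -/
def coneD (N : t.TwoTerm) (f₀ : M.P →ₗ[R] N.P) : N.A × M.P →ₗ[R] N.P :=
  N.d.coprod (-f₀)

theorem coneD_apply (x : N.A × M.P) : coneD N f₀ x = N.d x.1 - f₀ x.2 := by
  simp [coneD, sub_eq_add_neg]

variable {f₁ f₀} (hf : ∀ a, N.d (f₁ a) = f₀ (M.d a))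

/-- The differential of the cone from degree `-2`, with values in the cycles. -/
def toConeZ : M.A →ₗ[R] LinearMap.ker (coneD N f₀) :=
  (f₁.prod M.d).codRestrict _ fun a => by simp [coneD_apply, hf]

@[simp]
theorem toConeZ_coe (a : M.A) : (toConeZ hf a : N.A × M.P) = (f₁ a, M.d a) := rfl

/-- The homology of the cone in degree `-1`. -/
abbrev coneH : Type u := LinearMap.ker (coneD N f₀) ⧸ LinearMap.range (toConeZ hf)

/-- The submodule of cycles whose homology class is torsion. -/
def torsionCycles : Submodule R (N.A × M.P) :=
  ((t.torsion (coneH hf)).comap (Submodule.mkQ _)).map (Submodule.subtype _)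

theorem mem_torsionCycles {x : N.A × M.P} : x ∈ torsionCycles hf ↔
    ∃ h : x ∈ LinearMap.ker (coneD N f₀), (Submodule.Quotient.mk ⟨x, h⟩ : coneH hf) ∈
      t.torsion (coneH hf) := by
  simp [torsionCycles]

theorem torsionCycles_le : torsionCycles hf ≤ LinearMap.ker (coneD N f₀) := fun _ hx =>
  ((mem_torsionCycles hf).1 hx).1

theorem mem_torsionCycles_of_mem_range (a : M.A) : (f₁ a, M.d a) ∈ torsionCycles hf := by
  rw [mem_torsionCycles]
  refine ⟨(toConeZ hf a).2, ?_⟩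
  have : (Submodule.Quotient.mk (toConeZ hf a) : coneH hf) = 0 :=
    (Submodule.Quotient.mk_eq_zero _).2 ⟨a, rfl⟩
  exact this ▸ zero_mem _

/-- The cokernel of a chain map in the heart. -/
abbrev coker : t.TwoTerm where
  A := (N.A × M.P) ⧸ torsionCycles hf
  P := N.P
  d := (torsionCycles hf).liftQ (coneD N f₀) (torsionCycles_le hf)
  isF := by
    have h : ∀ z : LinearMap.ker (coneD N f₀), (torsionCycles hf).mkQ z ∈
        LinearMap.ker ((torsionCycles hf).liftQ (coneD N f₀) (torsionCycles_le hf)) := fun z => z.2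
    let p : LinearMap.ker (coneD N f₀) →ₗ[R]
        LinearMap.ker ((torsionCycles hf).liftQ (coneD N f₀) (torsionCycles_le hf)) :=
      ((torsionCycles hf).mkQ ∘ₗ Submodule.subtype _).codRestrict _ h
    have hp : Function.Surjective p := by
      rintro ⟨x, hx⟩
      obtain ⟨x, rfl⟩ := Submodule.mkQ_surjective _ x
      exact ⟨⟨x, hx⟩, rfl⟩
    -- Both maps kill exactly the cycles with torsion class, so the kernel of the new differential
    -- is `H⁻¹` of the cone modulo its torsion.
    have hker : LinearMap.ker p = LinearMap.ker ((t.torsion (coneH hf)).mkQ ∘ₗ Submodule.mkQ _) := by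
      ext z
      have h₁ : z ∈ LinearMap.ker p ↔ (z : N.A × M.P) ∈ torsionCycles hf := by
        rw [LinearMap.mem_ker, ← Submodule.Quotient.mk_eq_zero, Subtype.ext_iff]; rfl
      have h₂ : z ∈ LinearMap.ker ((t.torsion (coneH hf)).mkQ ∘ₗ Submodule.mkQ _) ↔
          (Submodule.Quotient.mk z : coneH hf) ∈ t.torsion (coneH hf) := by
        rw [LinearMap.mem_ker, ← Submodule.Quotient.mk_eq_zero]; rfl
      rw [h₁, h₂, mem_torsionCycles]
      exact ⟨fun ⟨_, h⟩ => h, fun h => ⟨z.2, h⟩⟩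
    exact (isF_quotient_torsion (t := t) (M := coneH hf)).of_equiv
      ((((t.torsion (coneH hf)).mkQ ∘ₗ Submodule.mkQ _).quotKerEquivOfSurjective
        ((Submodule.mkQ_surjective _).comp (Submodule.mkQ_surjective _))).symm ≪≫ₗ
      Submodule.quotEquivOfEq _ _ hker.symm ≪≫ₗ p.quotKerEquivOfSurjective hp)
  isT := by
    refine N.isT.of_surjective (Submodule.factor (fun x hx => ?_)) (Submodule.factor_surjective _)
    obtain ⟨b, rfl⟩ := hx
    exact ⟨Submodule.Quotient.mk (b, 0), by simp [coneD_apply]⟩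

/-- The map to the cokernel. -/
def toCoker : N ⟶ coker hf :=
  homMk (N := coker hf) ((torsionCycles hf).mkQ ∘ₗ LinearMap.inl R _ _) LinearMap.id
    fun a => by
      show coneD N f₀ (a, 0) = _
      simp [coneD_apply]

theorem homMk_comp_toCoker : homMk f₁ f₀ hf ≫ toCoker hf = 0 := by
  refine homMk_comp_eq_zero_iff.2 ⟨-((torsionCycles hf).mkQ ∘ₗ LinearMap.inr R _ _),
    fun a => ?_, fun p => ?_⟩
  · show (Submodule.Quotient.mk (f₁ a, 0) : (N.A × M.P) ⧸ torsionCycles hf) =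
      -Submodule.Quotient.mk (0, M.d a)
    rw [eq_neg_iff_add_eq_zero, ← Submodule.Quotient.mk_add, Submodule.Quotient.mk_eq_zero]
    simpa using mem_torsionCycles_of_mem_range hf a
  · show f₀ p = coneD N f₀ (-(0, p))
    simp [coneD_apply]

/-- The condition on the cone of a chain map which characterizes epimorphisms of the heart. -/
structure IsConeEpi : Prop where
  surjective : Function.Surjective (coneD N f₀)
  isT : t.IsT (coneH hf)

variable {hf}

/-- A null-homotopy `w` of the composite with `u` yields `v = (u₁, -w)` on `N.A × M.P`. On cycles,
`v` induces a map from the torsion module `H⁻¹` of the cone to the torsion-free `ker L.d`, hence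
vanishes. So `v` descends along the surjection `coneD` to a null-homotopy of `u`. -/
theorem IsConeEpi.epi (h : IsConeEpi hf) : Epi (homMk f₁ f₀ hf) := by
  refine Preadditive.epi_of_cancel_zero _ fun {L} u hu => ?_
  obtain ⟨u₁, u₀, hu', rfl⟩ := exists_homMk u
  rw [homMk_comp_homMk, homMk_eq_zero_iff] at hu
  obtain ⟨w, hw₁, hw₀⟩ := hu
  simp only [LinearMap.comp_apply] at hw₁ hw₀
  let v : N.A × M.P →ₗ[R] L.A := u₁.coprod (-w)
  have hv : ∀ x, L.d (v x) = u₀ (coneD N f₀ x) := fun x => by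
    simp [v, coneD_apply, hu', hw₀, sub_eq_add_neg]
  have hvF : ∀ x : LinearMap.ker (coneD N f₀), v x ∈ LinearMap.ker L.d := fun x => by
    rw [LinearMap.mem_ker, hv, LinearMap.mem_ker.1 x.2, map_zero]
  let v' : LinearMap.ker (coneD N f₀) →ₗ[R] LinearMap.ker L.d :=
    (v ∘ₗ Submodule.subtype _).codRestrict _ hvF
  have hv' : LinearMap.range (toConeZ hf) ≤ LinearMap.ker v' := by
    rintro _ ⟨a, rfl⟩
    ext
    show v (f₁ a, M.d a) = 0
    simp [v, hw₁]
  have hv0 : LinearMap.ker (coneD N f₀) ≤ LinearMap.ker v := fun x hx =>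
    congrArg Subtype.val (h.isT.apply_eq_zero L.isF ((LinearMap.range (toConeZ hf)).liftQ v' hv')
      (Submodule.Quotient.mk ⟨x, hx⟩))
  let k : N.P →ₗ[R] L.A := (LinearMap.ker (coneD N f₀)).liftQ v hv0 ∘ₗ
    ((coneD N f₀).quotKerEquivOfSurjective h.surjective).symm
  have hk : ∀ x, k (coneD N f₀ x) = v x := fun x => by
    have : ((coneD N f₀).quotKerEquivOfSurjective h.surjective).symm (coneD N f₀ x) =
        Submodule.Quotient.mk x := by
      rw [LinearEquiv.symm_apply_eq]; rfl
    simp [k, this]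
  rw [homMk_eq_zero_iff]
  refine ⟨k, fun b => ?_, fun p => ?_⟩
  · have := hk (b, 0)
    simpa [coneD_apply, v] using this.symm
  · obtain ⟨x, rfl⟩ := h.surjective p
    rw [hk, hv]

/-- A null-homotopy `k` corrects the inclusion of `M.P` to a map `q` into the cycles of the cokernel
that kills the range of `M.d`. It is thus a map from a torsion module to a torsion-free one, so `q =
0`, and this says that every cycle of the cone is a torsion cycle. -/
theorem isConeEpi_of_toCoker_eq_zero (h : toCoker hf = 0) : IsConeEpi hf := by
  obtain ⟨k, hk₁, hk₀⟩ := (homMk_eq_zero_iff _).1 h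
  have hsurj : Function.Surjective (coneD N f₀) := fun p => by
    obtain ⟨x, hx⟩ := Submodule.mkQ_surjective (torsionCycles hf) (k p)
    refine ⟨x, ?_⟩
    have : p = (coker hf).d (k p) := hk₀ p
    rw [this, ← hx]
    rfl
  refine ⟨hsurj, isT_of_torsion_eq_top ?_⟩
  let q : M.P →ₗ[R] (coker hf).A :=
    ((torsionCycles hf).mkQ ∘ₗ LinearMap.inr R N.A M.P : M.P →ₗ[R] _) + k ∘ₗ f₀
  have hk₁' : ∀ b : N.A, (Submodule.Quotient.mk (b, 0) : (N.A × M.P) ⧸ torsionCycles hf) =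
    k (N.d b) := hk₁
  have hq : ∀ p, q p ∈ LinearMap.ker (coker hf).d := fun p => by
    have h₁ : (coker hf).d (Submodule.Quotient.mk (0, p) : (N.A × M.P) ⧸ torsionCycles hf) =
      -f₀ p := by
        show coneD N f₀ (0, p) = _
        simp [coneD_apply]
    have h₂ : f₀ p = (coker hf).d (k (f₀ p)) := hk₀ _
    have : q p = (Submodule.Quotient.mk (0, p) : (N.A × M.P) ⧸ torsionCycles hf) + k (f₀ p) := rfl
    rw [LinearMap.mem_ker, this]
    refine ((coker hf).d.map_add _ _).trans ?_
    rw [h₁, ← h₂, neg_add_cancel]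
  have hq0 : LinearMap.range M.d ≤ LinearMap.ker (q.codRestrict _ hq) := by
    rintro _ ⟨a, rfl⟩
    ext
    show (Submodule.Quotient.mk (0, M.d a) : (N.A × M.P) ⧸ torsionCycles hf) +
      k (f₀ (M.d a)) = 0
    rw [← hf, ← hk₁', ← Submodule.Quotient.mk_add, Submodule.Quotient.mk_eq_zero]
    simpa using mem_torsionCycles_of_mem_range hf a
  have hq1 : ∀ p, (Submodule.Quotient.mk (0, p) : (N.A × M.P) ⧸ torsionCycles hf) +
      k (f₀ p) = 0 := fun p => congrArg Subtype.val
    (M.isT.apply_eq_zero (coker hf).isF ((LinearMap.range M.d).liftQ _ hq0)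
      (Submodule.Quotient.mk p))
  rw [eq_top_iff]
  rintro z -
  obtain ⟨⟨⟨b, p⟩, hz⟩, rfl⟩ := Submodule.mkQ_surjective _ z
  have : (b, p) ∈ torsionCycles hf := by
    rw [← Submodule.Quotient.mk_eq_zero]
    have h₂ : (b, p) = (b, 0) + ((0, p) : N.A × M.P) := by simp
    rw [LinearMap.mem_ker, coneD_apply, sub_eq_zero] at hz
    rw [h₂, Submodule.Quotient.mk_add, hk₁', show N.d b = f₀ p from hz, add_comm]
    exact hq1 p
  exact ((mem_torsionCycles hf).1 this).2

theorem isConeEpi_of_epi [Epi (homMk f₁ f₀ hf)] : IsConeEpi hf :=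
  isConeEpi_of_toCoker_eq_zero
    ((cancel_epi (homMk f₁ f₀ hf)).1 ((homMk_comp_toCoker hf).trans Limits.comp_zero.symm))

end Cone

end TwoTerm

end TorsionPair

/-! ### Injectivity and surjectivity on homology, in terms of elements. -/

section Elementwise

variable {R : Type u} [Ring R] {K L : CochainComplex (ModuleCat.{u} R) ℤ} (φ : K ⟶ L)

theorem ModuleCat.exists_d_eq_of_mono_homologyMap (i j k : ℤ) (hij : i + 1 = j) (hjk : j + 1 = k)
    [Mono (HomologicalComplex.homologyMap φ j)] (x : K.X j) (hx : (K.d j k).hom x = 0)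
    (y : L.X i) (h : (φ.f j).hom x = (L.d i j).hom y) : ∃ z : K.X i, (K.d i j).hom z = x := by
  obtain ⟨A, π, hπ, z, hz⟩ := (HomologicalComplex.mono_homologyMap_iff_up_to_refinements φ i j k
    (by simp [← hij]) (by simp [← hjk])).1 inferInstance
    (ModuleCat.ofHom (LinearMap.toSpanSingleton R (K.X j) x))
    (by ext; simp [hx]) (ModuleCat.ofHom (LinearMap.toSpanSingleton R (L.X i) y))
    (by ext; simp [h])
  -- An element is a morphism from `R`; the refinement `π` is onto `R`, so evaluating at a preimage
  -- of `1` turns generalized elements back into elements.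
  obtain ⟨a, ha⟩ := (ModuleCat.epi_iff_surjective π).1 hπ (1 : R)
  refine ⟨z.hom a, ?_⟩
  have := congrArg (fun f => f.hom a) hz
  simpa [ha] using this.symm

theorem ModuleCat.exists_eq_of_epi_homologyMap (i j k : ℤ) (hij : i + 1 = j) (hjk : j + 1 = k)
    [Epi (HomologicalComplex.homologyMap φ j)] (y : L.X j) (hy : (L.d j k).hom y = 0) :
    ∃ (x : K.X j) (z : L.X i), (K.d j k).hom x = 0 ∧
      y = (φ.f j).hom x + (L.d i j).hom z := by
  obtain ⟨A, π, hπ, x, hx, z, hz⟩ :=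
    (HomologicalComplex.epi_homologyMap_iff_up_to_refinements φ i j k
    (by simp [← hij]) (by simp [← hjk])).1 inferInstance
    (ModuleCat.ofHom (LinearMap.toSpanSingleton R (L.X j) y)) (by ext; simp [hy])
  obtain ⟨a, ha⟩ := (ModuleCat.epi_iff_surjective π).1 hπ (1 : R)
  refine ⟨x.hom a, z.hom a, ?_, ?_⟩
  · exact congrArg (fun f => f.hom a) hx
  · have := congrArg (fun f => f.hom a) hz
    simpa [ha] using this

end Elementwise

/-! ### Cochain complexes concentrated in degrees -1 and 0. -/

namespace CochainComplex

open Limits HomologicalComplex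

variable {C : Type*} [Category* C] [Abelian C]

/-- The complex `A → B` with `B` in degree `0`. -/
noncomputable abbrev twoTerm {A B : C} (f : A ⟶ B) : CochainComplex C ℤ :=
  double f (c := ComplexShape.up ℤ) (i₀ := -1) (i₁ := 0) (by simp)

section

variable {A B : C} (f : A ⟶ B)

/-- The term of `twoTerm f` in degree `-1`. -/
noncomputable abbrev twoTermXNegOne : (twoTerm f).X (-1) ≅ A := doubleXIso₀ f _

/-- The term of `twoTerm f` in degree `0`. -/
noncomputable abbrev twoTermXZero : (twoTerm f).X 0 ≅ B := doubleXIso₁ f _ (by simp)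

theorem twoTerm_d : (twoTerm f).d (-1) 0 = (twoTermXNegOne f).hom ≫ f ≫ (twoTermXZero f).inv :=
  double_d f _ (by simp)

instance : (twoTerm f).IsStrictlyGE (-1) := by
  rw [isStrictlyGE_iff]
  intro i hi
  exact isZero_double_X f _ i (by lia) (by lia)

instance : (twoTerm f).IsStrictlyLE 0 := by
  rw [isStrictlyLE_iff]
  intro i hi
  exact isZero_double_X f _ i (by lia) (by lia)

variable {f} {K : CochainComplex C ℤ} (φ₁ : A ⟶ K.X (-1)) (φ₀ : B ⟶ K.X 0)
  (comm : φ₁ ≫ K.d (-1) 0 = f ≫ φ₀) (hφ : φ₀ ≫ K.d 0 1 = 0)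

/-- Morphisms from `twoTerm f`. -/
noncomputable def fromTwoTerm : twoTerm f ⟶ K :=
  mkHomFromDouble _ (by simp) φ₁ φ₀ comm (by
    intro k hk
    obtain rfl : k = 1 := by simpa using hk.symm
    exact hφ)

@[simp]
theorem fromTwoTerm_f_negOne :
    (fromTwoTerm φ₁ φ₀ comm hφ).f (-1) = (twoTermXNegOne f).hom ≫ φ₁ :=
  mkHomFromDouble_f₀ ..

@[simp]
theorem fromTwoTerm_f_zero :
    (fromTwoTerm φ₁ φ₀ comm hφ).f 0 = (twoTermXZero f).hom ≫ φ₀ :=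
  mkHomFromDouble_f₁ ..

end

theorem twoTerm_hom_ext {A B : C} {f : A ⟶ B} {K : CochainComplex C ℤ} {φ ψ : twoTerm f ⟶ K}
    (h₁ : φ.f (-1) = ψ.f (-1)) (h₀ : φ.f 0 = ψ.f 0) : φ = ψ :=
  from_double_hom_ext h₁ h₀

section

variable {A B A' B' A'' B'' : C} {f : A ⟶ B} {f' : A' ⟶ B'} {f'' : A'' ⟶ B''}

/-- The morphism between two-term complexes attached to a commutative square. -/
noncomputable def twoTermMap (φ₁ : A ⟶ A') (φ₀ : B ⟶ B') (comm : φ₁ ≫ f' = f ≫ φ₀) :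
    twoTerm f ⟶ twoTerm f' :=
  fromTwoTerm (φ₁ ≫ (twoTermXNegOne f').inv) (φ₀ ≫ (twoTermXZero f').inv)
    (by
      simp only [twoTerm_d, Category.assoc, Iso.inv_hom_id_assoc]
      rw [← Category.assoc, comm, Category.assoc])
    ((isZero_double_X f' _ 1 (by lia) (by lia)).eq_of_tgt _ _)

theorem twoTermMap_f_negOne (φ₁ : A ⟶ A') (φ₀ : B ⟶ B') (comm : φ₁ ≫ f' = f ≫ φ₀) :
    (twoTermMap φ₁ φ₀ comm).f (-1) =
      (twoTermXNegOne f).hom ≫ φ₁ ≫ (twoTermXNegOne f').inv := by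
  simp [twoTermMap]

theorem twoTermMap_f_zero (φ₁ : A ⟶ A') (φ₀ : B ⟶ B') (comm : φ₁ ≫ f' = f ≫ φ₀) :
    (twoTermMap φ₁ φ₀ comm).f 0 = (twoTermXZero f).hom ≫ φ₀ ≫ (twoTermXZero f').inv := by
  simp [twoTermMap]

theorem twoTermMap_id : twoTermMap (f := f) (𝟙 A) (𝟙 B) (by simp) = 𝟙 _ :=
  twoTerm_hom_ext (by simp [twoTermMap_f_negOne]) (by simp [twoTermMap_f_zero])

theorem twoTermMap_comp (φ₁ : A ⟶ A') (φ₀ : B ⟶ B') (comm : φ₁ ≫ f' = f ≫ φ₀)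
    (ψ₁ : A' ⟶ A'') (ψ₀ : B' ⟶ B'') (comm' : ψ₁ ≫ f'' = f' ≫ ψ₀) :
    twoTermMap φ₁ φ₀ comm ≫ twoTermMap ψ₁ ψ₀ comm' =
      twoTermMap (φ₁ ≫ ψ₁) (φ₀ ≫ ψ₀) (by
        rw [Category.assoc, comm', ← Category.assoc, comm, Category.assoc]) :=
  twoTerm_hom_ext (by simp [twoTermMap_f_negOne]) (by simp [twoTermMap_f_zero])

theorem twoTermMap_add (φ₁ ψ₁ : A ⟶ A') (φ₀ ψ₀ : B ⟶ B') (comm : φ₁ ≫ f' = f ≫ φ₀)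
    (comm' : ψ₁ ≫ f' = f ≫ ψ₀) :
    twoTermMap φ₁ φ₀ comm + twoTermMap ψ₁ ψ₀ comm' =
      twoTermMap (φ₁ + ψ₁) (φ₀ + ψ₀)
        (by rw [Preadditive.add_comp, Preadditive.comp_add, comm, comm']) :=
  twoTerm_hom_ext (by simp [twoTermMap_f_negOne]) (by simp [twoTermMap_f_zero])

end

/-- The homology of a two-term complex in degree `0`. -/
noncomputable def twoTermHomologyZero {A B : C} (f : A ⟶ B) :
    (twoTerm f).homology 0 ≅ cokernel f :=
  (twoTerm f).isoHomologyι 0 1 (by simp)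
    ((isZero_double_X f _ 1 (by lia) (by lia)).eq_of_tgt _ _) ≪≫
  ((twoTerm f).opcyclesIsCokernel (-1) 0 (by simp)).coconePointUniqueUpToIso
    (cokernelIsCokernel _) ≪≫
  cokernel.mapIso _ _ (twoTermXNegOne f) (twoTermXZero f) (by simp [twoTerm_d])

/-- The homology of a two-term complex in degree `-1`. -/
noncomputable def twoTermHomologyNegOne {A B : C} (f : A ⟶ B) :
    (twoTerm f).homology (-1) ≅ kernel f :=
  ((twoTerm f).isoHomologyπ (-2) (-1) (by simp)
    ((isZero_double_X f _ (-2) (by lia) (by lia)).eq_of_src _ _)).symm ≪≫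
  ((twoTerm f).cyclesIsKernel (-1) 0 (by simp)).conePointUniqueUpToIso
    (kernelIsKernel _) ≪≫
  kernel.mapIso _ _ (twoTermXNegOne f) (twoTermXZero f) (by simp [twoTerm_d])

theorem acyclic_twoTerm_id (B : C) : (twoTerm (𝟙 B)).Acyclic := by
  intro i
  by_cases h₁ : i = -1
  · subst h₁
    rw [exactAt_iff_isZero_homology]
    exact IsZero.of_iso (isZero_kernel_of_mono _) (twoTermHomologyNegOne (𝟙 B))
  by_cases h₀ : i = 0
  · subst h₀
    rw [exactAt_iff_isZero_homology]
    exact IsZero.of_iso (isZero_cokernel_of_epi _) (twoTermHomologyZero (𝟙 B))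
  by_cases h : i < -1
  · exact exactAt_of_isGE _ (-1) i h
  · exact exactAt_of_isLE _ 0 i (by lia)

end CochainComplex

/-! ### Equivalence of the model with the heart. -/

namespace TorsionPair.TwoTerm

open CochainComplex HomologicalComplex

variable {R : Type u} [Ring R] {t : TorsionPair (ModuleCat.{u} R)}

/-- The cochain complex attached to an object of the model. -/
noncomputable abbrev cpx (M : t.TwoTerm) : CochainComplex (ModuleCat.{u} R) ℤ :=
  twoTerm (ModuleCat.ofHom M.d)

/-- The morphism of cochain complexes attached to a chain map. -/
noncomputable def cpxMap {M N : t.TwoTerm} (f : chain M N) : M.cpx ⟶ N.cpx :=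
  twoTermMap (ModuleCat.ofHom f.1.1) (ModuleCat.ofHom f.1.2) (by
    ext a
    exact chain_comm f a)

theorem cpxMap_f_negOne {M N : t.TwoTerm} (f : chain M N) :
    (cpxMap f).f (-1) = (twoTermXNegOne (ModuleCat.ofHom M.d)).hom ≫ ModuleCat.ofHom f.1.1 ≫
      (twoTermXNegOne (ModuleCat.ofHom N.d)).inv :=
  twoTermMap_f_negOne ..

theorem cpxMap_f_zero {M N : t.TwoTerm} (f : chain M N) :
    (cpxMap f).f 0 = (twoTermXZero (ModuleCat.ofHom M.d)).hom ≫ ModuleCat.ofHom f.1.2 ≫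
      (twoTermXZero (ModuleCat.ofHom N.d)).inv :=
  twoTermMap_f_zero ..

section

variable [HasDerivedCategory.{w} (ModuleCat.{u} R)]

/-- A null-homotopic map factors through the acyclic complex `M.P = M.P`. On that complex zero is a
quasi-isomorphism, so the complex becomes a zero object in the derived category. -/
theorem Q_map_eq_zero_of_null {M N : t.TwoTerm} (k : M.P →ₗ[R] N.A) :
    DerivedCategory.Q.map (cpxMap (null M N k)) = 0 := by
  have hid : QuasiIso (0 : twoTerm (𝟙 (ModuleCat.of R M.P)) ⟶ twoTerm (𝟙 (ModuleCat.of R M.P))) := by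
    refine ⟨fun i => (quasiIsoAt_iff_isIso_homologyMap _ i).2 ?_⟩
    have h := (exactAt_iff_isZero_homology _ _).1 (acyclic_twoTerm_id (ModuleCat.of R M.P) i)
    exact ⟨⟨0, h.eq_of_src _ _, h.eq_of_src _ _⟩⟩
  let a : M.cpx ⟶ twoTerm (𝟙 (ModuleCat.of R M.P)) :=
    twoTermMap (ModuleCat.ofHom M.d) (𝟙 _) (by simp)
  let b : twoTerm (𝟙 (ModuleCat.of R M.P)) ⟶ N.cpx :=
    twoTermMap (ModuleCat.ofHom k) (ModuleCat.ofHom (N.d ∘ₗ k)) (by ext; simp)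
  have hab : cpxMap (null M N k) = a ≫ b := by
    simp only [a, b, twoTermMap_comp, cpxMap]
    congr 1
  have ha : DerivedCategory.Q.map a = 0 := by
    have := (DerivedCategory.isIso_Q_map_iff_quasiIso _
      (0 : twoTerm (𝟙 (ModuleCat.of R M.P)) ⟶ twoTerm (𝟙 (ModuleCat.of R M.P)))).2 hid
    rw [← cancel_mono (DerivedCategory.Q.map
      (0 : twoTerm (𝟙 (ModuleCat.of R M.P)) ⟶ twoTerm (𝟙 (ModuleCat.of R M.P))))]
    simp
  rw [hab, Functor.map_comp, ha, Limits.zero_comp]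

/-- The additive map on chain maps given by the localization functor. -/
noncomputable def chainToDerived (M N : t.TwoTerm) :
    chain M N →+ (DerivedCategory.Q.obj M.cpx ⟶ DerivedCategory.Q.obj N.cpx) :=
  AddMonoidHom.mk' (fun f => DerivedCategory.Q.map (cpxMap f)) fun f g => by
    rw [← Functor.map_add]
    congr 1
    simp only [cpxMap, twoTermMap_add]
    rfl

/-- The functor from the model to the derived category. -/
noncomputable def toDerived : t.TwoTerm ⥤ DerivedCategory (ModuleCat.{u} R) where
  obj M := DerivedCategory.Q.obj M.cpx
  map {M N} f := QuotientAddGroup.lift (null M N).range (chainToDerived M N) (by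
    rintro _ ⟨k, rfl⟩
    exact Q_map_eq_zero_of_null k) f
  map_id M := by
    refine Eq.trans ?_ (DerivedCategory.Q.map_id M.cpx)
    exact congrArg DerivedCategory.Q.map twoTermMap_id
  map_comp {M N L} f g := by
    obtain ⟨f, rfl⟩ := QuotientAddGroup.mk_surjective f
    obtain ⟨g, rfl⟩ := QuotientAddGroup.mk_surjective g
    refine Eq.trans ?_ (DerivedCategory.Q.map_comp (cpxMap f) (cpxMap g))
    refine congrArg DerivedCategory.Q.map ?_
    simp only [cpxMap, twoTermMap_comp]
    rfl

theorem toDerived_map_homMk {M N : t.TwoTerm} {f₁ : M.A →ₗ[R] N.A} {f₀ : M.P →ₗ[R] N.P}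
    (h : ∀ a, N.d (f₁ a) = f₀ (M.d a)) :
    toDerived.map (homMk f₁ f₀ h) = DerivedCategory.Q.map
      (twoTermMap (ModuleCat.ofHom f₁) (ModuleCat.ofHom f₀) (by ext a; exact h a)) := rfl

/-- The homology in degree `0` of the image of an object of the model. -/
noncomputable def homologyZeroIso {A P : ModuleCat.{u} R} (d : A ⟶ P) :
    (DerivedCategory.homologyFunctor (ModuleCat.{u} R) 0).obj
      (DerivedCategory.Q.obj (twoTerm d)) ≅
      ModuleCat.of R (P ⧸ LinearMap.range d.hom) :=
  (DerivedCategory.homologyFunctorFactors _ 0).app _ ≪≫ twoTermHomologyZero _ ≪≫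
    ModuleCat.cokernelIsoRangeQuotient _

/-- The homology in degree `-1` of the image of an object of the model. -/
noncomputable def homologyNegOneIso {A P : ModuleCat.{u} R} (d : A ⟶ P) :
    (DerivedCategory.homologyFunctor (ModuleCat.{u} R) (-1)).obj
      (DerivedCategory.Q.obj (twoTerm d)) ≅ ModuleCat.of R (LinearMap.ker d.hom) :=
  (DerivedCategory.homologyFunctorFactors _ (-1)).app _ ≪≫ twoTermHomologyNegOne _ ≪≫
    ModuleCat.kernelIsoKer _

theorem heart_toDerived (M : t.TwoTerm) : t.heart (toDerived.obj M) := by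
  have := t.T_iso
  have := t.F_iso
  refine ⟨⟨?_, ?_⟩, ⟨?_, ?_⟩⟩
  · exact inferInstanceAs ((DerivedCategory.Q.obj M.cpx).IsLE 0)
  · exact t.T.prop_of_iso (homologyZeroIso (ModuleCat.ofHom M.d)).symm M.isT
  · exact inferInstanceAs ((DerivedCategory.Q.obj M.cpx).IsGE (-1))
  · exact t.F.prop_of_iso (homologyNegOneIso (ModuleCat.ofHom M.d)).symm M.isF

end

section QuasiIso

variable {M : t.TwoTerm} {K : CochainComplex (ModuleCat.{u} R) ℤ} (s : K ⟶ M.cpx) [QuasiIso s]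

/-- The component in degree `-1` of a morphism to the complex of an object of the model. -/
noncomputable def compNegOne {K : CochainComplex (ModuleCat.{u} R) ℤ} (s : K ⟶ M.cpx) :
    K.X (-1) →ₗ[R] M.A := (s.f (-1) ≫ (twoTermXNegOne (ModuleCat.ofHom M.d)).hom).hom

/-- The component in degree `0` of a morphism to the complex of an object of the model. -/
noncomputable def compZero {K : CochainComplex (ModuleCat.{u} R) ℤ} (s : K ⟶ M.cpx) :
    K.X 0 →ₗ[R] M.P := (s.f 0 ≫ (twoTermXZero (ModuleCat.ofHom M.d)).hom).hom

theorem comp_comm {K : CochainComplex (ModuleCat.{u} R) ℤ} (s : K ⟶ M.cpx) (x : K.X (-1)) :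
    M.d (compNegOne s x) = compZero s ((K.d (-1) 0).hom x) := by
  have h : (s.f (-1) ≫ (twoTermXNegOne (ModuleCat.ofHom M.d)).hom) ≫ ModuleCat.ofHom M.d =
      K.d (-1) 0 ≫ s.f 0 ≫ (twoTermXZero (ModuleCat.ofHom M.d)).hom := by
    rw [← s.comm_assoc, twoTerm_d]
    simp
  exact congrArg (fun f => f.hom x) h

theorem exists_cycle_add (p : M.P) : ∃ (z : LinearMap.ker (K.d 0 1).hom) (a : M.A),
    p = compZero s z + M.d a := by
  have : Epi (homologyMap s 0) := inferInstance
  obtain ⟨z, y, hz, hzy⟩ := ModuleCat.exists_eq_of_epi_homologyMap s (-1) 0 1 (by simp) (by simp)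
    ((twoTermXZero (ModuleCat.ofHom M.d)).inv.hom p)
    ((ModuleCat.subsingleton_of_isZero
      (isZero_double_X _ _ 1 (by lia) (by lia))).elim _ _)
  refine ⟨⟨z, hz⟩, (twoTermXNegOne (ModuleCat.ofHom M.d)).hom.hom y, ?_⟩
  have h := congrArg (twoTermXZero (ModuleCat.ofHom M.d)).hom.hom hzy
  rw [twoTerm_d] at h
  simpa [compZero] using h

/-- Injectivity on `H⁰` gives some `x` with boundary `z`; its image differs from `a` by a cycle,
which surjectivity on `H⁻¹` lifts to correct `x`. -/
theorem exists_preimage (z : K.X 0) (hz : (K.d 0 1).hom z = 0) (a : M.A)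
    (h : compZero s z = M.d a) : ∃ x : K.X (-1), (K.d (-1) 0).hom x = z ∧ compNegOne s x = a := by
  have : Mono (homologyMap s 0) := inferInstance
  have : Epi (homologyMap s (-1)) := inferInstance
  have hinj := (ModuleCat.mono_iff_injective (twoTermXZero (ModuleCat.ofHom M.d)).hom).1
    inferInstance
  obtain ⟨x, hx⟩ := ModuleCat.exists_d_eq_of_mono_homologyMap s (-1) 0 1 (by simp) (by simp) z hz
    ((twoTermXNegOne (ModuleCat.ofHom M.d)).inv.hom a) (hinj (by
      rw [twoTerm_d]
      simpa [compZero] using h))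
  have ha : M.d (a - compNegOne s x) = 0 := by
    rw [map_sub, comp_comm, hx, h, sub_self]
  obtain ⟨y, w, hy, hyw⟩ := ModuleCat.exists_eq_of_epi_homologyMap s (-2) (-1) 0 (by simp) (by simp)
    ((twoTermXNegOne (ModuleCat.ofHom M.d)).inv.hom (a - compNegOne s x)) (hinj (by
      rw [twoTerm_d]
      simpa using ha))
  obtain rfl : w = 0 := (ModuleCat.subsingleton_of_isZero
      (isZero_double_X _ _ (-2) (by lia) (by lia))).elim _ _
  refine ⟨x + y, by rw [map_add, hx, hy, add_zero], ?_⟩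
  have h := congrArg (twoTermXNegOne (ModuleCat.ofHom M.d)).hom.hom hyw
  have h' : a - compNegOne s x = compNegOne s y := by simpa [compNegOne] using h
  rw [map_add, ← h', add_sub_cancel]

theorem comp_injective [K.IsStrictlyGE (-1)] (x : K.X (-1)) (h₀ : (K.d (-1) 0).hom x = 0)
    (h₁ : compNegOne s x = 0) : x = 0 := by
  have : Mono (homologyMap s (-1)) := inferInstance
  have hinj := (ModuleCat.mono_iff_injective (twoTermXNegOne (ModuleCat.ofHom M.d)).hom).1
    inferInstance
  obtain ⟨y, rfl⟩ := ModuleCat.exists_d_eq_of_mono_homologyMap s (-2) (-1) 0 (by simp) (by simp)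
    x h₀ 0 (hinj (by simpa [compNegOne] using h₁))
  obtain rfl : y = 0 := (ModuleCat.subsingleton_of_isZero
      (K.isZero_of_isStrictlyGE (-1) (-2) (by lia))).elim _ _
  rw [map_zero]

/-- Surjectivity on `H⁰` makes `Z⁰(K) × M.A → M.P` onto, and projectivity of `M.P` splits it. Here
`σ` is the degree 0 part of a right inverse of `s` up to homotopy, and `k` is the homotopy. -/
theorem exists_section : ∃ (σ : M.P →ₗ[R] LinearMap.ker (K.d 0 1).hom) (k : M.P →ₗ[R] M.A),
    ∀ p, p = compZero s (σ p) + M.d (k p) := by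
  let e : LinearMap.ker (K.d 0 1).hom × M.A →ₗ[R] M.P :=
    (compZero s ∘ₗ Submodule.subtype _).coprod M.d
  have he : Function.Surjective e := fun p => by
    obtain ⟨z, a, h⟩ := exists_cycle_add s p
    exact ⟨(z, a), h.symm⟩
  obtain ⟨l, hl⟩ := Module.projective_lifting_property e LinearMap.id he
  exact ⟨LinearMap.fst _ _ _ ∘ₗ l, LinearMap.snd _ _ _ ∘ₗ l,
    fun p => (LinearMap.congr_fun hl p).symm⟩

end QuasiIso

variable [HasDerivedCategory.{w} (ModuleCat.{u} R)]

/-- By calculus of fractions, a chain map that dies in the derived category is null-homotopic after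
composition with a quasi-isomorphism `s : K → M`. The homotopy is carried back to `M` along the
section of `s` from `exists_section`. -/
instance : (toDerived (t := t)).Faithful where
  map_injective {M N} f g hfg := by
    rw [← sub_eq_zero]
    obtain ⟨f, rfl⟩ := QuotientAddGroup.mk_surjective f
    obtain ⟨g, rfl⟩ := QuotientAddGroup.mk_surjective g
    replace hfg : DerivedCategory.Q.map (cpxMap f) = DerivedCategory.Q.map (cpxMap g) := hfg
    rw [← sub_eq_zero, ← Functor.map_sub] at hfg
    have h0 : cpxMap f - cpxMap g = cpxMap (f - g) := by
      rw [sub_eq_iff_eq_add]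
      simp only [cpxMap, twoTermMap_add]
      congr 1 <;> (ext; simp)
    rw [h0] at hfg
    refine (QuotientAddGroup.eq_zero_iff (f - g)).2 (mem_null_range.2 ?_)
    generalize f - g = φ at hfg
    have hQh : DerivedCategory.Qh.map ((HomotopyCategory.quotient _ _).map (cpxMap φ)) =
        DerivedCategory.Qh.map 0 := by
      rw [Functor.map_zero,
        ← cancel_mono ((DerivedCategory.quotientCompQhIso (ModuleCat.{u} R)).hom.app N.cpx),
        DerivedCategory.quotientCompQhIso_hom_naturality, hfg, Limits.comp_zero, Limits.zero_comp]
    obtain ⟨K, s, hs, hsφ⟩ := (MorphismProperty.map_eq_iff_precomp DerivedCategory.Qh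
      (HomotopyCategory.quasiIso _ _) _ _).1 hQh
    obtain ⟨K, rfl⟩ := HomotopyCategory.quotient_obj_surjective K
    obtain ⟨s, rfl⟩ := (HomotopyCategory.quotient _ _).map_surjective s
    have : QuasiIso s := by
      rw [← DerivedCategory.isIso_Qh_map_iff] at hs
      rw [← DerivedCategory.isIso_Q_map_iff_quasiIso]
      exact (NatIso.isIso_map_iff (DerivedCategory.quotientCompQhIso (ModuleCat.{u} R)) s).1 hs
    rw [Limits.comp_zero, ← Functor.map_comp, HomotopyCategory.quotient_map_eq_zero_iff] at hsφ
    obtain ⟨H⟩ := hsφ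
    let h : K.X 0 →ₗ[R] N.A := (H.hom 0 (-1) ≫ (twoTermXNegOne (ModuleCat.ofHom N.d)).hom).hom
    have h₁ : ∀ x, φ.1.1 (compNegOne s x) = h ((K.d (-1) 0).hom x) := fun x => by
      have h0 := H.comm (-1)
      rw [dNext_eq _ (show (ComplexShape.up ℤ).Rel (-1) 0 by simp),
        prevD_eq _ (show (ComplexShape.up ℤ).Rel (-2) (-1) by simp),
        (isZero_double_X _ _ (-2) (by lia) (by lia)).eq_of_tgt (H.hom (-1) (-2)) 0,
        Limits.zero_comp, add_zero, HomologicalComplex.zero_f, add_zero,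
        HomologicalComplex.comp_f, cpxMap_f_negOne] at h0
      have h1 := congrArg (fun f => (f ≫ (twoTermXNegOne (ModuleCat.ofHom N.d)).hom).hom x) h0
      simpa [h, compNegOne] using h1
    have h₀ : ∀ z, (K.d 0 1).hom z = 0 → φ.1.2 (compZero s z) = N.d (h z) := fun z hz => by
      have h0 := H.comm 0
      rw [dNext_eq _ (show (ComplexShape.up ℤ).Rel 0 1 by simp),
        prevD_eq _ (show (ComplexShape.up ℤ).Rel (-1) 0 by simp),
        HomologicalComplex.zero_f, add_zero,
        HomologicalComplex.comp_f, cpxMap_f_zero, twoTerm_d] at h0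
      have h1 := congrArg (fun f => (f ≫ (twoTermXZero (ModuleCat.ofHom N.d)).hom).hom z) h0
      simpa [h, compZero, hz] using h1
    obtain ⟨σ, k, hσ⟩ := exists_section s
    -- Apply `φ` to `p = s(σ p) + d(k p)`: the first summand contributes `h ∘ σ`, and the second `φ₁
    -- ∘ k` because `φ` is a chain map.
    refine ⟨h ∘ₗ Submodule.subtype _ ∘ₗ σ + φ.1.1 ∘ₗ k, fun a => ?_, fun p => ?_⟩
    · obtain ⟨x, hx₀, hx₁⟩ := exists_preimage s (σ (M.d a)) (σ (M.d a)).2 (a - k (M.d a)) (by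
        rw [map_sub, eq_sub_iff_add_eq, ← hσ])
      have := h₁ x
      rw [hx₀, hx₁] at this
      simp [← this]
    · conv_lhs => rw [hσ p]
      simp [h₀ _ (σ p).2, chain_comm]

/-- A morphism is a roof `M ← K → N` with `K` in degrees -1 and 0. The left leg has a right inverse
`S` up to homotopy, so the roof is the honest chain map `S` followed by the right leg. -/
instance : (toDerived (t := t)).Full where
  map_surjective {M N} φ := by
    obtain ⟨K, _, _, s, hs, g, hφ⟩ :=
      DerivedCategory.right_fac_of_isStrictlyLE_of_isStrictlyGE (-1) 0
        (X := M.cpx) (Y := N.cpx) φ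
    have := (DerivedCategory.isIso_Q_map_iff_quasiIso _ s).1 hs
    obtain ⟨σ, k, hσ⟩ := exists_section s
    -- Injectivity of `j` makes the elements supplied by `exists_preimage` unique, hence linear in
    -- `a`; this gives the degree -1 part of the section.
    let j : K.X (-1) →ₗ[R] M.A × K.X 0 := (compNegOne s).prod (K.d (-1) 0).hom
    have hj : Function.Injective j := by
      rw [← LinearMap.ker_eq_bot, LinearMap.ker_eq_bot']
      intro x hx
      exact comp_injective s x (congrArg Prod.snd hx) (congrArg Prod.fst hx)
    let τ : M.A →ₗ[R] M.A × K.X 0 :=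
      (LinearMap.id - k ∘ₗ M.d).prod (Submodule.subtype _ ∘ₗ σ ∘ₗ M.d)
    have hτ : ∀ a, τ a ∈ LinearMap.range j := fun a => by
      obtain ⟨x, hx₀, hx₁⟩ := exists_preimage s (σ (M.d a)) (σ (M.d a)).2 (a - k (M.d a)) (by
        rw [map_sub, eq_sub_iff_add_eq, ← hσ])
      exact ⟨x, Prod.ext hx₁ hx₀⟩
    let σ₁ : M.A →ₗ[R] K.X (-1) :=
      (LinearEquiv.ofInjective j hj).symm ∘ₗ τ.codRestrict _ hτ
    have hσ₁ : ∀ a, j (σ₁ a) = τ a := fun a =>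
      congrArg Subtype.val ((LinearEquiv.ofInjective j hj).apply_symm_apply ⟨τ a, hτ a⟩)
    have hσ₁s : ∀ a, compNegOne s (σ₁ a) = a - k (M.d a) := fun a => congrArg Prod.fst (hσ₁ a)
    have hσ₁d : ∀ a, (K.d (-1) 0).hom (σ₁ a) = σ (M.d a) := fun a => congrArg Prod.snd (hσ₁ a)
    let σ₀ : M.P →ₗ[R] K.X 0 := Submodule.subtype _ ∘ₗ σ
    let S : M.cpx ⟶ K := fromTwoTerm (ModuleCat.ofHom σ₁) (ModuleCat.ofHom σ₀)
      (by ext a; exact hσ₁d a) (by ext p; exact (σ p).2)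
    have hcomp : ∀ {L : t.TwoTerm} (u : K ⟶ L.cpx),
        toDerived.map (homMk (compNegOne u ∘ₗ σ₁) (compZero u ∘ₗ σ₀)
          (fun a => by simp [comp_comm, hσ₁d, σ₀])) =
        DerivedCategory.Q.map S ≫ DerivedCategory.Q.map u := fun {L} u => by
      refine (toDerived_map_homMk _).trans ?_
      rw [← Functor.map_comp]
      congr 1
      refine twoTerm_hom_ext ?_ ?_
      · simp [twoTermMap_f_negOne, S, compNegOne]
      · simp [twoTermMap_f_zero, S, compZero]
    refine ⟨homMk (compNegOne g ∘ₗ σ₁) (compZero g ∘ₗ σ₀)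
      (fun a => by simp [comp_comm, hσ₁d, σ₀]), ?_⟩
    rw [hcomp, hφ]
    have hS : DerivedCategory.Q.map S ≫ DerivedCategory.Q.map s = 𝟙 _ := by
      rw [← hcomp]
      refine Eq.trans ?_ (toDerived.map_id M)
      refine congrArg toDerived.map ((homMk_eq_homMk_iff _ (fun _ => rfl)).2
        ⟨-k, fun a => ?_, fun p => ?_⟩)
      · simp [hσ₁s, sub_eq_add_neg]
      · have := hσ p
        simp only [LinearMap.comp_apply, LinearMap.id_apply, LinearMap.neg_apply, map_neg, σ₀]
        rw [← sub_eq_add_neg, eq_sub_iff_add_eq]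
        exact this.symm
    rw [IsIso.eq_inv_of_inv_hom_id hS]

/-- Represent `X` by a complex `K` in degrees -1 and 0, cover `K⁰` by a projective and pull `K⁻¹`
back along the cover. The projection to `K` is a quasi-isomorphism. -/
theorem exists_iso_toDerived {X : DerivedCategory (ModuleCat.{u} R)} (hX : t.heart X) :
    ∃ M : t.TwoTerm, Nonempty (toDerived.obj M ≅ X) := by
  obtain ⟨⟨hX₁, hX₂⟩, ⟨hX₃, hX₄⟩⟩ := hX
  obtain ⟨K, _, _, ⟨e⟩⟩ := DerivedCategory.exists_iso_Q_obj_of_isGE_of_isLE X (-1) 0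
  obtain ⟨Y, p, _, _⟩ : ∃ (Y : ModuleCat.{u} R) (p : Y ⟶ K.X 0), Epi p ∧ Projective Y :=
    ⟨_, Projective.π (K.X 0), inferInstance, inferInstance⟩
  obtain ⟨A, q, d, hsq⟩ : ∃ (A : ModuleCat.{u} R) (q : A ⟶ K.X (-1)) (d : A ⟶ Y),
      IsPullback q d (K.d (-1) 0) p := ⟨_, _, _, IsPullback.of_hasPullback _ _⟩
  have h1 : Limits.IsZero (K.X 1) := K.isZero_of_isStrictlyLE 0 1
  have h2 : Limits.IsZero (K.X (-2)) := K.isZero_of_isStrictlyGE (-1) (-2)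
  let s : twoTerm d ⟶ K := fromTwoTerm q p hsq.w
    (h1.eq_of_tgt _ _)
  have hs : QuasiIso s := by
    refine ⟨fun i => (quasiIsoAt_iff_isIso_homologyMap _ i).2 ?_⟩
    by_cases hi₁ : i = -1
    · subst hi₁
      have : Mono (homologyMap s (-1)) := by
        rw [mono_homologyMap_iff_up_to_refinements s (-2) (-1) 0 (by simp) (by simp)]
        intro W x hx y hy
        refine ⟨W, 𝟙 W, inferInstance, 0, ?_⟩
        rw [h2.eq_of_tgt y 0, Limits.zero_comp] at hy
        rw [Category.id_comp, Limits.zero_comp, ← cancel_mono (twoTermXNegOne d).hom]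
        refine hsq.hom_ext ?_ ?_
        · simpa [s] using hy
        · rw [twoTerm_d] at hx
          simpa using hx =≫ (twoTermXZero d).hom
      have : Epi (homologyMap s (-1)) := by
        rw [epi_homologyMap_iff_up_to_refinements s (-2) (-1) 0 (by simp) (by simp)]
        intro W y hy
        refine ⟨W, 𝟙 W, inferInstance, hsq.lift y 0 (by simpa using hy) ≫
          (twoTermXNegOne d).inv, ?_, 0, ?_⟩
        · rw [twoTerm_d]
          simp
        · simp [s]
      exact isIso_of_mono_of_epi _
    by_cases hi₀ : i = 0
    · subst hi₀
      have : Mono (homologyMap s 0) := by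
        rw [mono_homologyMap_iff_up_to_refinements s (-1) 0 1 (by simp) (by simp)]
        intro W x hx y hy
        refine ⟨W, 𝟙 W, inferInstance, hsq.lift y (x ≫ (twoTermXZero d).hom)
          (by simpa [s] using hy.symm) ≫ (twoTermXNegOne d).inv, ?_⟩
        rw [twoTerm_d]
        simp
      have : Epi (homologyMap s 0) := by
        rw [epi_homologyMap_iff_up_to_refinements s (-1) 0 1 (by simp) (by simp)]
        intro W y hy
        obtain ⟨W', π, hπ, x, hx⟩ := surjective_up_to_refinements_of_epi p y
        refine ⟨W', π, hπ, x ≫ (twoTermXZero d).inv,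
          (isZero_double_X _ _ 1 (by lia) (by lia)).eq_of_tgt _ _, 0, ?_⟩
        simp [s, hx]
      exact isIso_of_mono_of_epi _
    · have hz : ∀ L : CochainComplex (ModuleCat.{u} R) ℤ, L.IsStrictlyGE (-1) →
          L.IsStrictlyLE 0 → Limits.IsZero (L.homology i) := fun L _ _ => by
        rw [← exactAt_iff_isZero_homology]
        by_cases h : i < -1
        · exact exactAt_of_isGE _ (-1) i h
        · exact exactAt_of_isLE _ 0 i (by lia)
      exact ⟨⟨0, (hz _ inferInstance inferInstance).eq_of_src _ _,
        (hz _ inferInstance inferInstance).eq_of_src _ _⟩⟩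
  have := (DerivedCategory.isIso_Q_map_iff_quasiIso _ s).2 hs
  let e' : DerivedCategory.Q.obj (twoTerm d) ≅ X := asIso (DerivedCategory.Q.map s) ≪≫ e.symm
  have := t.T_iso
  have := t.F_iso
  have : Module.Projective R Y := (IsProjective.iff_projective Y).2 ‹_›
  exact ⟨{  A := A
            P := Y
            d := d.hom
            isF := t.F.prop_of_iso (((DerivedCategory.homologyFunctor _ (-1)).mapIso e').symm ≪≫
              homologyNegOneIso d) hX₄
            isT := t.T.prop_of_iso (((DerivedCategory.homologyFunctor _ 0).mapIso e').symm ≪≫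
              homologyZeroIso d) hX₂ }, ⟨e'⟩⟩

variable (t) in
/-- The functor from the model to the heart. -/
noncomputable def toHeart : t.TwoTerm ⥤ t.Heart := t.heart.lift toDerived heart_toDerived

instance : (toHeart t).Faithful := inferInstanceAs (t.heart.lift toDerived heart_toDerived).Faithful

instance : (toHeart t).Full := inferInstanceAs (t.heart.lift toDerived heart_toDerived).Full

instance : (toHeart t).EssSurj where
  mem_essImage X := by
    obtain ⟨M, ⟨e⟩⟩ := exists_iso_toDerived X.property
    exact ⟨M, ⟨t.heart.isoMk e⟩⟩

instance : (toHeart t).IsEquivalence where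

theorem isModuleCategory_heart_iff :
    IsModuleCategory.{u} t.Heart ↔ IsModuleCategory.{u} t.TwoTerm :=
  ⟨fun ⟨S, _, ⟨e⟩⟩ => ⟨S, _, ⟨(toHeart t).asEquivalence.trans e⟩⟩,
    fun ⟨S, _, ⟨e⟩⟩ => ⟨S, _, ⟨(toHeart t).asEquivalence.symm.trans e⟩⟩⟩

end TorsionPair.TwoTerm

/-! ### Recognition of module categories by a small projective generator. -/

section Progenerator

variable {C : Type*} [Category.{u} C] [Preadditive C] (G : C)

/-- An object `G` of a preadditive category, with chosen powers, which behaves like a small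
projective generator. -/
structure IsProgenerator (pow : Type u → C) (ι : ∀ {I : Type u}, I → (G ⟶ pow I)) : Prop where
  exists_desc {I : Type u} {M : C} (f : I → (G ⟶ M)) : ∃ g : pow I ⟶ M, ∀ i, ι i ≫ g = f i
  span_eq_top (I : Type u) :
    Submodule.span (End G)ᵐᵒᵖ (Set.range (ι : I → (G ⟶ pow I))) = ⊤
  separates {M N : C} (f : M ⟶ N) (hf : ∀ s : G ⟶ M, s ≫ f = 0) : f = 0
  exists_factor {M N : C} (p : pow (G ⟶ M) ⟶ M) (hp : ∀ s, ι s ≫ p = s)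
    (q : pow (G ⟶ M) ⟶ N) (hq : ∀ s : G ⟶ pow (G ⟶ M), s ≫ p = 0 → s ≫ q = 0) :
    ∃ r : M ⟶ N, p ≫ r = q
  exists_coker {I J : Type u} (f : pow J ⟶ pow I) : ∃ (D : C) (c : pow I ⟶ D),
    (∀ s : G ⟶ D, ∃ s' : G ⟶ pow I, s' ≫ c = s) ∧
      ∀ s : G ⟶ pow I, s ≫ c = 0 ↔ ∃ s' : G ⟶ pow J, s' ≫ f = s

namespace IsProgenerator

variable {G} {pow : Type u → C} {ι : ∀ {I : Type u}, I → (G ⟶ pow I)}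

/-- Postcomposition as a linear map over the endomorphism ring. -/
def postcomp (G : C) {M N : C} (f : M ⟶ N) : (G ⟶ M) →ₗ[(End G)ᵐᵒᵖ] (G ⟶ N) :=
  ((preadditiveCoyonedaObj G).map f).hom

/-- The coordinates are read off with the maps `pow I ⟶ G` that are the identity on one summand and
zero on the others. With `span_eq_top`, `Hom(G, pow I)` is free on the coprojections. -/
theorem linearIndependent (h : IsProgenerator G pow ι) (I : Type u) :
    LinearIndependent (End G)ᵐᵒᵖ (ι : I → (G ⟶ pow I)) := by
  classical
  rw [linearIndependent_iff]
  intro l hl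
  ext i
  obtain ⟨π, hπ⟩ := h.exists_desc (fun j : I => if j = i then 𝟙 G else 0)
  have h' := congrArg (postcomp G π) hl
  rw [map_zero, Finsupp.apply_linearCombination, Finsupp.linearCombination_apply,
    Finsupp.sum_eq_single i] at h'
  · have h2 : (postcomp G π ∘ ι) i = 𝟙 G := (hπ i).trans (if_pos rfl)
    rw [h2] at h'
    exact MulOpposite.unop_injective ((Category.comp_id (l i).unop).symm.trans h')
  · intro j _ hj
    have h2 : (postcomp G π ∘ ι) j = 0 := (hπ j).trans (if_neg hj)
    rw [h2, smul_zero]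
  · simp

theorem isEquivalence (h : IsProgenerator G pow ι) :
    (preadditiveCoyonedaObj G).IsEquivalence where
  faithful := ⟨fun {M N} f g hfg => by
    rw [← sub_eq_zero]
    refine h.separates _ fun s => ?_
    rw [Preadditive.comp_sub, sub_eq_zero]
    exact congrArg (fun φ => φ.hom s) hfg⟩
  full := ⟨fun {M N} φ => by
    -- `M` is covered by the power of `G` indexed by all maps `G ⟶ M`. A linear map `φ` prescribes a
    -- map `q` from this power, and linearity of `φ` makes `q` vanish on the relations, so that it
    -- descends to `M`.
    obtain ⟨p, hp⟩ := h.exists_desc (fun s : G ⟶ M => s)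
    obtain ⟨q, hq⟩ := h.exists_desc (fun s : G ⟶ M => φ.hom s)
    have hpq : postcomp G q = φ.hom ∘ₗ postcomp G p := by
      refine LinearMap.ext_on_range (h.span_eq_top _) fun s => ?_
      exact (hq s).trans (congrArg φ.hom (hp s)).symm
    obtain ⟨r, hr⟩ := h.exists_factor p hp q fun s hs => by
      refine (LinearMap.congr_fun hpq s).trans ?_
      exact (congrArg φ.hom hs).trans (map_zero φ.hom)
    have h2 : ∀ s : G ⟶ M, s ≫ r = φ.hom s := fun s => by
      conv_lhs => rw [← hp s, Category.assoc, hr]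
      exact hq s
    refine ⟨r, ?_⟩
    ext s
    exact h2 s⟩
  essSurj := ⟨fun N => by
    -- `Hom(G, pow N)` is free on the elements of `N`, so `θ` starts a free presentation of `N`. Its
    -- relations are realized by a map `f` between powers, whose cokernel `D` corresponds to `N`.
    let b := Module.Basis.mk (h.linearIndependent N) (h.span_eq_top N).ge
    let θ : (G ⟶ pow N) →ₗ[(End G)ᵐᵒᵖ] N := b.constr ℕ (fun n : N => n)
    have hθ : ∀ n, θ (ι n) = n := fun n => by
      have : b n = ι n := by simp [b]
      rw [← this]
      simp only [θ, Module.Basis.constr_basis]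
    obtain ⟨f, hf⟩ := h.exists_desc (fun s : LinearMap.ker θ => (s : G ⟶ pow N))
    obtain ⟨D, c, hc, hcf⟩ := h.exists_coker f
    have hrange : LinearMap.range (postcomp G f) ≤ LinearMap.ker θ := by
      rw [LinearMap.range_eq_map, ← h.span_eq_top, Submodule.map_span_le]
      rintro _ ⟨s, rfl⟩
      have : postcomp G f (ι s) = s := hf s
      rw [this]
      exact s.2
    have hker : LinearMap.ker (postcomp G c) = LinearMap.ker θ := by
      refine le_antisymm (fun s hs => ?_) (fun s hs => ?_)
      · obtain ⟨s', rfl⟩ := (hcf s).1 hs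
        exact hrange ⟨s', rfl⟩
      · exact (hcf s).2 ⟨ι (⟨s, hs⟩ : LinearMap.ker θ), hf ⟨s, hs⟩⟩
    refine ⟨D, ⟨LinearEquiv.toModuleIso
      (((postcomp G c).quotKerEquivOfSurjective hc).symm ≪≫ₗ
        Submodule.quotEquivOfEq _ _ hker ≪≫ₗ
        θ.quotKerEquivOfSurjective fun n => ⟨ι n, hθ n⟩)⟩⟩⟩

end IsProgenerator

end Progenerator

/-! ### Tilting objects of the model and why they are progenerators. -/

theorem LinearMap.exists_finset_support_subset {R A B I : Type*} [Ring R] [AddCommGroup A]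
    [Module R A] [AddCommGroup B] [Module R B] [Module.Finite R A] (f : A →ₗ[R] I →₀ B) :
    ∃ S : Finset I, ∀ a, (f a).support ⊆ S := by
  classical
  obtain ⟨s, hs⟩ := (Module.Finite.fg_top : (⊤ : Submodule R A).FG)
  refine ⟨s.biUnion fun a => (f a).support, fun a => ?_⟩
  have h : (⊤ : Submodule R A) ≤
      (Finsupp.supported B R (s.biUnion fun a => (f a).support : Set I)).comap f := by
    rw [← hs, Submodule.span_le]
    intro a ha
    simp only [Submodule.comap_coe, Set.mem_preimage, SetLike.mem_coe, Finsupp.mem_supported]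
    intro i hi
    exact Finset.mem_biUnion.2 ⟨a, ha, hi⟩
  exact_mod_cast (Finsupp.mem_supported R _).1 (h (Submodule.mem_top (x := a)))

namespace TorsionPair

variable {R : Type u} [Ring R] {t : TorsionPair (ModuleCat.{u} R)}

namespace TwoTerm

section OfMap

variable {A Z L : Type u} [AddCommGroup A] [Module R A] [AddCommGroup Z] [Module R Z]
  [AddCommGroup L] [Module R L]

/-- The pullback of two linear maps. -/
abbrev pullback (z : A →ₗ[R] Z) (c : L →ₗ[R] Z) : Submodule R (A × L) :=
  LinearMap.eqLocus (z ∘ₗ LinearMap.fst R A L) (c ∘ₗ LinearMap.snd R A L)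

variable (z : A →ₗ[R] Z) (c : L →ₗ[R] Z)

/-- The differential of `ofMap`. -/
def ofMapD : pullback z c →ₗ[R] L := LinearMap.snd R A L ∘ₗ (pullback z c).subtype

variable {z c}

theorem isF_ker_ofMapD (hF : t.IsF (LinearMap.ker z)) : t.IsF (LinearMap.ker (ofMapD z c)) := by
  refine hF.of_injective ((LinearMap.fst R A L ∘ₗ (pullback z c).subtype ∘ₗ
    (LinearMap.ker (ofMapD z c)).subtype).codRestrict _ fun x => ?_) ?_
  · have h1 : z x.1.1.1 = c x.1.1.2 := x.1.2
    have h2 : x.1.1.2 = 0 := x.2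
    rw [h2, map_zero] at h1
    exact h1
  · intro x y hxy
    refine Subtype.ext (Subtype.ext (Prod.ext (congrArg Subtype.val hxy) ?_))
    exact (show x.1.1.2 = 0 from x.2).trans (show y.1.1.2 = 0 from y.2).symm

theorem isT_coker_ofMapD (hc : Function.Surjective ((LinearMap.range z).mkQ ∘ₗ c))
    (hT : t.IsT (Z ⧸ LinearMap.range z)) :
    t.IsT (L ⧸ LinearMap.range (ofMapD z c)) := by
  let c' : L →ₗ[R] Z ⧸ LinearMap.range z := Submodule.mkQ _ ∘ₗ c
  have hc' : LinearMap.ker c' = LinearMap.range (ofMapD z c) := by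
    ext l
    constructor
    · intro hl
      obtain ⟨a, ha⟩ := (Submodule.Quotient.mk_eq_zero _).1 (LinearMap.mem_ker.1 hl)
      exact ⟨⟨(a, l), ha⟩, rfl⟩
    · rintro ⟨x, rfl⟩
      exact (Submodule.Quotient.mk_eq_zero _).2 ⟨_, x.2⟩
  exact hT.of_equiv ((c'.quotKerEquivOfSurjective hc).symm ≪≫ₗ Submodule.quotEquivOfEq _ _ hc')

/-- The two-term complex quasi-isomorphic to `z : A → Z` obtained from a map `c : L → Z` from a
projective module which is surjective modulo the range of `z`. -/
abbrev ofMap [Module.Projective R L]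
    (hc : Function.Surjective ((LinearMap.range z).mkQ ∘ₗ c)) (hF : t.IsF (LinearMap.ker z))
    (hT : t.IsT (Z ⧸ LinearMap.range z)) : t.TwoTerm where
  A := pullback z c
  P := L
  d := ofMapD z c
  isF := isF_ker_ofMapD hF
  isT := isT_coker_ofMapD hc hT

end OfMap

/-- The conditions on a two-term complex which make it a progenerator of the heart. -/
structure IsTilting (G : t.TwoTerm) : Prop where
  -- `extend` is the vanishing of `Ext¹(G, T[0])` and `lift` that of `Ext¹(G, F[1]) = Ext¹(G.A, F)`
  -- in the heart, both phrased with module maps only.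
  extend {T : Type u} [AddCommGroup T] [Module R T] (hT : t.IsT T) (f : G.A →ₗ[R] T) :
    ∃ g : G.P →ₗ[R] T, ∀ a, g (G.d a) = f a
  lift {E K : Type u} [AddCommGroup E] [Module R E] [AddCommGroup K] [Module R K]
    (p : E →ₗ[R] K) (hp : t.IsF (LinearMap.ker p)) (f : G.A →ₗ[R] K)
    (hf : ∀ a, ∃ e, p e = f a) : ∃ g : G.A →ₗ[R] E, ∀ a, p (g a) = f a
  pres {T : Type u} [AddCommGroup T] [Module R T] (hT : t.IsT T) :
    ∃ (I : Type u) (p : (I →₀ G.P ⧸ LinearMap.range G.d) →ₗ[R] T), Function.Surjective p ∧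
      t.IsT (LinearMap.ker p)
  finite_A : Module.Finite R G.A
  finite_P : Module.Finite R G.P
  sub : ∃ (I : Type u) (h : (I →₀ G.A) →ₗ[R] R ⧸ t.torsion R) (T : Type u) (_ : AddCommGroup T)
    (_ : Module R T) (j : (R ⧸ t.torsion R) →ₗ[R] T), t.IsT T ∧
      ∀ r, j r = 0 → ∃ x, (∀ i, G.d (x i) = 0) ∧ h x = r

namespace IsTilting

variable {G : t.TwoTerm}

section Coker

variable {M N : t.TwoTerm} {f₁ : M.A →ₗ[R] N.A} {f₀ : M.P →ₗ[R] N.P}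
  (hf : ∀ a, N.d (f₁ a) = f₀ (M.d a))

/-- The component of `s₁` in `M.P`, taken modulo the image `Z` of the torsion cycles, has torsion
target, so `extend` makes it factor through `G.d`. Subtracting the resulting homotopy pushes `s₁`
into the image of `N.A`, and `lift` applies because the kernel of `N.A → (coker hf).A` sits in `ker
N.d`. -/
theorem exists_comp_toCoker (hG : G.IsTilting)
    (s : G ⟶ coker hf) : ∃ s' : G ⟶ N, s' ≫ toCoker hf = s := by
  obtain ⟨s₁, s₀, hs, rfl⟩ := exists_homMk s
  let Z := (torsionCycles hf).map (LinearMap.snd R N.A M.P)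
  have hZ : LinearMap.range M.d ≤ Z := by
    rintro _ ⟨a, rfl⟩
    exact ⟨_, mem_torsionCycles_of_mem_range hf a, rfl⟩
  have hT : t.IsT (M.P ⧸ Z) :=
    M.isT.of_surjective (Submodule.factor hZ) (Submodule.factor_surjective hZ)
  let π : (coker hf).A →ₗ[R] M.P ⧸ Z := (torsionCycles hf).mapQ Z (LinearMap.snd R N.A M.P)
    fun x hx => ⟨x, hx, rfl⟩
  obtain ⟨g, hg⟩ := hG.extend hT (π ∘ₗ s₁)
  obtain ⟨k, hk⟩ := Module.projective_lifting_property Z.mkQ g Z.mkQ_surjective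
  let inr : M.P →ₗ[R] (coker hf).A := (torsionCycles hf).mkQ ∘ₗ LinearMap.inr R _ _
  let inl : N.A →ₗ[R] (coker hf).A := (torsionCycles hf).mkQ ∘ₗ LinearMap.inl R _ _
  have hdl : ∀ b, (coker hf).d (inl b) = N.d b := fun b => by
    show coneD N f₀ (b, 0) = _
    simp [coneD_apply]
  have hdr : ∀ p, (coker hf).d (inr p) = - f₀ p := fun b => by
    show coneD N f₀ (0, b) = _
    simp [coneD_apply]
  obtain ⟨g₁, hg₁⟩ := hG.lift inl
    (N.isF.of_injective (Submodule.inclusion (fun b hb => by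
      rw [LinearMap.mem_ker] at hb ⊢
      rw [← hdl, hb, map_zero])) (Submodule.inclusion_injective _)) (s₁ - inr ∘ₗ k ∘ₗ G.d)
    (fun a => by
      obtain ⟨⟨b, p⟩, hx⟩ := Submodule.mkQ_surjective (torsionCycles hf) (s₁ a)
      have h1 : Z.mkQ p = Z.mkQ (k (G.d a)) := by
        have h2 : Z.mkQ (k (G.d a)) = π (s₁ a) := (LinearMap.congr_fun hk _).trans (hg a)
        rw [h2, ← hx]
        rfl
      obtain ⟨⟨b', p'⟩, hz, hz'⟩ := (Submodule.Quotient.eq Z).1 h1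
      have hz' : p' = p - k (G.d a) := hz'
      refine ⟨b - b', ?_⟩
      rw [LinearMap.sub_apply, ← hx]
      show Submodule.mkQ _ (b - b', 0) = Submodule.mkQ _ (b, p) - Submodule.mkQ _ (0, k (G.d a))
      rw [← map_sub, eq_comm]
      refine (Submodule.Quotient.eq _).2 ?_
      convert hz using 1
      simp [hz'])
  have hg₁' : ∀ a, inl (g₁ a) = s₁ a - inr (k (G.d a)) := hg₁
  refine ⟨homMk g₁ (s₀ + f₀ ∘ₗ k) fun a => ?_, homMk_comp_eq_homMk_iff.2
    ⟨-(inr ∘ₗ k), fun a => ?_, fun p => ?_⟩⟩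
  · rw [← hdl, hg₁', map_sub, hdr, hs]
    simp
  · refine (hg₁' a).trans ?_
    simp [sub_eq_add_neg]
  · show s₀ p + f₀ (k p) = s₀ p + (coker hf).d (-inr (k p))
    rw [map_neg, hdr, neg_neg]

/-- After lifting the null-homotopy to `N.A × M.P`, the error `ζ` takes values in the torsion
cycles. `extend`, applied to its class in the torsion of `H⁻¹` of the cone, gives a second
correction `m`. What remains consists of boundaries `(f₁ b, M.d b)` and lifts to `M.A`, since the
kernel lies in `ker M.d`. -/
theorem exists_comp_of_comp_toCoker (hG : G.IsTilting) (s : G ⟶ N) (h : s ≫ toCoker hf = 0) :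
    ∃ s' : G ⟶ M, s' ≫ homMk f₁ f₀ hf = s := by
  obtain ⟨s₁, s₀, hs, rfl⟩ := exists_homMk s
  obtain ⟨k, hk₁, hk₀⟩ := homMk_comp_eq_zero_iff.1 h
  obtain ⟨k', hk'⟩ := Module.projective_lifting_property (torsionCycles hf).mkQ k
    (Submodule.mkQ_surjective _)
  have hk'' : ∀ p, (torsionCycles hf).mkQ (k' p) = k p := LinearMap.congr_fun hk'
  have hζ : ∀ a, (s₁ a, 0) - k' (G.d a) ∈ torsionCycles hf := fun a =>
    (Submodule.Quotient.eq _).1 ((hk₁ a).trans (hk'' (G.d a)).symm)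
  have hs₀ : ∀ p, s₀ p = coneD N f₀ (k' p) := fun p => by
    have := hk₀ p
    rw [← hk'' p] at this
    exact this
  let τ : torsionCycles hf →ₗ[R] t.torsion (coneH hf) :=
    ((LinearMap.range (toConeZ hf)).mkQ ∘ₗ
      Submodule.inclusion (torsionCycles_le hf)).codRestrict _ fun x => by
        obtain ⟨h, h'⟩ := (mem_torsionCycles hf).1 x.2
        exact h'
  have hτ : Function.Surjective τ := by
    rintro ⟨z, hz⟩
    obtain ⟨z, rfl⟩ := Submodule.mkQ_surjective _ z
    exact ⟨⟨z, (mem_torsionCycles hf).2 ⟨z.2, hz⟩⟩, rfl⟩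
  let ζ : G.A →ₗ[R] torsionCycles hf :=
    (LinearMap.inl R _ _ ∘ₗ s₁ - k' ∘ₗ G.d).codRestrict _ hζ
  obtain ⟨g, hg⟩ := hG.extend isT_torsion (τ ∘ₗ ζ)
  obtain ⟨m, hm⟩ := Module.projective_lifting_property τ g hτ
  obtain ⟨g₁, hg₁⟩ := hG.lift (f₁.prod M.d)
    (M.isF.of_injective (Submodule.inclusion (fun b hb => by
      rw [LinearMap.mem_ker] at hb ⊢
      exact congrArg Prod.snd hb)) (Submodule.inclusion_injective _))
    (Submodule.subtype _ ∘ₗ (ζ - m ∘ₗ G.d)) (fun a => by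
      have h1 : τ (ζ a) = τ (m (G.d a)) := (hg a).symm.trans (LinearMap.congr_fun hm _).symm
      have h2 := congrArg Subtype.val h1
      obtain ⟨b, hb⟩ := (Submodule.Quotient.eq _).1 h2
      exact ⟨b, congrArg Subtype.val hb⟩)
  have hg₁' : ∀ a, (f₁ (g₁ a), M.d (g₁ a)) = (s₁ a, 0) - k' (G.d a) - (m (G.d a)).1 := hg₁
  have hm' : ∀ p, N.d (m p).1.1 = f₀ (m p).1.2 := fun p => by
    have := torsionCycles_le hf (m p).2
    rwa [LinearMap.mem_ker, coneD_apply, sub_eq_zero] at this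
  let m₁ : G.P →ₗ[R] N.A := LinearMap.fst R _ _ ∘ₗ (k' + Submodule.subtype _ ∘ₗ m)
  let m₂ : G.P →ₗ[R] M.P := LinearMap.snd R _ _ ∘ₗ (k' + Submodule.subtype _ ∘ₗ m)
  have h₁ : ∀ a, f₁ (g₁ a) = s₁ a - m₁ (G.d a) := fun a => by
    have := congrArg Prod.fst (hg₁' a)
    rw [Prod.fst_sub, Prod.fst_sub, sub_sub] at this
    exact this
  have h₂ : ∀ a, M.d (g₁ a) = - m₂ (G.d a) := fun a => by
    have := congrArg Prod.snd (hg₁' a)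
    rw [Prod.snd_sub, Prod.snd_sub, sub_sub, zero_sub] at this
    exact this
  have h₃ : ∀ p, s₀ p = N.d (m₁ p) - f₀ (m₂ p) := fun p => by
    simp [hs₀, coneD_apply, m₁, m₂, hm']
  exact ⟨homMk g₁ (-m₂) h₂, homMk_comp_eq_homMk_iff.2 ⟨-m₁,
    fun a => by simp [h₁, sub_eq_add_neg], fun p => by simp [h₃, sub_eq_add_neg]⟩⟩

end Coker

/-- An element `x` of `F` is a map `φ : R/t(R) → F`. By `h`, maps `G.A → F` factor through `G.d` and
so kill `H⁻¹(G)`; hence `φ` kills the image of `H⁻¹(G)^(I)` and therefore the kernel of `j : R/t(R)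
→ T`. The pushout of `φ` along `j` is an extension of the torsion module `T / im j` by `F`. It
splits, and a retraction onto `F` must kill the image of `T`, so `φ = 0`. -/
theorem subsingleton_of_extend (hG : G.IsTilting)
    {F : Type u} [AddCommGroup F] [Module R F] (hF : t.IsF F)
    (h : ∀ f : G.A →ₗ[R] F, ∃ g : G.P →ₗ[R] F, ∀ a, g (G.d a) = f a) (x : F) : x = 0 := by
  have hx : t.torsion R ≤ LinearMap.ker (LinearMap.toSpanSingleton R F x) := fun r hr =>
    isT_torsion.apply_eq_zero hF (LinearMap.toSpanSingleton R F x ∘ₗ Submodule.subtype _) ⟨r, hr⟩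
  let φ := (t.torsion R).liftQ _ hx
  suffices hφ : ∀ r, φ r = 0 by
    have := hφ (Submodule.Quotient.mk 1)
    simpa [φ] using this
  obtain ⟨I, h', T, _, _, j, hT, hj⟩ := hG.sub
  have hφj : ∀ r, j r = 0 → φ r = 0 := by
    intro r hr
    obtain ⟨y, hy, rfl⟩ := hj r hr
    choose g hg using fun i => h (φ ∘ₗ h' ∘ₗ Finsupp.lsingle i)
    have h1 : φ ∘ₗ h' = Finsupp.lsum ℕ g ∘ₗ Finsupp.mapRange.linearMap G.d :=
      Finsupp.lhom_ext fun i a => by simpa using (hg i a).symm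
    have h2 : Finsupp.mapRange.linearMap G.d y = 0 := Finsupp.ext hy
    have h3 := LinearMap.congr_fun h1 y
    rwa [LinearMap.comp_apply, LinearMap.comp_apply, h2, map_zero] at h3
  let D : Submodule R (F × T) := LinearMap.range (φ.prod (-j))
  let i : F →ₗ[R] (F × T) ⧸ D := D.mkQ ∘ₗ LinearMap.inl R F T
  let i' : T →ₗ[R] (F × T) ⧸ D := D.mkQ ∘ₗ LinearMap.inr R F T
  have hii : ∀ r, i (φ r) = i' (j r) := fun r =>
    (Submodule.Quotient.eq D).2 ⟨r, by simp⟩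
  have hi : Function.Injective i := by
    rw [injective_iff_map_eq_zero]
    intro y hy
    obtain ⟨r, hr⟩ := (Submodule.Quotient.mk_eq_zero D).1 hy
    have h1 : φ r = y := congrArg Prod.fst hr
    have h2 : -j r = 0 := congrArg Prod.snd hr
    rw [← h1, hφj r (neg_eq_zero.1 h2)]
  let q : ((F × T) ⧸ D) →ₗ[R] T ⧸ LinearMap.range j :=
    D.mapQ _ (LinearMap.snd R F T) (by
      rintro _ ⟨r, rfl⟩
      exact ⟨-r, by simp⟩)
  have hqs : Function.Surjective q := by
    intro y
    obtain ⟨y, rfl⟩ := Submodule.mkQ_surjective _ y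
    exact ⟨i' y, rfl⟩
  have hqi : ∀ y, q (i y) = 0 := fun y => by
    show (LinearMap.range j).mkQ 0 = 0
    simp
  have hq : ∀ w, q w = 0 → ∃ y, i y = w := by
    intro w hw
    obtain ⟨⟨y, z⟩, rfl⟩ := Submodule.mkQ_surjective _ w
    obtain ⟨r, rfl⟩ := (Submodule.Quotient.mk_eq_zero _).1 hw
    refine ⟨y + φ r, ?_⟩
    rw [map_add, hii]
    show D.mkQ (y, 0) + D.mkQ (0, j r) = D.mkQ (y, j r)
    rw [← map_add]
    congr 1
    simp
  let V := G.P ⧸ LinearMap.range G.d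
  -- `h` forces `Ext¹(V, F) = 0`: lift to `G.P` by projectivity; on the image of `G.d` the lift
  -- lands in `F`, and `h` provides the correction making it descend to `V`.
  have hV : ∀ v : V →ₗ[R] T ⧸ LinearMap.range j, ∃ v' : V →ₗ[R] (F × T) ⧸ D, q ∘ₗ v' = v := by
    intro v
    obtain ⟨c, hc⟩ := Module.projective_lifting_property q (v ∘ₗ Submodule.mkQ _) hqs
    have hc' : ∀ p, q (c p) = v (Submodule.Quotient.mk p) := LinearMap.congr_fun hc
    let e := LinearEquiv.ofInjective i hi
    have hcd : ∀ a, c (G.d a) ∈ LinearMap.range i := fun a => by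
      refine hq _ ?_
      rw [hc', (Submodule.Quotient.mk_eq_zero (LinearMap.range G.d)).2 ⟨a, rfl⟩, map_zero]
    obtain ⟨g, hg⟩ := h (e.symm ∘ₗ (c ∘ₗ G.d).codRestrict _ hcd)
    have hg' : ∀ a, i (g (G.d a)) = c (G.d a) := fun a => by
      rw [hg]
      exact congrArg Subtype.val (e.apply_symm_apply ⟨_, hcd a⟩)
    refine ⟨(LinearMap.range G.d).liftQ (c - i ∘ₗ g) ?_, ?_⟩
    · rintro _ ⟨a, rfl⟩
      simp [hg']
    · refine Submodule.linearMap_qext _ (LinearMap.ext fun p => ?_)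
      show q (c p - i (g p)) = _
      rw [map_sub, hqi, sub_zero, hc']
      rfl
  obtain ⟨J, p, hp, hpT⟩ := hG.pres (hT.of_surjective (LinearMap.range j).mkQ
    (Submodule.mkQ_surjective _))
  choose σ hσ using fun a : J => hV (p ∘ₗ Finsupp.lsingle a)
  let s : (J →₀ V) →ₗ[R] (F × T) ⧸ D := Finsupp.lsum ℕ σ
  have hs : ∀ y, q (s y) = p y := LinearMap.congr_fun (f := q ∘ₗ s) (g := p)
    (Finsupp.lhom_ext fun a v => by simpa [s] using LinearMap.congr_fun (hσ a) v)
  -- On `ker p` the lift `s` takes values in `F`. The kernel is torsion and `F` torsion-free, so `s`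
  -- descends to a section of `q`.
  have hsk : LinearMap.ker p ≤ LinearMap.ker s := by
    let e := LinearEquiv.ofInjective i hi
    have hr : ∀ y : LinearMap.ker p, s y ∈ LinearMap.range i := fun y => hq _ (by
      rw [hs, LinearMap.mem_ker.1 y.2])
    intro y hy
    have := hpT.apply_eq_zero (hF.of_equiv e) ((s ∘ₗ Submodule.subtype _).codRestrict _ hr) ⟨y, hy⟩
    exact congrArg Subtype.val this
  let s' := (LinearMap.ker p).liftQ s hsk ∘ₗ (p.quotKerEquivOfSurjective hp).symm.toLinearMap
  have hs' : ∀ y, q (s' y) = y := fun y => by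
    obtain ⟨y, rfl⟩ := hp y
    have : (p.quotKerEquivOfSurjective hp).symm (p y) = Submodule.Quotient.mk y := by
      rw [LinearEquiv.symm_apply_eq]; rfl
    simp [s', this, hs]
  have hr : ∀ w, (LinearMap.id - s' ∘ₗ q : _ →ₗ[R] (F × T) ⧸ D) w ∈ LinearMap.range i := fun w =>
    hq _ (by simp [hs'])
  let ρ := (LinearMap.id - s' ∘ₗ q).codRestrict _ hr
  intro r
  have h1 : ρ (i' (j r)) = 0 := hT.apply_eq_zero (hF.of_equiv (LinearEquiv.ofInjective i hi))
    (ρ ∘ₗ i') (j r)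
  rw [← hii] at h1
  have h2 : i (φ r) - s' (q (i (φ r))) = 0 := congrArg Subtype.val h1
  rw [hqi, map_zero, sub_zero] at h2
  exact hi (h2.trans (map_zero i).symm)

/-- Any map `V → H⁰(C)` is induced by a chain map `G → C`, hence is zero; as `V` generates the
torsion module `H⁰(C)`, this module vanishes. Maps `G.A → ker C.d` also give chain maps, whose
null-homotopies are extensions to `G.P`, so `subsingleton_of_extend` kills `H⁻¹(C)`. -/
theorem id_eq_zero (hG : G.IsTilting) (C : t.TwoTerm) (h : ∀ s : G ⟶ C, s = 0) : 𝟙 C = 0 := by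
  have hsurj : Function.Surjective C.d := by
    obtain ⟨I, p, hp, -⟩ := hG.pres C.isT
    have hp0 : p = 0 := by
      refine Finsupp.lhom_ext fun i v => ?_
      obtain ⟨x, rfl⟩ := Submodule.mkQ_surjective _ v
      let u : G.P →ₗ[R] C.P ⧸ LinearMap.range C.d := p ∘ₗ Finsupp.lsingle i ∘ₗ Submodule.mkQ _
      obtain ⟨u₀, hu₀⟩ := Module.projective_lifting_property (LinearMap.range C.d).mkQ u
        (Submodule.mkQ_surjective _)
      have hu₀' : ∀ x, Submodule.Quotient.mk (u₀ x) = u x := LinearMap.congr_fun hu₀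
      obtain ⟨g, hg⟩ := hG.lift C.d C.isF (u₀ ∘ₗ G.d) fun a => by
        have : u (G.d a) = 0 := by
          show p (Finsupp.single i (Submodule.Quotient.mk (G.d a))) = 0
          rw [(Submodule.Quotient.mk_eq_zero (LinearMap.range G.d)).2 ⟨a, rfl⟩]
          simp
        exact (Submodule.Quotient.mk_eq_zero _).1 ((hu₀' (G.d a)).trans this)
      obtain ⟨k, -, hk⟩ := (homMk_eq_zero_iff _).1 (h (homMk g u₀ hg))
      show u x = 0
      rw [← hu₀', hk]
      exact (Submodule.Quotient.mk_eq_zero _).2 ⟨_, rfl⟩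
    intro y
    obtain ⟨z, hz⟩ := hp (Submodule.Quotient.mk y)
    rw [hp0] at hz
    exact (Submodule.Quotient.mk_eq_zero _).1 hz.symm
  have hinj : LinearMap.ker C.d = ⊥ := by
    rw [eq_bot_iff]
    intro x hx
    refine congrArg Subtype.val (hG.subsingleton_of_extend C.isF (fun f => ?_) ⟨x, hx⟩)
    obtain ⟨k, hk₁, hk₀⟩ := (homMk_eq_zero_iff _).1
      (h (homMk (Submodule.subtype _ ∘ₗ f) 0 fun a => LinearMap.mem_ker.1 (f a).2))
    exact ⟨k.codRestrict _ fun p => (hk₀ p).symm, fun a => Subtype.ext (hk₁ a).symm⟩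
  let e := LinearEquiv.ofBijective C.d ⟨LinearMap.ker_eq_bot.1 hinj, hsurj⟩
  refine (homMk_eq_zero_iff (fun _ => rfl)).2 ⟨e.symm, fun a => ?_, fun p => ?_⟩
  · exact (e.symm_apply_apply a).symm
  · exact (e.apply_symm_apply p).symm

/-- Every map from `G` to the cokernel comes from `N`, hence from `M`, hence is zero. By
`id_eq_zero` the cokernel is zero. -/
theorem isConeEpi (hG : G.IsTilting) {M N : t.TwoTerm} {f₁ : M.A →ₗ[R] N.A} {f₀ : M.P →ₗ[R] N.P}
    (hf : ∀ a, N.d (f₁ a) = f₀ (M.d a)) (h : ∀ s : G ⟶ N, ∃ s', s' ≫ homMk f₁ f₀ hf = s) :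
    IsConeEpi hf := by
  refine isConeEpi_of_toCoker_eq_zero ?_
  rw [← Category.comp_id (toCoker hf), hG.id_eq_zero (coker hf), Limits.comp_zero]
  intro s
  obtain ⟨s, rfl⟩ := hG.exists_comp_toCoker hf s
  obtain ⟨s, rfl⟩ := h s
  rw [Category.assoc, homMk_comp_toCoker, Limits.comp_zero]

theorem separates (hG : G.IsTilting)
    {M N : t.TwoTerm} (f : M ⟶ N) (h : ∀ s : G ⟶ M, s ≫ f = 0) : f = 0 := by
  obtain ⟨p, hp⟩ := exists_pow_desc (fun s : G ⟶ M => s)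
  obtain ⟨p₁, p₀, hp', rfl⟩ := exists_homMk p
  have := (hG.isConeEpi hp' fun s => ⟨_, hp s⟩).epi
  rw [← cancel_epi (homMk p₁ p₀ hp'), Limits.comp_zero]
  refine pow_hom_ext fun s => ?_
  rw [← Category.assoc, hp, h, Limits.comp_zero]

/-- The complex `M.A → Z`, with `Z` the cycles of the cone, represents the kernel of the
epimorphism; `κ` is its model with a free term in degree 0. The hypothesis and `separates` give `v ≫
u = 0`, and the null-homotopy descends to a map `w` on `Z`, from which `r` is built. -/
theorem exists_factor (hG : G.IsTilting)
    {M N X : t.TwoTerm} {f₁ : M.A →ₗ[R] N.A} {f₀ : M.P →ₗ[R] N.P}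
    {hf : ∀ a, N.d (f₁ a) = f₀ (M.d a)} (h : IsConeEpi hf) (u : M ⟶ X)
    (hu : ∀ s : G ⟶ M, s ≫ homMk f₁ f₀ hf = 0 → s ≫ u = 0) :
    ∃ r : N ⟶ X, homMk f₁ f₀ hf ≫ r = u := by
  obtain ⟨u₁, u₀, hu', rfl⟩ := exists_homMk u
  let Z := LinearMap.ker (coneD N f₀)
  let c : (Z →₀ R) →ₗ[R] Z := Finsupp.linearCombination R id
  have hc : Function.Surjective c := Finsupp.linearCombination_id_surjective R Z
  have hF : t.IsF (LinearMap.ker (toConeZ hf)) :=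
    M.isF.of_injective (Submodule.inclusion fun a ha => LinearMap.mem_ker.2
      (congrArg (fun z : Z => z.1.2) (LinearMap.mem_ker.1 ha))) (Submodule.inclusion_injective _)
  let κ : t.TwoTerm := ofMap ((Submodule.mkQ_surjective _).comp hc) hF h.isT
  let v : κ ⟶ M := homMk (M := κ) (LinearMap.fst R _ _ ∘ₗ (pullback _ _).subtype)
    (LinearMap.snd R _ _ ∘ₗ Z.subtype ∘ₗ c) fun x => congrArg (fun z => z.1.2) x.2
  have hZ : ∀ z : Z, N.d z.1.1 = f₀ z.1.2 := fun z => by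
    have := LinearMap.mem_ker.1 z.2
    rwa [coneD_apply, sub_eq_zero] at this
  have hv : v ≫ homMk f₁ f₀ hf = 0 := homMk_comp_eq_zero_iff.2
    ⟨LinearMap.fst R _ _ ∘ₗ Z.subtype ∘ₗ c, fun x => congrArg (fun z => z.1.1) x.2,
      fun l => (hZ (c l)).symm⟩
  have hvu : v ≫ homMk u₁ u₀ hu' = 0 := hG.separates _ fun s => by
    rw [← Category.assoc]
    exact hu _ (by rw [Category.assoc, hv, Limits.comp_zero])
  obtain ⟨w₀, hw₁, hw₂⟩ := homMk_comp_eq_zero_iff.1 hvu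
  have hwc : LinearMap.ker c ≤ LinearMap.ker w₀ := fun l hl => by
    have := hw₁ ⟨(0, l), by
      show toConeZ hf 0 = c l
      rw [map_zero, LinearMap.mem_ker.1 hl]⟩
    exact this.symm.trans (map_zero u₁)
  let w : Z →ₗ[R] X.A :=
    (LinearMap.ker c).liftQ w₀ hwc ∘ₗ (c.quotKerEquivOfSurjective hc).symm.toLinearMap
  have hwl : ∀ l, w (c l) = w₀ l := fun l => by
    have : (c.quotKerEquivOfSurjective hc).symm (c l) = Submodule.Quotient.mk l := by
      rw [LinearEquiv.symm_apply_eq]; rfl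
    simp [w, this]
  have hwu₁ : ∀ a, u₁ a = w (toConeZ hf a) := fun a => by
    obtain ⟨l, hl⟩ := hc (toConeZ hf a)
    rw [← hl, hwl]
    exact hw₁ ⟨(a, l), hl.symm⟩
  have hwu₀ : ∀ z : Z, u₀ z.1.2 = X.d (w z) := fun z => by
    obtain ⟨l, rfl⟩ := hc z
    rw [hwl]
    exact hw₂ l
  -- `N.P` is projective, so `Z` is a direct summand of `N.A × M.P` with retraction `ρ`. The
  -- components of `w ∘ ρ` are the degree -1 part of `r` and, up to sign, the homotopy.
  obtain ⟨σ, hσ⟩ := Module.projective_lifting_property (coneD N f₀) LinearMap.id h.surjective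
  have hσ' : ∀ x, coneD N f₀ (σ x) = x := LinearMap.congr_fun hσ
  let ρ : N.A × M.P →ₗ[R] Z := (LinearMap.id - σ ∘ₗ coneD N f₀).codRestrict _ fun x => by
    show coneD N f₀ (x - σ (coneD N f₀ x)) = 0
    rw [map_sub, hσ', sub_self]
  have hρ : ∀ z : Z, ρ z = z := fun z => Subtype.ext (by
    show z.1 - σ (coneD N f₀ z.1) = z.1
    rw [LinearMap.mem_ker.1 z.2, map_zero, sub_zero])
  let v₁ : N.A →ₗ[R] X.A := w ∘ₗ ρ ∘ₗ LinearMap.inl R _ _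
  let v₂ : M.P →ₗ[R] X.A := w ∘ₗ ρ ∘ₗ LinearMap.inr R _ _
  let θ : N.A × M.P →ₗ[R] X.P := X.d ∘ₗ w ∘ₗ ρ - u₀ ∘ₗ LinearMap.snd R _ _
  let v₀ : N.P →ₗ[R] X.P := θ ∘ₗ σ
  have hv₀ : ∀ x, v₀ (coneD N f₀ x) = θ x := fun x => by
    have h1 : θ (ρ x) = 0 := by
      show X.d (w (ρ (ρ x))) - u₀ (ρ x).1.2 = 0
      rw [hρ, hwu₀, sub_self]
    have h2 : θ x - v₀ (coneD N f₀ x) = 0 := by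
      rw [← h1]
      show _ = θ (x - σ (coneD N f₀ x))
      rw [map_sub]
      rfl
    exact (sub_eq_zero.1 h2).symm
  refine ⟨homMk v₁ v₀ fun b => ?_, homMk_comp_eq_homMk_iff.2 ⟨-v₂, fun a => ?_, fun p => ?_⟩⟩
  · have h1 := hv₀ (b, 0)
    simp only [coneD_apply, map_zero, sub_zero] at h1
    rw [h1]
    simp [θ, v₁]
  · rw [hwu₁, ← hρ (toConeZ hf a), toConeZ_coe]
    have h1 : (f₁ a, M.d a) = (f₁ a, 0) + ((0, M.d a) : N.A × M.P) := by simp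
    rw [h1, map_add, map_add, LinearMap.neg_apply]
    exact (add_neg_cancel_right _ _).symm
  · have h1 := hv₀ (0, p)
    simp only [coneD_apply, map_zero, zero_sub, map_neg] at h1
    rw [← neg_neg (v₀ (f₀ p)), h1]
    show -(X.d (v₂ p) - u₀ p) = u₀ p + X.d (-v₂ p)
    rw [map_neg]
    abel

/-- Both terms of `G` are finitely generated, so a chain map to `G.pow I` has finite support.
Induction on the support splits off one coordinate, an endomorphism of `G`, at a time. -/
theorem mem_span_ι (hG : G.IsTilting) {I : Type u} (s : G ⟶ G.pow I) :
    s ∈ Submodule.span (End G)ᵐᵒᵖ (Set.range (G.ι : I → (G ⟶ G.pow I))) := by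
  classical
  obtain ⟨s₁, s₀, hs, rfl⟩ := exists_homMk s
  have := hG.finite_A
  have := hG.finite_P
  obtain ⟨S₁, hS₁⟩ := LinearMap.exists_finset_support_subset s₁
  obtain ⟨S₀, hS₀⟩ := LinearMap.exists_finset_support_subset s₀
  replace hS₁ : ∀ a i, i ∉ S₁ ∪ S₀ → s₁ a i = 0 := fun a i hi => by
    by_contra h
    exact hi (Finset.mem_union_left _ (hS₁ a (Finsupp.mem_support_iff.2 h)))
  replace hS₀ : ∀ a i, i ∉ S₁ ∪ S₀ → s₀ a i = 0 := fun a i hi => by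
    by_contra h
    exact hi (Finset.mem_union_right _ (hS₀ a (Finsupp.mem_support_iff.2 h)))
  generalize S₁ ∪ S₀ = S at hS₁ hS₀
  induction S using Finset.induction_on generalizing s₁ s₀ with
  | empty =>
    have : homMk s₁ s₀ hs = 0 := (homMk_eq_zero_iff _).2
      ⟨0, fun a => Finsupp.ext fun i => hS₁ a i (by simp),
        fun a => (Finsupp.ext fun i => hS₀ a i (by simp)).trans (map_zero (G.pow I).d).symm⟩
    rw [this]
    exact zero_mem _
  | insert i S hi ih =>
    have hs' : ∀ a, G.d (s₁ a i) = s₀ (G.d a) i := fun a => DFunLike.congr_fun (hs a) i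
    let e : G ⟶ G := homMk (Finsupp.lapply i ∘ₗ s₁) (Finsupp.lapply i ∘ₗ s₀) hs'
    have he : ∀ a, (G.pow I).d ((s₁ - Finsupp.lsingle i ∘ₗ Finsupp.lapply i ∘ₗ s₁) a) =
        (s₀ - Finsupp.lsingle i ∘ₗ Finsupp.lapply i ∘ₗ s₀) (G.d a) := fun a => by
      show (G.pow I).d (s₁ a - Finsupp.single i (s₁ a i)) = _
      refine (map_sub (G.pow I).d _ _).trans ?_
      refine (congrArg₂ _ (hs a) (Finsupp.mapRange_single (hf := map_zero G.d))).trans ?_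
      rw [hs']
      rfl
    have h1 : homMk (N := G.pow I) (s₁ - Finsupp.lsingle i ∘ₗ Finsupp.lapply i ∘ₗ s₁)
          (s₀ - Finsupp.lsingle i ∘ₗ Finsupp.lapply i ∘ₗ s₀) he =
        homMk (N := G.pow I) s₁ s₀ hs - MulOpposite.op (show End G from e) • G.ι i := rfl
    rw [eq_sub_iff_add_eq] at h1
    rw [← h1]
    refine add_mem (ih _ _ he ?_ ?_) (Submodule.smul_mem _ _ (Submodule.subset_span ⟨i, rfl⟩))
    · intro a j hj
      show s₁ a j - Finsupp.single i (s₁ a i) j = 0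
      by_cases hij : j = i
      · subst hij
        simp
      · rw [hS₁ a j (by simp [hij, hj]), Finsupp.single_eq_of_ne hij, sub_zero]
    · intro a j hj
      show s₀ a j - Finsupp.single i (s₀ a i) j = 0
      by_cases hij : j = i
      · subst hij
        simp
      · rw [hS₀ a j (by simp [hij, hj]), Finsupp.single_eq_of_ne hij, sub_zero]

theorem isProgenerator (hG : G.IsTilting) : IsProgenerator G G.pow G.ι where
  exists_desc := exists_pow_desc
  span_eq_top I := eq_top_iff.2 fun s _ => hG.mem_span_ι s
  separates := hG.separates
  exists_factor {M N} p hp q hq := by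
    obtain ⟨p₁, p₀, hp', rfl⟩ := exists_homMk p
    exact hG.exists_factor (hG.isConeEpi hp' fun s => ⟨_, hp s⟩) q hq
  exists_coker f := by
    obtain ⟨f₁, f₀, hf, rfl⟩ := exists_homMk f
    refine ⟨coker hf, toCoker hf, hG.exists_comp_toCoker hf, fun s =>
      ⟨hG.exists_comp_of_comp_toCoker hf s, ?_⟩⟩
    rintro ⟨s, rfl⟩
    rw [Category.assoc, homMk_comp_toCoker, Limits.comp_zero]

theorem isModuleCategory (hG : G.IsTilting) : IsModuleCategory.{u} t.TwoTerm :=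
  have := hG.isProgenerator.isEquivalence
  ⟨(End G)ᵐᵒᵖ, inferInstance, ⟨(preadditiveCoyonedaObj G).asEquivalence⟩⟩

end IsTilting

end TwoTerm

end TorsionPair

/-! ### From the five conditions to a tilting object. -/

theorem LinearMap.exists_comp_eq_of_ker_le {R M N L : Type*} [Ring R] [AddCommGroup M]
    [Module R M] [AddCommGroup N] [Module R N] [AddCommGroup L] [Module R L] {p : M →ₗ[R] N}
    (hp : Function.Surjective p) {f : M →ₗ[R] L} (h : LinearMap.ker p ≤ LinearMap.ker f) :
    ∃ g : N →ₗ[R] L, ∀ x, g (p x) = f x := by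
  refine ⟨(LinearMap.ker p).liftQ f h ∘ₗ (p.quotKerEquivOfSurjective hp).symm.toLinearMap,
    fun x => ?_⟩
  have : (p.quotKerEquivOfSurjective hp).symm (p x) = Submodule.Quotient.mk x := by
    rw [LinearEquiv.symm_apply_eq]; rfl
  simp [this]

theorem pres_self {R : Type u} [Ring R] (V : ModuleCat.{u} R) : Pres V V := by
  refine ⟨PUnit, PUnit, 0, (Finsupp.uniqueLinearEquiv R V PUnit.unit).toLinearMap, ?_,
    (Finsupp.uniqueLinearEquiv R V PUnit.unit).surjective⟩
  intro x
  simp only [LinearEquiv.coe_coe, LinearEquiv.map_eq_zero_iff, Set.mem_range,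
    LinearMap.zero_apply, exists_const]
  exact eq_comm

namespace TorsionPair

variable {R : Type u} [Ring R] {t : TorsionPair (ModuleCat.{u} R)}

/-- The conditions on a three-term complex which characterize the torsion pairs whose heart is a
module category. -/
structure IsTiltingComplex (t : TorsionPair (ModuleCat.{u} R)) (G : ThreeTermComplex R) :
    Prop where
  eq_pres : t.T = Pres G.H0
  pres_le : Pres G.H0 ≤ KerExtOne G.H0
  finite_Q : Module.Finite R G.Q
  finite_P : Module.Finite R G.P
  projective_P : Module.Projective R G.P
  isF : t.F (ModuleCat.of R G.HNegOne)
  le_reject : G.HNegOne ≤ reject t.T (G.Q ⧸ LinearMap.range G.j)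
  le_kerExtOne : t.F ≤ KerExtOne G.cokerJ
  exists_subGen : ∃ (I : Type u) (h : (I →₀ G.Q ⧸ LinearMap.range G.j) →ₗ[R] R ⧸ t.torsion R),
    SubGen G.H0
      (ModuleCat.of R ((R ⧸ t.torsion R) ⧸ LinearMap.range (h ∘ₗ G.HNegOneIncl I)))

namespace IsTiltingComplex

variable {G : ThreeTermComplex R}

/-- The map `Q / X → P` induced by the differential. -/
def quotD (G : ThreeTermComplex R) : (G.Q ⧸ LinearMap.range G.j) →ₗ[R] G.P :=
  (LinearMap.range G.j).liftQ G.d (by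
    rintro _ ⟨x, rfl⟩
    exact LinearMap.congr_fun G.d_comp_j x)

theorem range_quotD (G : ThreeTermComplex R) : LinearMap.range (quotD G) = LinearMap.range G.d :=
  Submodule.range_liftQ _ _ _

theorem ker_quotD (G : ThreeTermComplex R) : LinearMap.ker (quotD G) = G.HNegOne :=
  Submodule.ker_liftQ _ _ _

theorem isT_H0 (h : t.IsTiltingComplex G) : t.IsT (G.P ⧸ LinearMap.range G.d) := by
  show t.T G.H0
  rw [h.eq_pres]
  exact pres_self _

/-- The two-term complex `Q / X → P`. -/
abbrev toTwoTerm (h : t.IsTiltingComplex G) : t.TwoTerm where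
  A := G.Q ⧸ LinearMap.range G.j
  P := G.P
  d := quotD G
  projective := h.projective_P
  isF := by
    rw [ker_quotD]
    exact h.isF
  isT := by
    rw [range_quotD]
    exact h.isT_H0

theorem isTilting (h : t.IsTiltingComplex G) : h.toTwoTerm.IsTilting where
  extend {T} _ _ hT f := by
    -- The reject condition lets `f` descend to the image of `d`; vanishing of `Ext¹(V, T)` then
    -- extends it to `P`.
    have hk : LinearMap.ker (quotD G).rangeRestrict ≤ LinearMap.ker f := by
      rw [LinearMap.ker_rangeRestrict, ker_quotD]
      refine h.le_reject.trans ?_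
      exact (iInf_le _ (ModuleCat.of R T)).trans ((iInf_le _ hT).trans (iInf_le _ f))
    obtain ⟨g, hg⟩ := LinearMap.exists_comp_eq_of_ker_le
      (LinearMap.surjective_rangeRestrict _) hk
    have hext : KerExtOne (ModuleCat.of R (G.P ⧸ LinearMap.range (quotD G)))
        (ModuleCat.of R T) := by
      rw [range_quotD]
      refine h.pres_le _ ?_
      rw [← h.eq_pres]
      exact hT
    obtain ⟨g', hg'⟩ := hext.exists_extension (Submodule.subtype_injective _)
      (LinearMap.exact_subtype_mkQ (LinearMap.range (quotD G))) (Submodule.mkQ_surjective _) g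
    exact ⟨g', fun a => (LinearMap.congr_fun hg' ((quotD G).rangeRestrict a)).trans (hg a)⟩
  lift {E K} _ _ _ _ p hp f hf := by
    have hext : KerExtOne (ModuleCat.of R (G.Q ⧸ LinearMap.range G.j))
        (ModuleCat.of R (LinearMap.ker p)) := h.le_kerExtOne _ hp
    obtain ⟨g, hg⟩ := hext.exists_lift (Submodule.subtype_injective _)
      (p := p.rangeRestrict) (fun x => by
        rw [← LinearMap.mem_ker, LinearMap.ker_rangeRestrict]
        simp) (LinearMap.surjective_rangeRestrict _) (f.codRestrict _ hf)
    exact ⟨g, fun a => congrArg Subtype.val (LinearMap.congr_fun hg a)⟩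
  pres {T} _ _ hT := by
    show ∃ (I : Type u) (p : (I →₀ G.P ⧸ LinearMap.range (quotD G)) →ₗ[R] T),
      Function.Surjective p ∧ t.IsT (LinearMap.ker p)
    rw [range_quotD]
    have hT' : t.T (ModuleCat.of R T) := hT
    rw [h.eq_pres] at hT'
    obtain ⟨I, J, f, p, hfp, hp⟩ := hT'
    -- This is what `Pres` gives beyond `Gen`: the kernel of the presentation is a quotient of
    -- `V^(J)` and hence torsion.
    refine ⟨I, p, hp, (h.isT_H0.finsupp J).of_surjective
      (f.codRestrict _ fun x => LinearMap.mem_ker.2 (hfp.apply_apply_eq_zero x)) ?_⟩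
    rintro ⟨x, hx⟩
    obtain ⟨y, hy⟩ := (hfp x).1 hx
    exact ⟨y, Subtype.ext hy⟩
  finite_A := have := h.finite_Q; inferInstanceAs (Module.Finite R (G.Q ⧸ LinearMap.range G.j))
  finite_P := h.finite_P
  sub := by
    obtain ⟨I, g, N, i, ⟨J, p, hp⟩, hi⟩ := h.exists_subGen
    refine ⟨I, g, N, inferInstance, inferInstance, i ∘ₗ Submodule.mkQ _,
      (h.isT_H0.finsupp J).of_surjective p hp, fun r hr => ?_⟩
    obtain ⟨x, hx⟩ := (Submodule.Quotient.mk_eq_zero _).1 (hi (hr.trans (map_zero i).symm))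
    refine ⟨G.HNegOneIncl I x, fun a => ?_, hx⟩
    rw [← LinearMap.mem_ker]
    show _ ∈ LinearMap.ker (quotD G)
    rw [ker_quotD]
    exact (x a).2

end IsTiltingComplex

end TorsionPair

/-! ### A directed system of quotients -/

namespace DirectedQuotients

variable {R B : Type u} [Ring R] [AddCommGroup B] [Module R B] [DecidableEq B]
  (N : Finset B → Submodule R B)

/-- The sum of all quotients. -/
abbrev Sum₀ : Type u := DirectSum (Finset B) fun i => B ⧸ N i

/-- The sum of the sources of all transition maps. -/
abbrev Sum₁ : Type u := DirectSum (Finset B × Finset B) fun i => B ⧸ N i.1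

/-- The sum of the sources of all pairs of composable transition maps. -/
abbrev Sum₂ : Type u := DirectSum (Finset B × Finset B × Finset B) fun i => B ⧸ N i.1

/-- The coprojections of `Sum₀`. -/
def e₀ (i : Finset B) : B →ₗ[R] Sum₀ N := DirectSum.lof R _ _ i ∘ₗ (N i).mkQ

/-- The coprojections of `Sum₁`. -/
def e₁ (i j : Finset B) : B →ₗ[R] Sum₁ N :=
  DirectSum.lof R _ (fun i : Finset B × Finset B => B ⧸ N i.1) (i, j) ∘ₗ (N i).mkQ

variable {N}

theorem e₀_eq_zero {i : Finset B} {x : B} (h : x ∈ N i) : e₀ N i x = 0 := by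
  rw [e₀, LinearMap.comp_apply, Submodule.mkQ_apply, (Submodule.Quotient.mk_eq_zero _).2 h,
    map_zero]

theorem e₁_eq_zero {i j : Finset B} {x : B} (h : x ∈ N i) : e₁ N i j x = 0 := by
  rw [e₁, LinearMap.comp_apply, Submodule.mkQ_apply, (Submodule.Quotient.mk_eq_zero _).2 h,
    map_zero]

variable (hN : Monotone N)

/-- The map whose cokernel is the direct limit. -/
def g : Sum₁ N →ₗ[R] Sum₀ N := DirectSum.toModule R _ _ fun i =>
  (N i.1).liftQ (e₀ N i.1 - e₀ N (i.1 ∪ i.2)) fun x hx => by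
    rw [LinearMap.mem_ker, LinearMap.sub_apply, e₀_eq_zero hx,
      e₀_eq_zero (hN Finset.subset_union_left hx), sub_self]

theorem g_e₁ (i j : Finset B) (x : B) : g hN (e₁ N i j x) = e₀ N i x - e₀ N (i ∪ j) x := by
  rw [g, e₁, LinearMap.comp_apply, DirectSum.toModule_lof]
  rfl

/-- The map whose range is the kernel of `g`. -/
def g' : Sum₂ N →ₗ[R] Sum₁ N := DirectSum.toModule R _ _ fun i =>
  (N i.1).liftQ (e₁ N i.1 i.2.1 + e₁ N (i.1 ∪ i.2.1) i.2.2 - e₁ N i.1 (i.2.1 ∪ i.2.2))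
    fun x hx => by
      rw [LinearMap.mem_ker, LinearMap.sub_apply, LinearMap.add_apply, e₁_eq_zero hx,
        e₁_eq_zero hx, e₁_eq_zero (hN Finset.subset_union_left hx), add_zero, sub_self]

theorem g'_lof (i j k : Finset B) (x : B) :
    g' hN (DirectSum.lof R _ (fun i : Finset B × Finset B × Finset B => B ⧸ N i.1) (i, j, k)
      (Submodule.Quotient.mk x)) = e₁ N i j x + e₁ N (i ∪ j) k x - e₁ N i (j ∪ k) x := by
  rw [g', DirectSum.toModule_lof]
  rfl

theorem g_g' (y : Sum₂ N) : g hN (g' hN y) = 0 := by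
  refine LinearMap.congr_fun (f := g hN ∘ₗ g' hN) (g := 0)
    (DirectSum.linearMap_ext _ fun ⟨i, j, k⟩ =>
      Submodule.linearMap_qext _ (LinearMap.ext fun x => ?_)) y
  show g hN (g' hN (DirectSum.lof R _ (fun i : Finset B × Finset B × Finset B => B ⧸ N i.1)
    (i, j, k) (Submodule.Quotient.mk x))) = 0
  rw [g'_lof]
  simp only [map_add, map_sub, g_e₁, Finset.union_assoc]
  abel

variable (N) in
/-- A contracting homotopy. -/
def homotopy (k : Finset B) : Sum₀ N →ₗ[R] Sum₁ N := DirectSum.toModule R _ _ fun i =>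
  (N i).liftQ (e₁ N i k) fun _ hx => e₁_eq_zero hx

theorem homotopy_e₀ (i k : Finset B) (x : B) : homotopy N k (e₀ N i x) = e₁ N i k x := by
  rw [homotopy, e₀, LinearMap.comp_apply, DirectSum.toModule_lof]
  rfl

/-- The defect `y - homotopy (g y)` on the generator `e₁ i j x` is `g'` of the generator at `(i, j,
k)` as soon as `j ⊆ k`. A given `y` involves finitely many `j`, so a large `k` works, and exactness
of `g'`, `g` follows. -/
theorem exists_sub_homotopy_mem_range (y : Sum₁ N) : ∃ k₀ : Finset B, ∀ k, k₀ ⊆ k →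
    y - homotopy N k (g hN y) ∈ LinearMap.range (g' hN) := by
  induction y using DirectSum.induction_on with
  | zero => exact ⟨∅, fun k _ => by simp⟩
  | of i x =>
    obtain ⟨i, j⟩ := i
    obtain ⟨x, rfl⟩ := Submodule.mkQ_surjective _ x
    refine ⟨j, fun k hk => ⟨DirectSum.lof R _
      (fun i : Finset B × Finset B × Finset B => B ⧸ N i.1) (i, j, k)
      (Submodule.Quotient.mk x), ?_⟩⟩
    show _ = e₁ N i j x - homotopy N k (g hN (e₁ N i j x))
    rw [g'_lof, g_e₁, map_sub, homotopy_e₀, homotopy_e₀, Finset.union_eq_right.2 hk]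
    abel
  | add x y hx hy =>
    obtain ⟨k₁, h₁⟩ := hx
    obtain ⟨k₂, h₂⟩ := hy
    refine ⟨k₁ ∪ k₂, fun k hk => ?_⟩
    have := add_mem (h₁ k (Finset.subset_union_left.trans hk))
      (h₂ k (Finset.subset_union_right.trans hk))
    rw [map_add, map_add]
    convert this using 1
    abel

theorem exact_g'_g : Function.Exact (g' hN) (g hN) := by
  intro y
  refine ⟨fun hy => ?_, ?_⟩
  · obtain ⟨k, hk⟩ := exists_sub_homotopy_mem_range hN y
    have := hk k le_rfl
    rwa [hy, map_zero, sub_zero] at this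
  · rintro ⟨x, rfl⟩
    exact g_g' hN x

/-- The direct limit is zero: the class of `x` dies at stage `i ∪ {x}`. -/
theorem g_surjective (hmem : ∀ i, ∀ x ∈ i, x ∈ N i) : Function.Surjective (g hN) := by
  intro y
  induction y using DirectSum.induction_on with
  | zero => exact ⟨0, map_zero _⟩
  | of i x =>
    obtain ⟨x, rfl⟩ := Submodule.mkQ_surjective _ x
    refine ⟨e₁ N i {x} x, ?_⟩
    rw [g_e₁, e₀_eq_zero (i := i ∪ {x}) (hmem _ x (by simp)), sub_zero]
    rfl
  | add x y hx hy =>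
    obtain ⟨x, rfl⟩ := hx
    obtain ⟨y, rfl⟩ := hy
    exact ⟨x + y, map_add _ _ _⟩

/-- Let `k` contain all indices in the finite support of the lift. The projection of the stages
below `k` to `B ⧸ N k` kills `g` of the summands involved, hence kills `e₀ N ∅ x` for every `x`,
whose image is the class of `x`. -/
theorem exists_eq_top (f : B →ₗ[R] Sum₁ N) (hf : ∀ x, g hN (f x) = e₀ N ∅ x)
    (S : Finset (Finset B × Finset B)) (hS : ∀ x, ∀ i ∉ S, f x i = 0) : ∃ i, N i = ⊤ := by
  classical
  let k : Finset B := S.sup fun i => i.1 ∪ i.2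
  let π : Sum₀ N →ₗ[R] B ⧸ N k := DirectSum.toModule R _ _ fun i =>
    if h : i ⊆ k then Submodule.factor (hN h) else 0
  have hπ : ∀ i x, i ⊆ k → π (e₀ N i x) = Submodule.Quotient.mk x := fun i x h => by
    rw [e₀, LinearMap.comp_apply, DirectSum.toModule_lof, dif_pos h]
    rfl
  refine ⟨k, eq_top_iff.2 fun x _ => ?_⟩
  rw [← Submodule.Quotient.mk_eq_zero, ← hπ ∅ x (Finset.empty_subset _), ← hf,
    ← DirectSum.sum_support_of (f x), map_sum, map_sum]
  refine Finset.sum_eq_zero fun i hi => ?_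
  have hiS : i ∈ S := by
    by_contra h
    exact (DFinsupp.mem_support_iff.1 hi) (hS x i h)
  have hik : i.1 ∪ i.2 ⊆ k := Finset.le_sup (f := fun i => i.1 ∪ i.2) hiS
  obtain ⟨y, hy⟩ := Submodule.mkQ_surjective _ (f x i)
  rw [← hy]
  show π (g hN (e₁ N i.1 i.2 y)) = 0
  rw [g_e₁, map_sub, hπ _ _ hik, hπ _ _ (Finset.subset_union_left.trans hik), sub_self]

end DirectedQuotients

/-! ### Small projective generators of the model. -/

namespace TorsionPair

variable {R : Type u} [Ring R] {t : TorsionPair (ModuleCat.{u} R)}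

namespace TwoTerm

/-- Small projective generators. -/
structure IsSmallProjectiveGenerator (G : t.TwoTerm) : Prop where
  projective : Projective G
  separates {M N : t.TwoTerm} (f : M ⟶ N) (h : ∀ s : G ⟶ M, s ≫ f = 0) : f = 0
  small {M : t.TwoTerm} {I : Type u} (φ : G ⟶ M.pow I) : ∃ S : Finset I,
    ∀ {N : t.TwoTerm} (u : M.pow I ⟶ N), (∀ i ∈ S, M.ι i ≫ u = 0) → φ ≫ u = 0

/-- The projection modulo the span of these images corresponds to a map out of `M.pow I` that
vanishes on all coprojections, so it is zero. -/
theorem iSup_range_map_ι {S : Type u} [Ring S] (e : t.TwoTerm ≌ ModuleCat.{u} S) (M : t.TwoTerm)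
    (I : Type u) : ⨆ i : I, LinearMap.range (e.functor.map (M.ι i)).hom = ⊤ := by
  let D := ⨆ i : I, LinearMap.range (e.functor.map (M.ι i)).hom
  let q : e.functor.obj (M.pow I) ⟶ ModuleCat.of S (_ ⧸ D) := ModuleCat.ofHom D.mkQ
  let β : e.functor.obj (e.inverse.obj (ModuleCat.of S (_ ⧸ D))) ≅ ModuleCat.of S (_ ⧸ D) :=
    e.counitIso.app (ModuleCat.of S (_ ⧸ D))
  let u : M.pow I ⟶ e.inverse.obj (ModuleCat.of S (_ ⧸ D)) :=
    e.functor.preimage (q ≫ β.inv)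
  have hu : u = 0 := pow_hom_ext fun i => by
    rw [Limits.comp_zero]
    apply e.functor.map_injective
    rw [Functor.map_comp, Functor.map_preimage, Functor.map_zero, ← Category.assoc]
    have : e.functor.map (M.ι i) ≫ q = 0 := by
      ext x
      exact (Submodule.Quotient.mk_eq_zero _).2 (le_iSup (fun i : I =>
        LinearMap.range (e.functor.map (M.ι i)).hom) i ⟨x, rfl⟩)
    rw [this, Limits.zero_comp]
  have hq : q ≫ β.inv = 0 := by
    rw [← e.functor.map_preimage (q ≫ β.inv)]
    exact (congrArg e.functor.map hu).trans (Functor.map_zero _ _ _)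
  have hq0 : q = 0 := by
    rw [← Category.comp_id q, ← β.inv_hom_id, ← Category.assoc, hq, Limits.zero_comp]
  rw [← Submodule.ker_mkQ (⨆ i : I, LinearMap.range (e.functor.map (M.ι i)).hom),
    show Submodule.mkQ _ = 0 from congrArg ModuleCat.Hom.hom hq0, LinearMap.ker_zero]

/-- Take the object corresponding to the regular module `S`. A map from it is determined by the
image of `1`, which lies in the sum of finitely many of the images of the summands. -/
theorem exists_isSmallProjectiveGenerator (h : IsModuleCategory.{u} t.TwoTerm) :
    ∃ G : t.TwoTerm, G.IsSmallProjectiveGenerator := by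
  obtain ⟨S, _, ⟨e⟩⟩ := h
  let G := e.inverse.obj (ModuleCat.of S S)
  let α : ModuleCat.of S S ≅ e.functor.obj G := (e.counitIso.app _).symm
  have hzero : ∀ {M : t.TwoTerm} (f : G ⟶ M), (e.functor.map f).hom (α.hom.hom (1 : S)) = 0 →
      f = 0 := by
    intro M f hf
    apply e.functor.map_injective
    rw [← cancel_epi α.hom, Functor.map_zero, Limits.comp_zero]
    ext
    exact hf
  refine ⟨G, (e.symm.map_projective_iff _).2 inferInstance, fun {M N} f hf => ?_,
    fun {M I} φ => ?_⟩
  · apply e.functor.map_injective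
    rw [Functor.map_zero]
    ext x
    let s : ModuleCat.of S S ⟶ e.functor.obj M :=
      ModuleCat.ofHom (LinearMap.toSpanSingleton S _ x)
    have h1 := hf (e.functor.preimage (α.inv ≫ s))
    have h2 : (α.inv ≫ s) ≫ e.functor.map f = 0 := by
      rw [← e.functor.map_preimage (α.inv ≫ s), ← Functor.map_comp, h1, Functor.map_zero]
    rw [Category.assoc, ← cancel_epi α.hom, α.hom_inv_id_assoc, Limits.comp_zero] at h2
    have h3 := congrArg (fun f => f.hom (1 : S)) h2
    simpa [s] using h3
  · have hx : (e.functor.map φ).hom (α.hom.hom (1 : S)) ∈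
        ⨆ i : I, LinearMap.range (e.functor.map (M.ι i)).hom := by
      rw [iSup_range_map_ι e M I]
      exact Submodule.mem_top
    obtain ⟨T, hT⟩ := (Submodule.mem_iSup_iff_exists_finset).1 hx
    refine ⟨T, fun {N} u hu => hzero _ ?_⟩
    have hle : ⨆ i ∈ T, LinearMap.range (e.functor.map (M.ι i)).hom ≤
        LinearMap.ker (e.functor.map u).hom := by
      refine iSup₂_le fun i hi => ?_
      rintro _ ⟨y, rfl⟩
      have h1 : e.functor.map (M.ι i) ≫ e.functor.map u = 0 := by
        rw [← Functor.map_comp, hu i hi, Functor.map_zero]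
      exact congrArg (fun f => f.hom y) h1
    rw [Functor.map_comp]
    exact hle hT

namespace IsSmallProjectiveGenerator

variable {G : t.TwoTerm}

theorem of_iso (hG : G.IsSmallProjectiveGenerator)
    {G' : t.TwoTerm} (e : G ≅ G') : G'.IsSmallProjectiveGenerator where
  projective := Projective.of_iso e hG.projective
  separates f h := hG.separates f fun s => by
    rw [← cancel_epi e.inv, ← Category.assoc, h, Limits.comp_zero]
  small φ := by
    obtain ⟨S, hS⟩ := hG.small (e.hom ≫ φ)
    refine ⟨S, fun u hu => ?_⟩
    rw [← cancel_epi e.hom, ← Category.assoc, hS u hu, Limits.comp_zero]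

/-- The map `f` defines an extension `M` of `G` by `T[0]`, represented by `(d, f) : G.A → G.P × T`.
The projection `M → G` has cone with `H⁻¹ = T`, hence is epi and splits by projectivity. The
`T`-component of the section, corrected by `f ∘ k` for the homotopy `k`, is the required extension.
-/
theorem extend (hG : G.IsSmallProjectiveGenerator)
    {T : Type u} [AddCommGroup T] [Module R T] (hT : t.IsT T) (f : G.A →ₗ[R] T) :
    ∃ g : G.P →ₗ[R] T, ∀ a, g (G.d a) = f a := by
  let c : (T →₀ R) →ₗ[R] T := Finsupp.linearCombination R id
  have hc : Function.Surjective c := Finsupp.linearCombination_id_surjective R T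
  let z : G.A →ₗ[R] G.P × T := G.d.prod f
  have hF : t.IsF (LinearMap.ker z) :=
    G.isF.of_injective (Submodule.inclusion fun a ha => LinearMap.mem_ker.2
      (congrArg Prod.fst (LinearMap.mem_ker.1 ha))) (Submodule.inclusion_injective _)
  have hzT : t.IsT ((G.P × T) ⧸ LinearMap.range z) := by
    refine hT.of_exact G.isT ((LinearMap.range z).mkQ ∘ₗ LinearMap.inr R _ _)
      ((LinearMap.range z).mapQ (LinearMap.range G.d) (LinearMap.fst R _ _) (by
        rintro _ ⟨a, rfl⟩
        exact ⟨a, rfl⟩)) (fun x => ?_) (fun x => ?_)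
    · obtain ⟨⟨p, y⟩, rfl⟩ := Submodule.mkQ_surjective _ x
      constructor
      · intro hx
        obtain ⟨a, ha⟩ := (Submodule.Quotient.mk_eq_zero _).1 hx
        refine ⟨y - f a, (Submodule.Quotient.eq _).2 ⟨-a, ?_⟩⟩
        have ha : G.d a = p := ha
        simp [z, ha]
      · rintro ⟨y', hy'⟩
        rw [← hy']
        show Submodule.mkQ _ (0 : G.P) = 0
        exact map_zero _
    · obtain ⟨p, rfl⟩ := Submodule.mkQ_surjective _ x
      exact ⟨Submodule.mkQ _ (p, 0), rfl⟩
  let M : t.TwoTerm := ofMap (c := LinearMap.prodMap (LinearMap.id : G.P →ₗ[R] G.P) c)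
    ((Submodule.mkQ_surjective _).comp (Function.surjective_id.prodMap hc)) hF hzT
  let v₁ : M.A →ₗ[R] G.A := LinearMap.fst R _ _ ∘ₗ Submodule.subtype _
  let v₀ : M.P →ₗ[R] G.P := LinearMap.fst R _ _
  have hMA : ∀ x : M.A, G.d x.1.1 = x.1.2.1 ∧ f x.1.1 = c x.1.2.2 := fun x =>
    ⟨congrArg Prod.fst x.2, congrArg Prod.snd x.2⟩
  have hv : ∀ x, G.d (v₁ x) = v₀ (M.d x) := fun x => (hMA x).1
  have hepi : IsConeEpi hv := by
    refine ⟨fun p => ⟨(0, (-p, 0)), ?_⟩, ?_⟩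
    · rw [coneD_apply]
      show G.d 0 - -p = p
      rw [map_zero, sub_neg_eq_add, zero_add]
    · let θ : LinearMap.ker (coneD G v₀) →ₗ[R] T :=
        (f.coprod (-(c ∘ₗ LinearMap.snd R G.P _))) ∘ₗ Submodule.subtype _
      have hθ : ∀ x, θ x = f x.1.1 - c x.1.2.2 := fun x => (sub_eq_add_neg _ _).symm
      have hθs : Function.Surjective θ := fun y => by
        obtain ⟨l, rfl⟩ := hc y
        refine ⟨⟨(0, (0, -l)), ?_⟩, ?_⟩
        · rw [LinearMap.mem_ker, coneD_apply]
          show G.d 0 - 0 = 0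
          rw [map_zero, sub_zero]
        · rw [hθ]
          show f 0 - c (-l) = c l
          rw [map_zero, map_neg, sub_neg_eq_add, zero_add]
      have hθk : LinearMap.ker θ = LinearMap.range (toConeZ hv) := by
        ext x
        constructor
        · intro hx
          rw [LinearMap.mem_ker, hθ, sub_eq_zero] at hx
          have h1 := LinearMap.mem_ker.1 x.2
          rw [coneD_apply, sub_eq_zero] at h1
          exact ⟨⟨(x.1.1, x.1.2), Prod.ext h1 hx⟩, rfl⟩
        · rintro ⟨y, rfl⟩
          rw [LinearMap.mem_ker, hθ, sub_eq_zero]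
          exact (hMA y).2
      exact hT.of_equiv ((θ.quotKerEquivOfSurjective hθs).symm ≪≫ₗ
        Submodule.quotEquivOfEq _ _ hθk)
  have := hepi.epi
  have := hG.projective
  obtain ⟨σ₁, σ₀, hσ, hσ'⟩ := exists_homMk (Projective.factorThru (𝟙 G) (homMk v₁ v₀ hv))
  have hσv := Projective.factorThru_comp (𝟙 G) (homMk v₁ v₀ hv)
  rw [hσ', id_eq_homMk] at hσv
  obtain ⟨k, hk₁, hk₀⟩ := homMk_comp_eq_homMk_iff.1 hσv
  have hk₁' : ∀ a, (σ₁ a).1.1 = a + k (G.d a) := hk₁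
  refine ⟨c ∘ₗ LinearMap.snd R _ _ ∘ₗ σ₀ - f ∘ₗ k, fun a => ?_⟩
  have h1 : (σ₁ a).1.2 = σ₀ (G.d a) := hσ a
  show c (σ₀ (G.d a)).2 - f (k (G.d a)) = f a
  rw [← h1, ← (hMA (σ₁ a)).2, hk₁', map_add, add_sub_cancel_right]

/-- Replacing `G.A` by its pullback along `p` gives an extension of `G` by `(ker p)[1]`, an object
of the heart. It splits; projectivity of `G.P` lifts `f ∘ k` for the homotopy `k`, which turns the
`E`-component of the section into an exact lift. -/
theorem lift (hG : G.IsSmallProjectiveGenerator)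
    {E K : Type u} [AddCommGroup E] [Module R E] [AddCommGroup K] [Module R K]
    (p : E →ₗ[R] K) (hp : t.IsF (LinearMap.ker p)) (f : G.A →ₗ[R] K)
    (hf : ∀ a, ∃ e, p e = f a) : ∃ g : G.A →ₗ[R] E, ∀ a, p (g a) = f a := by
  let π : pullback f p →ₗ[R] G.A := LinearMap.fst R _ _ ∘ₗ (pullback f p).subtype
  have hπ : Function.Surjective π := fun a => by
    obtain ⟨e, he⟩ := hf a
    exact ⟨⟨(a, e), he.symm⟩, rfl⟩
  have hr : LinearMap.range (G.d ∘ₗ π) = LinearMap.range G.d :=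
    LinearMap.range_comp_of_range_eq_top _ (LinearMap.range_eq_top.2 hπ)
  let M : t.TwoTerm :=
    { A := pullback f p
      P := G.P
      d := G.d ∘ₗ π
      isF := by
        refine hp.of_exact G.isF
          (((LinearMap.inr R G.A E ∘ₗ (LinearMap.ker p).subtype).codRestrict (pullback f p)
            fun x => ?_).codRestrict (LinearMap.ker (G.d ∘ₗ π)) fun x => ?_)
          ((π ∘ₗ (LinearMap.ker (G.d ∘ₗ π)).subtype).codRestrict (LinearMap.ker G.d)
            fun x => x.2) (fun x y hxy => ?_) (fun x => ⟨fun hx => ?_, ?_⟩)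
        · show f 0 = p x
          rw [map_zero, LinearMap.mem_ker.1 x.2]
        · show G.d 0 = 0
          exact map_zero _
        · exact Subtype.ext (congrArg (fun x => x.1.1.2) hxy)
        · have h1 : x.1.1.1 = 0 := congrArg Subtype.val hx
          have h2 : f x.1.1.1 = p x.1.1.2 := x.1.2
          rw [h1, map_zero] at h2
          exact ⟨⟨x.1.1.2, h2.symm⟩, Subtype.ext (Subtype.ext (Prod.ext h1.symm rfl))⟩
        · rintro ⟨y, rfl⟩
          rfl
      isT := by
        rw [hr]
        exact G.isT }
  have hv : ∀ x : M.A, G.d (π x) = LinearMap.id (R := R) (M := G.P) (M.d x) := fun _ => rfl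
  have hepi : IsConeEpi hv := by
    refine ⟨fun p => ⟨(0, -p), ?_⟩, ?_⟩
    · rw [coneD_apply]
      simp
    · have : Subsingleton (coneH hv) := by
        refine Submodule.Quotient.subsingleton_iff.2 (eq_top_iff.2 ?_)
        rintro ⟨⟨a, p⟩, hx⟩ -
        obtain ⟨x, rfl⟩ := hπ a
        refine ⟨x, Subtype.ext (Prod.ext rfl ?_)⟩
        rw [LinearMap.mem_ker, coneD_apply, sub_eq_zero] at hx
        exact hx
      exact isT_of_subsingleton
  have := hepi.epi
  have := hG.projective
  obtain ⟨σ₁, σ₀, hσ, hσ'⟩ := exists_homMk (Projective.factorThru (𝟙 G) (homMk _ _ hv))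
  have hσv := Projective.factorThru_comp (𝟙 G) (homMk _ _ hv)
  rw [hσ', id_eq_homMk] at hσv
  obtain ⟨k, hk₁, hk₀⟩ := homMk_comp_eq_homMk_iff.1 hσv
  have hk₁' : ∀ a, (σ₁ a).1.1 = a + k (G.d a) := hk₁
  obtain ⟨m, hm⟩ := Module.projective_lifting_property p.rangeRestrict
    ((f ∘ₗ k).codRestrict _ fun x => hf (k x)) (LinearMap.surjective_rangeRestrict _)
  have hm' : ∀ x, p (m x) = f (k x) := fun x => congrArg Subtype.val (LinearMap.congr_fun hm x)
  refine ⟨LinearMap.snd R _ _ ∘ₗ Submodule.subtype _ ∘ₗ σ₁ - m ∘ₗ G.d, fun a => ?_⟩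
  have h1 : f (σ₁ a).1.1 = p (σ₁ a).1.2 := (σ₁ a).2
  show p ((σ₁ a).1.2 - m (G.d a)) = f a
  rw [map_sub, ← h1, hm', hk₁', map_add, add_sub_cancel_right]

end IsSmallProjectiveGenerator

end TwoTerm

end TorsionPair

/-! ### Stalk objects of the heart: presentations by `V` and smallness for modules. -/

theorem Finsupp.exists_mapRange_eq {R A P I : Type*} [Ring R] [AddCommGroup A] [Module R A]
    [AddCommGroup P] [Module R P] (d : A →ₗ[R] P) (y : I →₀ P) (h : ∀ i, ∃ x, d x = y i) :
    ∃ b, Finsupp.mapRange.linearMap d b = y := by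
  classical
  choose x hx using h
  refine ⟨Finsupp.onFinset y.support (fun i => if i ∈ y.support then x i else 0)
    fun i hi => by_contra fun h => hi (if_neg h), ?_⟩
  ext i
  by_cases hi : y i = 0 <;> simp [hi, hx]

namespace TorsionPair

variable {R : Type u} [Ring R] {t : TorsionPair (ModuleCat.{u} R)}

namespace TwoTerm

theorem IsConeEpi.isT_of_surjective {M N : t.TwoTerm} {f₁ : M.A →ₗ[R] N.A}
    {f₀ : M.P →ₗ[R] N.P} {hf : ∀ a, N.d (f₁ a) = f₀ (M.d a)} (h : IsConeEpi hf)
    {K : Type u} [AddCommGroup K] [Module R K] (τ : LinearMap.ker (coneD N f₀) →ₗ[R] K)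
    (hτ : ∀ a, τ (toConeZ hf a) = 0) (hs : Function.Surjective τ) : t.IsT K := by
  refine h.isT.of_surjective ((LinearMap.range (toConeZ hf)).liftQ τ ?_) fun y => ?_
  · rintro _ ⟨a, rfl⟩
    exact hτ a
  · obtain ⟨x, rfl⟩ := hs y
    exact ⟨Submodule.Quotient.mk x, rfl⟩

/-- A torsion module as an object of the heart, concentrated in degree `0`. -/
noncomputable abbrev ofTorsion {T : Type u} [AddCommGroup T] [Module R T] (hT : t.IsT T) :
    t.TwoTerm :=
  ofMap (z := (0 : PUnit.{u + 1} →ₗ[R] T)) (c := Finsupp.linearCombination R (id : T → T))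
    ((Submodule.mkQ_surjective _).comp (Finsupp.linearCombination_id_surjective R T))
    isF_of_subsingleton (hT.of_surjective (Submodule.mkQ _) (Submodule.mkQ_surjective _))

/-- The augmentation of `ofTorsion`. -/
noncomputable abbrev ofTorsionπ {T : Type u} [AddCommGroup T] [Module R T] (hT : t.IsT T) :
    (ofTorsion hT).P →ₗ[R] T := Finsupp.linearCombination R (id : T → T)

theorem ofTorsionπ_surjective {T : Type u} [AddCommGroup T] [Module R T] (hT : t.IsT T) :
    Function.Surjective (ofTorsionπ hT) := Finsupp.linearCombination_id_surjective R T

theorem ofTorsionπ_d {T : Type u} [AddCommGroup T] [Module R T] (hT : t.IsT T)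
    (x : (ofTorsion hT).A) : ofTorsionπ hT ((ofTorsion hT).d x) = 0 := x.2.symm

theorem exists_d_eq {T : Type u} [AddCommGroup T] [Module R T] (hT : t.IsT T)
    {p : (ofTorsion hT).P} (hp : ofTorsionπ hT p = 0) : ∃ x, (ofTorsion hT).d x = p :=
  ⟨⟨(0, p), hp.symm⟩, rfl⟩

/-- A torsion-free module as an object of the heart, concentrated in degree `-1`. -/
abbrev ofTorsionFree {F : Type u} [AddCommGroup F] [Module R F] (hF : t.IsF F) :
    t.TwoTerm where
  A := F
  P := PUnit.{u + 1}
  d := 0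
  isF := hF.of_injective _ (Submodule.subtype_injective _)
  isT := isT_of_subsingleton

/-- The projections of a power. -/
noncomputable def π (M : t.TwoTerm) {I : Type u} (i : I) : M.pow I ⟶ M :=
  homMk (M := M.pow I) (Finsupp.lapply i) (Finsupp.lapply i) fun _ => rfl

theorem ι_comp_π_of_ne (M : t.TwoTerm) {I : Type u} {i j : I} (h : j ≠ i) :
    M.ι i ≫ M.π j = 0 :=
  homMk_comp_eq_zero_iff.2 ⟨0, fun _ => Finsupp.single_eq_of_ne h,
    fun _ => (Finsupp.single_eq_of_ne h).trans (map_zero _).symm⟩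

namespace IsSmallProjectiveGenerator

variable {G : t.TwoTerm}

theorem exists_isConeEpi (hG : G.IsSmallProjectiveGenerator)
    (M : t.TwoTerm) : ∃ (I : Type u) (p₁ : (G.pow I).A →ₗ[R] M.A)
    (p₀ : (G.pow I).P →ₗ[R] M.P) (hp : ∀ a, M.d (p₁ a) = p₀ ((G.pow I).d a)), IsConeEpi hp := by
  obtain ⟨p, hp⟩ := exists_pow_desc (fun s : G ⟶ M => s)
  have : Epi p := Preadditive.epi_of_cancel_zero _ fun u hu => hG.separates _ fun s => by
    rw [← hp s, Category.assoc, hu, Limits.comp_zero]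
  obtain ⟨p₁, p₀, hp', rfl⟩ := exists_homMk p
  exact ⟨_, p₁, p₀, hp', isConeEpi_of_epi⟩

/-- Cover `T[0]` by a power of `G`. On `H⁰` this is a surjection `V^(I) → T`, and its kernel is a
quotient of `H⁻¹` of the cone, which is torsion. -/
theorem pres (hG : G.IsSmallProjectiveGenerator)
    {T : Type u} [AddCommGroup T] [Module R T] (hT : t.IsT T) :
    ∃ (I : Type u) (p : (I →₀ G.P ⧸ LinearMap.range G.d) →ₗ[R] T), Function.Surjective p ∧
      t.IsT (LinearMap.ker p) := by
  obtain ⟨I, p₁, p₀, hp, h⟩ := hG.exists_isConeEpi (ofTorsion hT)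
  let q : (I →₀ G.P ⧸ LinearMap.range G.d) →ₗ[R] T := Finsupp.lsum ℕ fun i =>
    (LinearMap.range G.d).liftQ (ofTorsionπ hT ∘ₗ p₀ ∘ₗ Finsupp.lsingle i) (by
      rintro _ ⟨a, rfl⟩
      have h1 : (G.pow I).d (Finsupp.single i a) = Finsupp.single i (G.d a) :=
        Finsupp.mapRange_single (hf := map_zero G.d)
      show ofTorsionπ hT (p₀ (Finsupp.single i (G.d a))) = 0
      rw [← h1, ← hp, ofTorsionπ_d])
  let μ : (I →₀ G.P) →ₗ[R] (I →₀ G.P ⧸ LinearMap.range G.d) :=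
    Finsupp.mapRange.linearMap (Submodule.mkQ _)
  have hμ : Function.Surjective μ :=
    Finsupp.mapRange_surjective _ (map_zero _) (Submodule.mkQ_surjective _)
  have hq : ∀ x, q (μ x) = ofTorsionπ hT (p₀ x) := LinearMap.congr_fun (f := q ∘ₗ μ)
    (g := ofTorsionπ hT ∘ₗ p₀) (Finsupp.lhom_ext fun i x => by
      rw [LinearMap.comp_apply]
      have h1 : μ (Finsupp.single i x) = Finsupp.single i (Submodule.Quotient.mk x) :=
        Finsupp.mapRange_single (hf := map_zero _)
      rw [h1]
      simp only [q, Finsupp.lsum_single]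
      rfl)
  have hμd : ∀ a, μ ((G.pow I).d a) = 0 := LinearMap.congr_fun (f := μ ∘ₗ (G.pow I).d) (g := 0)
    (Finsupp.lhom_ext fun i a => by
      have h1 : (G.pow I).d (Finsupp.single i a) = Finsupp.single i (G.d a) :=
        Finsupp.mapRange_single (hf := map_zero G.d)
      have h2 : μ (Finsupp.single i (G.d a)) = Finsupp.single i (Submodule.Quotient.mk (G.d a)) :=
        Finsupp.mapRange_single (hf := map_zero _)
      rw [LinearMap.comp_apply, h1, h2,
        (Submodule.Quotient.mk_eq_zero (LinearMap.range G.d)).2 ⟨a, rfl⟩, Finsupp.single_zero,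
        LinearMap.zero_apply])
  refine ⟨I, q, fun y => ?_, ?_⟩
  · obtain ⟨l, rfl⟩ := ofTorsionπ_surjective hT y
    obtain ⟨⟨k, x⟩, rfl⟩ := h.surjective l
    refine ⟨μ (-x), ?_⟩
    rw [hq, coneD_apply, map_sub, ofTorsionπ_d, map_neg, map_neg, zero_sub]
  · have hker : ∀ z : LinearMap.ker (coneD (ofTorsion hT) p₀), μ z.1.2 ∈ LinearMap.ker q :=
      fun z => by
        have := LinearMap.mem_ker.1 z.2
        rw [coneD_apply, sub_eq_zero] at this
        rw [LinearMap.mem_ker, hq, ← this, ofTorsionπ_d]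
    let τ : LinearMap.ker (coneD (ofTorsion hT) p₀) →ₗ[R] LinearMap.ker q :=
      (μ ∘ₗ LinearMap.snd R _ _ ∘ₗ Submodule.subtype _).codRestrict _ hker
    refine h.isT_of_surjective τ (fun a => Subtype.ext (hμd a)) ?_
    rintro ⟨y, hy⟩
    obtain ⟨x, rfl⟩ := hμ y
    rw [LinearMap.mem_ker, hq] at hy
    obtain ⟨k, hk⟩ := exists_d_eq hT hy
    refine ⟨⟨(k, x), ?_⟩, Subtype.ext rfl⟩
    rw [LinearMap.mem_ker, coneD_apply, hk, sub_self]

theorem kerExtOne (hG : G.IsSmallProjectiveGenerator)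
    {T : Type u} [AddCommGroup T] [Module R T] (hT : t.IsT T) :
    KerExtOne (ModuleCat.of R (G.P ⧸ LinearMap.range G.d)) (ModuleCat.of R T) := by
  refine kerExtOne_of_projective (Submodule.subtype_injective (LinearMap.range G.d))
    (LinearMap.exact_subtype_mkQ (LinearMap.range G.d)) (Submodule.mkQ_surjective _) fun f => ?_
  obtain ⟨g, hg⟩ := hG.extend hT (f ∘ₗ G.d.rangeRestrict)
  refine ⟨g, LinearMap.ext fun x => ?_⟩
  obtain ⟨_, a, rfl⟩ := x
  exact hg a

/-- By `lift`, a map from `V` to `T^(I)` is induced by a map from `G` to the power of `T[0]`.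
Smallness makes all but finitely many of its components null-homotopic, and these vanish on `H⁰`. -/
theorem exists_finset_of_isT (hG : G.IsSmallProjectiveGenerator)
    {T : Type u} [AddCommGroup T] [Module R T] (hT : t.IsT T)
    {I : Type u} (f : (G.P ⧸ LinearMap.range G.d) →ₗ[R] (I →₀ T)) :
    ∃ S : Finset I, ∀ x, ∀ i ∉ S, f x i = 0 := by
  obtain ⟨s₀, hs₀⟩ := Module.projective_lifting_property
    (Finsupp.mapRange.linearMap (ofTorsionπ hT) : (I →₀ (ofTorsion hT).P) →ₗ[R] (I →₀ T))
    (f ∘ₗ Submodule.mkQ _)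
    (Finsupp.mapRange_surjective _ (map_zero _) (ofTorsionπ_surjective hT))
  have hs₀' : ∀ p i, ofTorsionπ hT (s₀ p i) = f (Submodule.Quotient.mk p) i := fun p i =>
    DFunLike.congr_fun (LinearMap.congr_fun hs₀ p) i
  have hlift : ∀ a, ∃ b, ((ofTorsion hT).pow I).d b = s₀ (G.d a) := fun a => by
    refine Finsupp.exists_mapRange_eq _ _ fun i => exists_d_eq hT ?_
    rw [hs₀', (Submodule.Quotient.mk_eq_zero (LinearMap.range G.d)).2 ⟨a, rfl⟩, map_zero,
      Finsupp.zero_apply]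
  obtain ⟨s₁, hs₁⟩ := hG.lift ((ofTorsion hT).pow I).d ((ofTorsion hT).pow I).isF
    (s₀ ∘ₗ G.d) hlift
  obtain ⟨S, hS⟩ := hG.small (homMk (N := (ofTorsion hT).pow I) s₁ s₀ hs₁)
  refine ⟨S, fun x i hi => ?_⟩
  obtain ⟨p, rfl⟩ := Submodule.mkQ_surjective _ x
  obtain ⟨k, -, hk⟩ := homMk_comp_eq_zero_iff.1 (hS ((ofTorsion hT).π i) fun j hj =>
    (ofTorsion hT).ι_comp_π_of_ne fun h => hi (h ▸ hj))
  have hk' : s₀ p i = (ofTorsion hT).d (k p) := hk p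
  rw [Submodule.mkQ_apply, ← hs₀', hk', ofTorsionπ_d]

end IsSmallProjectiveGenerator

end TwoTerm

end TorsionPair

/-! ### Finite generation of the terms of a small projective generator. -/

/-- The embedding of a direct sum in a power of itself. -/
noncomputable def DirectSum.toFinsupp (R : Type*) {I : Type*} [Ring R] [DecidableEq I]
    (M : I → Type*) [∀ i, AddCommGroup (M i)] [∀ i, Module R (M i)] :
    DirectSum I M →ₗ[R] (I →₀ DirectSum I M) :=
  DirectSum.toModule R I _ fun i => Finsupp.lsingle i ∘ₗ DirectSum.lof R I M i

theorem DirectSum.eq_zero_of_toFinsupp {R I : Type*} [Ring R] [DecidableEq I]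
    {M : I → Type*} [∀ i, AddCommGroup (M i)] [∀ i, Module R (M i)] {x : DirectSum I M} {i : I}
    (h : DirectSum.toFinsupp R M x i = 0) : x i = 0 := by
  have h1 : DirectSum.component R I M i ∘ₗ Finsupp.lapply i ∘ₗ DirectSum.toFinsupp R M =
      DirectSum.component R I M i := by
    refine DirectSum.linearMap_ext _ fun j => LinearMap.ext fun y => ?_
    simp only [LinearMap.comp_apply, DirectSum.toFinsupp, DirectSum.toModule_lof,
      Finsupp.lapply_apply, Finsupp.lsingle_apply]
    by_cases hij : i = j
    · subst hij
      simp
    · rw [Finsupp.single_eq_of_ne hij, map_zero, DirectSum.component.of, dif_neg (Ne.symm hij)]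
  have h2 := LinearMap.congr_fun h1 x
  rw [LinearMap.comp_apply, LinearMap.comp_apply, Finsupp.lapply_apply, h, map_zero] at h2
  exact h2.symm

namespace TorsionPair

variable {R : Type u} [Ring R] {t : TorsionPair (ModuleCat.{u} R)}

theorem isT_ker_g {B : Type u} [AddCommGroup B] [Module R B] [DecidableEq B]
    {N : Finset B → Submodule R B} (hN : Monotone N) (hT : ∀ i, t.IsT (B ⧸ N i)) :
    t.IsT (LinearMap.ker (DirectedQuotients.g hN)) := by
  refine IsT.of_surjective (M := DirectedQuotients.Sum₂ N) (IsT.directSum fun i => hT i.1)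
    ((DirectedQuotients.g' hN).codRestrict _ (DirectedQuotients.g_g' hN)) ?_
  rintro ⟨x, hx⟩
  obtain ⟨y, hy⟩ := (DirectedQuotients.exact_g'_g hN x).1 hx
  exact ⟨y, Subtype.ext hy⟩

theorem isF_ker_g {B : Type u} [AddCommGroup B] [Module R B] [DecidableEq B]
    {N : Finset B → Submodule R B} (hN : Monotone N) (hF : ∀ i, t.IsF (B ⧸ N i)) :
    t.IsF (LinearMap.ker (DirectedQuotients.g hN)) :=
  IsF.of_injective (N := DirectedQuotients.Sum₁ N) (IsF.directSum fun i => hF i.1) _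
    (Submodule.subtype_injective _)

/-- Apply `DirectedQuotients` to the finitely generated submodules of `V`. The kernel of `g` is a
quotient of a sum of torsion modules, so `V → Sum₀` lifts through `g` by `hext`, and `hsmall` gives
the lift finite support. -/
theorem finite_of_isT {V : Type u} [AddCommGroup V] [Module R V] (hV : t.IsT V)
    (hext : ∀ {T : Type u} [AddCommGroup T] [Module R T], t.IsT T →
      KerExtOne (ModuleCat.of R V) (ModuleCat.of R T))
    (hsmall : ∀ {T : Type u} [AddCommGroup T] [Module R T], t.IsT T →
      ∀ {I : Type u} (f : V →ₗ[R] (I →₀ T)), ∃ S : Finset I, ∀ x, ∀ i ∉ S, f x i = 0) :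
    Module.Finite R V := by
  classical
  let N : Finset V → Submodule R V := fun i => Submodule.span R i
  have hN : Monotone N := fun i j h => Submodule.span_mono (by exact_mod_cast h)
  have hT : ∀ i, t.IsT (V ⧸ N i) := fun i => hV.of_surjective _ (Submodule.mkQ_surjective _)
  obtain ⟨f, hf⟩ := (hext (isT_ker_g hN hT)).exists_lift (Submodule.subtype_injective _)
    (LinearMap.exact_subtype_ker_map _) (DirectedQuotients.g_surjective hN
      fun i x hx => Submodule.subset_span hx) (DirectedQuotients.e₀ N ∅)
  obtain ⟨S, hS⟩ := hsmall (T := DirectedQuotients.Sum₁ N) (IsT.directSum fun i => hT i.1)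
    (DirectSum.toFinsupp R _ ∘ₗ f)
  obtain ⟨i, hi⟩ := DirectedQuotients.exists_eq_top hN f (LinearMap.congr_fun hf) S
    fun x i h => DirectSum.eq_zero_of_toFinsupp (hS x i h)
  exact ⟨⟨i, hi⟩⟩

namespace TwoTerm

namespace IsSmallProjectiveGenerator

variable {G : t.TwoTerm}

theorem finite_coker (hG : G.IsSmallProjectiveGenerator)
    : Module.Finite R (G.P ⧸ LinearMap.range G.d) :=
  finite_of_isT G.isT hG.kerExtOne hG.exists_finset_of_isT

theorem exists_finset_of_isF (hG : G.IsSmallProjectiveGenerator)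
    [Module.Finite R G.P] {F : Type u} [AddCommGroup F] [Module R F]
    (hF : t.IsF F) {I : Type u} (f : G.A →ₗ[R] (I →₀ F)) :
    ∃ S : Finset I, ∀ x, ∀ i ∉ S, f x i = 0 := by
  classical
  let M := ofTorsionFree hF
  obtain ⟨S, hS⟩ := hG.small (homMk (N := M.pow I) f 0 fun a => Subsingleton.elim _ _)
  -- `u` projects away from `S`. Smallness only makes `u ∘ f` null-homotopic, that is `k ∘ G.d`;
  -- finite generation of `G.P` bounds the support of `k` and hence that of `f`.
  let u : (I →₀ F) →ₗ[R] (I →₀ F) :=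
    Finsupp.lsum ℕ fun i => if i ∈ S then 0 else Finsupp.lsingle i
  have hu : ∀ y, ∀ i ∉ S, u y i = y i := fun y i hi => by
    refine LinearMap.congr_fun (f := Finsupp.lapply i ∘ₗ u) (g := Finsupp.lapply i)
      (Finsupp.lhom_ext fun j x => ?_) y
    simp only [u, LinearMap.comp_apply, Finsupp.lsum_single, Finsupp.lapply_apply]
    split_ifs with h
    · rw [Finsupp.single_eq_of_ne (fun hij : i = j => hi (hij ▸ h))]
      rfl
    · rfl
  obtain ⟨k, hk, -⟩ := homMk_comp_eq_zero_iff.1 (hS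
    (homMk (M := M.pow I) (N := M.pow I) u 0 fun a => Subsingleton.elim _ _)
    fun i hi => homMk_comp_eq_zero_iff.2 ⟨0, fun x => by
      show u (Finsupp.single i x) = 0
      simp only [u, Finsupp.lsum_single, if_pos hi, LinearMap.zero_apply],
      fun x => Subsingleton.elim _ _⟩)
  obtain ⟨S', hS'⟩ := LinearMap.exists_finset_support_subset k
  refine ⟨S ∪ S', fun x i hi => ?_⟩
  rw [Finset.mem_union, not_or] at hi
  rw [← hu _ _ hi.1, hk]
  by_contra h
  exact hi.2 (hS' _ (Finsupp.mem_support_iff.2 h))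

/-- `lift` is available only against torsion-free kernels, so each `W i` is saturated to `N i` with
torsion-free quotient. The limit argument then gives only that some `G.A ⧸ W i` is torsion. By
`extend`, that quotient is an image of `G.P`, hence finitely generated, and so is `G.A`. -/
theorem finite_A (hG : G.IsSmallProjectiveGenerator)
    [Module.Finite R G.P] : Module.Finite R G.A := by
  classical
  let W : Finset G.A → Submodule R G.A := fun i => Submodule.span R i
  have hW : ∀ {i j : Finset G.A}, i ⊆ j → W i ≤ W j := fun h =>
    Submodule.span_mono (by exact_mod_cast h)
  let N : Finset G.A → Submodule R G.A := fun i => (t.torsion (G.A ⧸ W i)).comap (W i).mkQ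
  have hN : Monotone N := fun i j h x hx => map_mem_torsion (Submodule.factor (hW h)) hx
  have hF : ∀ i, t.IsF (G.A ⧸ N i) := fun i => by
    refine (isF_quotient_torsion (t := t) (M := G.A ⧸ W i)).of_injective
      ((N i).mapQ (t.torsion (G.A ⧸ W i)) (W i).mkQ le_rfl) ?_
    rw [injective_iff_map_eq_zero]
    intro x hx
    obtain ⟨x, rfl⟩ := Submodule.mkQ_surjective _ x
    exact (Submodule.Quotient.mk_eq_zero _).2
      ((Submodule.Quotient.mk_eq_zero (t.torsion (G.A ⧸ W i))).1 hx)
  have hmem : ∀ i, ∀ x ∈ i, x ∈ N i := fun i x hx => by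
    show (W i).mkQ x ∈ t.torsion (G.A ⧸ W i)
    rw [Submodule.mkQ_apply, (Submodule.Quotient.mk_eq_zero _).2 (Submodule.subset_span hx)]
    exact zero_mem _
  obtain ⟨f, hf⟩ := hG.lift (DirectedQuotients.g hN)
    (isF_ker_g hN hF) (DirectedQuotients.e₀ N ∅)
    fun a => DirectedQuotients.g_surjective hN hmem _
  obtain ⟨S, hS⟩ := hG.exists_finset_of_isF (F := DirectedQuotients.Sum₁ N)
    (IsF.directSum fun i => hF i.1) (DirectSum.toFinsupp R _ ∘ₗ f)
  obtain ⟨i, hi⟩ := DirectedQuotients.exists_eq_top hN f hf S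
    fun x i h => DirectSum.eq_zero_of_toFinsupp (hS x i h)
  have hT : t.IsT (G.A ⧸ W i) := by
    refine isT_of_torsion_eq_top (eq_top_iff.2 fun x _ => ?_)
    obtain ⟨x, rfl⟩ := Submodule.mkQ_surjective _ x
    have : x ∈ N i := hi ▸ Submodule.mem_top
    exact this
  obtain ⟨g, hg⟩ := hG.extend hT (W i).mkQ
  have hgs : Function.Surjective g := fun y => by
    obtain ⟨a, rfl⟩ := Submodule.mkQ_surjective _ y
    exact ⟨_, hg a⟩
  have := Module.Finite.of_surjective g hgs
  have : Module.Finite R (W i) := Module.Finite.span_finset R i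
  exact Module.Finite.of_submodule_quotient (W i)

/-- Since `V` is finitely generated, `G.P` can be replaced by some `Rⁿ` that still covers `V`, with
`G.A` replaced by the pullback. A splitting of `G.A × Rⁿ → G.P` supplies the homotopy inverse. -/
theorem exists_finite_P (hG : G.IsSmallProjectiveGenerator)
    : ∃ G' : t.TwoTerm, G'.IsSmallProjectiveGenerator ∧
    Module.Finite R G'.P := by
  have := hG.finite_coker
  obtain ⟨n, q, hq⟩ := Module.Finite.exists_fin' R (G.P ⧸ LinearMap.range G.d)
  obtain ⟨r, hr⟩ := Module.projective_lifting_property (LinearMap.range G.d).mkQ q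
    (Submodule.mkQ_surjective _)
  have hr' : Function.Surjective ((LinearMap.range G.d).mkQ ∘ₗ r) := hr ▸ hq
  let G' : t.TwoTerm := ofMap (z := G.d) (c := r) hr' G.isF G.isT
  have hcone : Function.Surjective (G.d.coprod (-r)) := fun p => by
    obtain ⟨y, hy⟩ := hr' (-Submodule.Quotient.mk p)
    have h1 : (Submodule.Quotient.mk (p + r y) : G.P ⧸ LinearMap.range G.d) = 0 := by
      rw [Submodule.Quotient.mk_add]
      exact (congrArg _ hy).trans (add_neg_cancel _)
    obtain ⟨a, ha⟩ := (Submodule.Quotient.mk_eq_zero _).1 h1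
    exact ⟨(a, y), by simp [ha]⟩
  obtain ⟨σ, hσ⟩ := Module.projective_lifting_property (G.d.coprod (-r)) LinearMap.id hcone
  let α : G.P →ₗ[R] G.A := LinearMap.fst R _ _ ∘ₗ σ
  let β : G.P →ₗ[R] (Fin n → R) := LinearMap.snd R _ _ ∘ₗ σ
  have hαβ : ∀ p, G.d (α p) = p + r (β p) := fun p => by
    have h1 : G.d (α p) + -r (β p) = p := LinearMap.congr_fun hσ p
    rw [← sub_eq_add_neg, sub_eq_iff_eq_add] at h1
    exact h1
  let v : G' ⟶ G := homMk (M := G') (LinearMap.fst R _ _ ∘ₗ (pullback _ _).subtype) r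
    fun x => x.2
  let w₁ : G.A →ₗ[R] G'.A :=
    ((LinearMap.id - α ∘ₗ G.d).prod (-(β ∘ₗ G.d))).codRestrict (pullback G.d r) fun a => by
      show G.d (a - α (G.d a)) = r (-β (G.d a))
      rw [map_sub, hαβ, map_neg]
      abel
  let w : G ⟶ G' := homMk (N := G') w₁ (-β) fun _ => rfl
  let k : G'.P →ₗ[R] G'.A :=
    ((-(α ∘ₗ r)).prod (-(β ∘ₗ r) - LinearMap.id)).codRestrict (pullback G.d r) fun x => by
      show G.d (-α (r x)) = r (-β (r x) - x)
      rw [map_neg, hαβ, map_sub, map_neg]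
      abel
  have hwv : w ≫ v = 𝟙 G := by
    refine (homMk_comp_eq_homMk_iff (hh := fun _ => rfl)).2 ⟨-α, fun a => ?_, fun p => ?_⟩
    · exact sub_eq_add_neg _ _
    · show r (-β p) = p + G.d (-α p)
      rw [map_neg, map_neg, hαβ]
      abel
  have hvw : v ≫ w = 𝟙 G' := by
    refine (homMk_comp_eq_homMk_iff (hh := fun _ => rfl)).2 ⟨k,
      fun x => Subtype.ext (Prod.ext ?_ ?_), fun x => ?_⟩
    · show x.1.1 - α (G.d x.1.1) = x.1.1 + -α (r x.1.2)
      rw [show G.d x.1.1 = r x.1.2 from x.2, sub_eq_add_neg]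
    · show -β (G.d x.1.1) = x.1.2 + (-β (r x.1.2) - x.1.2)
      rw [show G.d x.1.1 = r x.1.2 from x.2]
      abel
    · show -β (r x) = x + (-β (r x) - x)
      abel
  exact ⟨G', hG.of_iso ⟨w, v, hwv, hvw⟩, inferInstanceAs (Module.Finite R (Fin n → R))⟩

end IsSmallProjectiveGenerator

end TwoTerm

end TorsionPair

/-- A module such that all epimorphisms to it with kernel `M` split lies in the kernel of
`Ext¹(?, M)`. -/
theorem kerExtOne_of_forall_split {R V M : Type u} [Ring R] [AddCommGroup V] [Module R V]
    [AddCommGroup M] [Module R M]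
    (H : ∀ (E : Type u) [AddCommGroup E] [Module R E] (i : M →ₗ[R] E) (p : E →ₗ[R] V),
      Function.Injective i → Function.Exact i p → Function.Surjective p →
        ∃ s : V →ₗ[R] E, ∀ v, p (s v) = v) :
    KerExtOne (ModuleCat.of R V) (ModuleCat.of R M) := by
  let c : (V →₀ R) →ₗ[R] V := Finsupp.linearCombination R id
  have hc : Function.Surjective c := Finsupp.linearCombination_id_surjective R V
  refine kerExtOne_of_projective (K := LinearMap.ker c) (E := V →₀ R)
    (Submodule.subtype_injective (LinearMap.ker c))
    (LinearMap.exact_subtype_ker_map c) hc fun f => ?_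
  -- Pushout of the free presentation of `V` along `f`; a splitting of the resulting extension gives
  -- the extension of `f` to `V →₀ R`.
  let D : Submodule R (M × (V →₀ R)) := LinearMap.range (f.prod (-(LinearMap.ker c).subtype))
  let i : M →ₗ[R] (M × (V →₀ R)) ⧸ D := D.mkQ ∘ₗ LinearMap.inl R _ _
  let i' : (V →₀ R) →ₗ[R] (M × (V →₀ R)) ⧸ D := D.mkQ ∘ₗ LinearMap.inr R _ _
  have hii : ∀ x, i (f x) = i' x := fun x => (Submodule.Quotient.eq D).2 ⟨x, by simp⟩
  have hi : Function.Injective i := by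
    rw [injective_iff_map_eq_zero]
    intro y hy
    obtain ⟨r, hr⟩ := (Submodule.Quotient.mk_eq_zero D).1 hy
    have h1 : f r = y := congrArg Prod.fst hr
    have h2 : -(r : V →₀ R) = 0 := congrArg Prod.snd hr
    rw [← h1, show r = 0 from Subtype.ext (neg_eq_zero.1 h2), map_zero]
  let q : ((M × (V →₀ R)) ⧸ D) →ₗ[R] V := D.liftQ (c ∘ₗ LinearMap.snd R _ _) (by
    rintro _ ⟨x, rfl⟩
    show c (-x) = 0
    rw [map_neg, LinearMap.mem_ker.1 x.2, neg_zero])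
  have hq : Function.Exact i q := by
    intro w
    constructor
    · intro hw
      obtain ⟨⟨y, x⟩, rfl⟩ := Submodule.mkQ_surjective _ w
      refine ⟨y + f ⟨x, hw⟩, ?_⟩
      rw [map_add, hii]
      show D.mkQ (y, 0) + D.mkQ (0, x) = D.mkQ (y, x)
      rw [← map_add]
      congr 1
      simp
    · rintro ⟨y, rfl⟩
      show c 0 = 0
      exact map_zero c
  obtain ⟨s, hs⟩ := H _ i q hi hq fun v => by
    obtain ⟨x, rfl⟩ := hc v
    exact ⟨i' x, rfl⟩
  have hr : ∀ x, (i' - s ∘ₗ c) x ∈ LinearMap.range i := fun x => (hq _).1 (by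
    show q (i' x - s (c x)) = 0
    rw [map_sub, hs, sub_eq_zero]
    rfl)
  let e := LinearEquiv.ofInjective i hi
  refine ⟨e.symm.toLinearMap ∘ₗ (i' - s ∘ₗ c).codRestrict _ hr, LinearMap.ext fun x => ?_⟩
  show e.symm _ = f x
  rw [LinearEquiv.symm_apply_eq]
  refine Subtype.ext ?_
  show i' x - s (c x) = i (f x)
  rw [hii, LinearMap.mem_ker.1 x.2, map_zero, sub_zero]

/-! ### From a small projective generator to the five conditions. -/

namespace TorsionPair

variable {R : Type u} [Ring R] {t : TorsionPair (ModuleCat.{u} R)}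

theorem exists_isTiltingComplex (h : IsModuleCategory.{u} t.TwoTerm) :
    ∃ G : ThreeTermComplex R, t.IsTiltingComplex G ∧ Module.Projective R G.Q ∧
      Function.Injective G.j := by
  obtain ⟨G₀, hG₀⟩ := TwoTerm.exists_isSmallProjectiveGenerator h
  obtain ⟨G, hG, _⟩ := hG₀.exists_finite_P
  have := hG.finite_A
  -- A finite free cover `Q → G.A` with kernel `X` turns `G.A → G.P` into the three-term complex,
  -- with `Q / X` identified with `G.A`.
  obtain ⟨n, q, hq⟩ := Module.Finite.exists_fin' R G.A
  let K : ThreeTermComplex R :=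
    { X := ModuleCat.of R (LinearMap.ker q)
      Q := ModuleCat.of R (Fin n → R)
      P := ModuleCat.of R G.P
      j := (LinearMap.ker q).subtype
      d := G.d ∘ₗ q
      d_comp_j := by
        ext x
        show G.d (q x) = 0
        rw [LinearMap.mem_ker.1 x.2, map_zero] }
  have hKr : LinearMap.range K.d = LinearMap.range G.d :=
    LinearMap.range_comp_of_range_eq_top _ (LinearMap.range_eq_top.2 hq)
  obtain ⟨e, he⟩ : ∃ e : (K.Q ⧸ LinearMap.range K.j) ≃ₗ[R] G.A,
      ∀ x, G.d (e x) = IsTiltingComplex.quotD K x := by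
    refine ⟨Submodule.quotEquivOfEq _ _ (Submodule.range_subtype _) ≪≫ₗ
      q.quotKerEquivOfSurjective hq, fun x => ?_⟩
    obtain ⟨x, rfl⟩ := Submodule.mkQ_surjective _ x
    rfl
  have hV : t.IsT (K.P ⧸ LinearMap.range K.d) := by
    rw [hKr]
    exact G.isT
  have hpres : ∀ {T : Type u} [AddCommGroup T] [Module R T], t.IsT T →
      ∃ (I : Type u) (p : (I →₀ K.P ⧸ LinearMap.range K.d) →ₗ[R] T), Function.Surjective p ∧
        t.IsT (LinearMap.ker p) := by
    rw [hKr]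
    exact hG.pres
  have hH : ∀ x, x ∈ K.HNegOne ↔ G.d (e x) = 0 := fun x => by
    rw [he, ← LinearMap.mem_ker, IsTiltingComplex.ker_quotD]
  have hpT : ∀ T, Pres K.H0 T → t.T T := by
    rintro T ⟨I, J, f, p, -, hp⟩
    exact (hV.finsupp I).of_surjective p hp
  refine ⟨K, ⟨?_, ?_, ?_, ?_, ?_, ?_, ?_, ?_, ?_⟩, ?_, ?_⟩
  · ext T
    refine ⟨fun hT => ?_, hpT T⟩
    -- The kernel of the cover is again torsion, hence covered by a power of `V`; this gives the
    -- second step of the presentation.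
    obtain ⟨I, p, hp, hK⟩ := hpres (T := T) hT
    obtain ⟨J, q, hq, -⟩ := hpres hK
    refine ⟨I, J, (LinearMap.ker p).subtype ∘ₗ q, p, fun x => ⟨fun hx => ?_, ?_⟩, hp⟩
    · obtain ⟨y, hy⟩ := hq ⟨x, hx⟩
      exact ⟨y, congrArg Subtype.val hy⟩
    · rintro ⟨y, rfl⟩
      exact (q y).2
  · intro T hT
    have h1 : KerExtOne (ModuleCat.of R (G.P ⧸ LinearMap.range K.d)) (ModuleCat.of R T) := by
      rw [hKr]
      exact hG.kerExtOne (hpT T hT)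
    exact h1
  · exact inferInstanceAs (Module.Finite R (Fin n → R))
  · assumption
  · exact G.projective
  · exact G.isF.of_injective ((e.toLinearMap ∘ₗ K.HNegOne.subtype).codRestrict _
      fun x => (hH x).1 x.2) fun x y hxy => Subtype.ext (e.injective (congrArg Subtype.val hxy))
  · intro x hx
    simp only [reject, Submodule.mem_iInf, LinearMap.mem_ker]
    intro T hT f
    obtain ⟨g, hg⟩ := hG.extend hT (f ∘ₗ e.symm.toLinearMap)
    have h1 := hg (e x)
    rw [(hH x).1 hx, map_zero] at h1
    simpa using h1.symm
  · intro F hF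
    refine kerExtOne_of_forall_split fun E _ _ i p hi hip hp => ?_
    have hpF : t.IsF (LinearMap.ker p) := by
      refine IsF.of_equiv hF (LinearEquiv.ofInjective i hi ≪≫ₗ LinearEquiv.ofEq _ _ ?_)
      exact (LinearMap.exact_iff.1 hip).symm
    obtain ⟨g, hg⟩ := hG.lift p hpF e.symm.toLinearMap fun a => hp _
    exact ⟨g ∘ₗ e.toLinearMap, fun v => (hg (e v)).trans (e.symm_apply_apply v)⟩
  -- Cover `(R/t(R))[1]` by a power of `G`. `H⁻¹` of the cone is torsion, hence generated by `V`,
  -- and `R/t(R)` maps to it with kernel exactly the image of `H⁻¹(G)^(I)`; so the cokernel in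
  -- condition 5 embeds in it.
  · obtain ⟨I, p₁, p₀, hp, hc⟩ := hG.exists_isConeEpi
      (TwoTerm.ofTorsionFree (isF_quotient_torsion (t := t) (M := R)))
    let h : (I →₀ K.Q ⧸ LinearMap.range K.j) →ₗ[R] R ⧸ t.torsion R :=
      p₁ ∘ₗ Finsupp.mapRange.linearMap e.toLinearMap
    let ν : (R ⧸ t.torsion R) →ₗ[R] TwoTerm.coneH hp := Submodule.mkQ _ ∘ₗ
      (LinearMap.inl R _ _).codRestrict _ fun _ => Subsingleton.elim _ _
    have hν : ∀ r, ν r = 0 ↔ ∃ a : I →₀ G.A, p₁ a = r ∧ ∀ i, G.d (a i) = 0 := fun r => by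
      refine (Submodule.Quotient.mk_eq_zero _).trans ⟨?_, ?_⟩
      · rintro ⟨a, ha⟩
        have ha' := congrArg Subtype.val ha
        exact ⟨a, congrArg Prod.fst ha', fun i => DFunLike.congr_fun (congrArg Prod.snd ha') i⟩
      · rintro ⟨a, rfl, ha⟩
        exact ⟨a, Subtype.ext (Prod.ext rfl (Finsupp.ext ha))⟩
    have hνh : LinearMap.range (h ∘ₗ K.HNegOneIncl I) ≤ LinearMap.ker ν := by
      rintro _ ⟨y, rfl⟩
      exact (hν _).2 ⟨_, rfl, fun i => (hH _).1 (y i).2⟩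
    obtain ⟨J, π, hπ, -⟩ := hpres hc.isT
    refine ⟨I, h, ModuleCat.of R (TwoTerm.coneH hp), Submodule.liftQ _ ν hνh, ⟨J, π, hπ⟩, ?_⟩
    rw [injective_iff_map_eq_zero]
    intro x hx
    obtain ⟨r, rfl⟩ := Submodule.mkQ_surjective _ x
    obtain ⟨a, rfl, ha⟩ := (hν r).1 hx
    obtain ⟨y, hy⟩ := Finsupp.exists_mapRange_eq K.HNegOne.subtype
      (Finsupp.mapRange.linearMap e.symm.toLinearMap a) fun i =>
        ⟨⟨e.symm (a i), (hH _).2 (by rw [LinearEquiv.apply_symm_apply, ha])⟩, rfl⟩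
    refine (Submodule.Quotient.mk_eq_zero _).2 ⟨y, ?_⟩
    have h1 : K.HNegOneIncl I y = Finsupp.mapRange.linearMap e.symm.toLinearMap a := hy
    show p₁ (Finsupp.mapRange.linearMap e.toLinearMap (K.HNegOneIncl I y)) = p₁ a
    rw [h1]
    congr 1
    ext i
    simp
  · exact inferInstanceAs (Module.Projective R (Fin n → R))
  · exact Submodule.subtype_injective _

end TorsionPair

theorem mainTheorem5 (R : Type u) [Ring R] [HasDerivedCategory.{w} (ModuleCat.{u} R)]
    (t : TorsionPair (ModuleCat.{u} R)) :
    IsModuleCategory.{u} t.Heart ↔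
      ∃ G : ThreeTermComplex R,
        (t.T = Pres G.H0 ∧ Pres G.H0 ≤ KerExtOne G.H0) ∧
        (Module.Finite R G.Q ∧ Module.Projective R G.Q ∧
          Module.Finite R G.P ∧ Module.Projective R G.P ∧
          Function.Injective G.j ∧ t.F (ModuleCat.of R G.HNegOne)) ∧
        G.HNegOne ≤ reject t.T (G.Q ⧸ LinearMap.range G.j) ∧
        t.F ≤ KerExtOne G.cokerJ ∧
        ∃ (I : Type u) (h : (I →₀ G.Q ⧸ LinearMap.range G.j) →ₗ[R] R ⧸ t.torsion R),
          SubGen G.H0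
            (ModuleCat.of R ((R ⧸ t.torsion R) ⧸ LinearMap.range (h ∘ₗ G.HNegOneIncl I))) := by
  rw [TorsionPair.TwoTerm.isModuleCategory_heart_iff]
  constructor
  · intro h
    obtain ⟨G, hG, hQ, hj⟩ := TorsionPair.exists_isTiltingComplex h
    exact ⟨G, ⟨hG.eq_pres, hG.pres_le⟩, ⟨hG.finite_Q, hQ, hG.finite_P, hG.projective_P, hj,
      hG.isF⟩, hG.le_reject, hG.le_kerExtOne, hG.exists_subGen⟩
  · rintro ⟨G, ⟨h₁, h₂⟩, ⟨h₃, -, h₅, h₆, -, h₈⟩, h₉, h₁₀, h₁₁⟩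
    exact (TorsionPair.IsTiltingComplex.mk h₁ h₂ h₃ h₅ h₆ h₈ h₉ h₁₀ h₁₁).isTilting.isModuleCategory
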